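/- A \emph{prop} is a strict symmetric monoidal category whose objects are the natural numbers, with product $+$ given by addition on objects and symmetry $\mathsf{swap}_{m,n}\colon m+n\to n+m$; an isomorphism of props is an identity-on-objects strict symmetric monoidal isomorphism. A \emph{controllable prop} (crop) $(\mathbf P,+,0,x)$ is a prop all of whose morphisms are endomorphisms, with a distinguished $x\colon 1\to 1$ such that $x\circ x=\mathrm{id}_1$. The \emph{controlled prop} $\mathbf{cP}$ is the prop freely generated by the prop $\mathbf P$ and operators $C^0,C^1$ sending $f\colon n\to n$ to $C^b(f)\colon 1+n\to 1+n$, subject to the following equations for all $m,n$ and $f,g,f_1,f_2\colon n\to n$: $C^1(g\circ f)=C^1(g)\circ C^1(f)$; $C^1(\mathrm{id}_n)=\mathrm{id}_{1+n}$; $C^1(f+\mathrm{id}_m)=C^1(f)+\mathrm{id}_m$; $(x+\mathrm{id}_n)\circ C^0(f)\circ(x+\mathrm{id}_n)=C^1(f)$; $C^0(f)\circ C^1(f)=\mathrm{id}_1+f$; $C^0(f_1)\circ C^1(f_2)=C^1(f_2)\circ C^0(f_1)$; $C^1(x)\circ\mathsf{swap}_{1,1}\circ C^1(x)\circ\mathsf{swap}_{1,1}\circ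 C^1(x)=\mathsf{swap}_{1,1}$; $(\mathsf{swap}_{1,1}+\mathrm{id}_n)\circ C^1(C^1(f))=C^1(C^1(f))\circ(\mathsf{swap}_{1,1}+\mathrm{id}_n)$. In a prop whose product is written $\oplus$, with symmetry $\gamma$, let $s_{m,n}\colon mn\to nm$ be the composite of symmetries $\gamma$ and identities that realises the permutation $an+b\mapsto bm+a$ ($a<m$, $b<n$), and for $f\colon k\to l$ and $h\colon m\to n$ put $$f\otimes h = s_{n,l}\circ f^{\oplus n}\circ s_{k,n}\circ h^{\oplus k}\colon km\to ln .$$ Let $\mathbf P$ be presented as a prop by generators $G$ and relations $R$. The \emph{rigged crop} $(\overline{\mathbf P},\oplus,0)$ is the prop generated by one $\widetilde g\colon 2^k\to 2^l$ for each $g\colon k\to l$ in $G$. Extend $\widetilde{\,\cdot\,}$ to expressions over $G$ by $\widetilde{\mathrm{id}_n}=\mathrm{id}_{2^n}$, $\widetilde{g\circ f}=\widetilde g\circ\widetilde f$, $\widetilde{f+h}=\widetilde f\otimes\widetilde h$ and $\widetilde{\mathsf{swap}_{m,n}}=s_{2^m,2^n}$. The relations of $\overline{\mathbf P}$ are: $\widetilde{f+\mathrm{id}_n}\circ\widetilde{\mathrm{id}_k+h}=\widetilde{\mathrm{id}_l+h}\circ\widetilde{f+\mathrm{id}_m}$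 for all $f\colon k\to l$ and $h\colon m\to n$ in $G$; $\widetilde f=\widetilde h$ for every relation $f=h$ in $R$; and $\widetilde x=\gamma_{1,1}$, where $x$ is written as an expression over $G$. Let $\overline{\mathbf P}_2$ be the full subcategory of $\overline{\mathbf P}$ on the objects $2^n$, with product $\otimes$, symmetry $s$, and the object $2^n$ named $n$. \textbf{Theorem.} Let $\mathbf P$ be a controllable prop with any presentation. Then $\overline{\mathbf P}_2$ is a prop, and there is an isomorphism of props $A\colon\mathbf{cP}\to\overline{\mathbf P}_2$ such that $A(x)=\gamma_{1,1}$, $A(g)=\widetilde g$ for every generator $g\in G$, and, for every $f\colon n\to n$ in $\mathbf{cP}$, $$A(C^1(f))=\mathrm{id}_{2^n}\oplus A(f),\qquad A(C^0(f))=A(f)\oplus\mathrm{id}_{2^n}.$$ -/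

import Mathlib

universe u v

/-- The data of a prop: a category on the natural numbers, a product which is addition on
objects, and a symmetry. `comp g f` is the composite `g ∘ f`. -/
structure PropData where
  /-- morphisms `m → n` -/
  Hom : ℕ → ℕ → Type u
  /-- identities -/
  id : ∀ n : ℕ, Hom n n
  /-- `comp g f = g ∘ f` -/
  comp : ∀ {l m n : ℕ}, Hom m n → Hom l m → Hom l n
  /-- the product `f + g` of morphisms -/
  add : ∀ {k l m n : ℕ}, Hom k l → Hom m n → Hom (k + m) (l + n)
  /-- the symmetry `m + n → n + m` -/
  swap : ∀ m n : ℕ, Hom (m + n) (n + m)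

namespace PropData

/-- Transport of a morphism along equalities of objects. The objects of a prop satisfy
`(k + l) + m = k + (l + m)` and so on, and this is how such equalities act on morphisms. -/
def cast (P : PropData.{u}) {m m' n n' : ℕ} (hm : m = m') (hn : n = n') (f : P.Hom m n) :
    P.Hom m' n' :=
  hm ▸ hn ▸ f

/-- The laws of a strict symmetric monoidal category on the natural numbers with product `+`. -/
structure IsProp (P : PropData.{u}) : Prop where
  id_comp : ∀ {m n : ℕ} (f : P.Hom m n), P.comp (P.id n) f = f
  comp_id : ∀ {m n : ℕ} (f : P.Hom m n), P.comp f (P.id m) = f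
  comp_assoc : ∀ {k l m n : ℕ} (h : P.Hom m n) (g : P.Hom l m) (f : P.Hom k l),
    P.comp (P.comp h g) f = P.comp h (P.comp g f)
  add_id : ∀ m n : ℕ, P.add (P.id m) (P.id n) = P.id (m + n)
  add_comp : ∀ {k l m k' l' m' : ℕ} (g : P.Hom l m) (f : P.Hom k l) (g' : P.Hom l' m')
    (f' : P.Hom k' l'),
    P.add (P.comp g f) (P.comp g' f') = P.comp (P.add g g') (P.add f f')
  add_assoc : ∀ {k l m k' l' m' : ℕ} (f : P.Hom k k') (g : P.Hom l l') (h : P.Hom m m'),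
    P.cast (Nat.add_assoc k l m) (Nat.add_assoc k' l' m') (P.add (P.add f g) h) =
      P.add f (P.add g h)
  zero_add : ∀ {m n : ℕ} (f : P.Hom m n),
    P.cast (Nat.zero_add m) (Nat.zero_add n) (P.add (P.id 0) f) = f
  add_zero : ∀ {m n : ℕ} (f : P.Hom m n),
    P.cast (Nat.add_zero m) (Nat.add_zero n) (P.add f (P.id 0)) = f
  swap_natural : ∀ {k l m n : ℕ} (f : P.Hom k l) (g : P.Hom m n),
    P.comp (P.swap l n) (P.add f g) = P.comp (P.add g f) (P.swap k m)
  swap_swap : ∀ m n : ℕ, P.comp (P.swap n m) (P.swap m n) = P.id (m + n)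
  swap_add : ∀ k m n : ℕ,
    P.swap k (m + n) =
      P.cast (Nat.add_assoc k m n) (Nat.add_assoc m n k).symm
        (P.comp
          (P.cast (Nat.add_assoc m k n).symm rfl (P.add (P.id m) (P.swap k n)))
          (P.add (P.swap k m) (P.id n)))

/-- An isomorphism of props: identity on objects, bijective on morphisms, preserving
composition, identities, the product and the symmetry. -/
structure Iso (P : PropData.{u}) (Q : PropData.{v}) where
  /-- the action on morphisms -/
  map : ∀ {m n : ℕ}, P.Hom m n → Q.Hom m n
  bijective : ∀ m n : ℕ, Function.Bijective (map : P.Hom m n → Q.Hom m n)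
  map_id : ∀ n : ℕ, map (P.id n) = Q.id n
  map_comp : ∀ {l m n : ℕ} (g : P.Hom m n) (f : P.Hom l m),
    map (P.comp g f) = Q.comp (map g) (map f)
  map_add : ∀ {k l m n : ℕ} (f : P.Hom k l) (g : P.Hom m n),
    map (P.add f g) = Q.add (map f) (map g)
  map_swap : ∀ m n : ℕ, map (P.swap m n) = Q.swap m n

/-! ### Kronecker products

Here the product `add` is thought of as a direct sum `⊕` with symmetry `γ`, and
`a n + b`, with `a < m` and `b < n`, is the position in `m * n` of the pair `(a, b)`. -/

/-- The `N`-fold sum `f ⊕ ⋯ ⊕ f`. -/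
def copies (P : PropData.{u}) {k l : ℕ} (f : P.Hom k l) : ∀ N : ℕ, P.Hom (N * k) (N * l)
  | 0 => P.cast (Nat.zero_mul k).symm (Nat.zero_mul l).symm (P.id 0)
  | N + 1 => P.cast (Nat.succ_mul N k).symm (Nat.succ_mul N l).symm (P.add (P.copies f N) f)

/-- The left distributor `m ⊗ (n ⊕ 1) → (m ⊗ n) ⊕ m`: it sends position `a (n + 1) + b` to
`a n + b` if `b < n`, and to `m n + a` if `b = n`. It is defined by recursion on `m`, as
`(id ⊕ γ ⊕ id) ∘ (δ ⊕ id)`. -/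
def leftDist (P : PropData.{u}) (n : ℕ) : ∀ m : ℕ, P.Hom (m * (n + 1)) (m * n + m)
  | 0 => P.cast (by simp) (by simp) (P.id 0)
  | m + 1 =>
    P.comp
      (P.cast (m := m * n + (m + n) + 1) (m' := m * n + m + (n + 1))
        (n := m * n + (n + m) + 1) (n' := (m + 1) * n + (m + 1)) (by ring) (by ring)
        (P.add (P.add (P.id (m * n)) (P.swap m n)) (P.id 1)))
      (P.cast (m := m * (n + 1) + (n + 1)) (m' := (m + 1) * (n + 1)) (by ring) rfl
        (P.add (P.leftDist n m) (P.id (n + 1))))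

/-- The symmetry `s : m ⊗ n → n ⊗ m` of the tensor product, written with the symmetry of the
direct sum: it sends position `a n + b` to `b m + a`. By recursion on `n`, it is
`(s ⊕ id) ∘ δ`. -/
def mulSwap (P : PropData.{u}) (m : ℕ) : ∀ n : ℕ, P.Hom (m * n) (n * m)
  | 0 => P.cast (Nat.mul_zero m).symm (Nat.zero_mul m).symm (P.id 0)
  | n + 1 =>
    P.cast rfl (Nat.succ_mul n m).symm
      (P.comp (P.add (P.mulSwap m n) (P.id m)) (P.leftDist n m))

/-- The tensor product
`f ⊗ h = s_{n,l} ∘ (f ⊕ ⋯ ⊕ f) ∘ s_{k,n} ∘ (h ⊕ ⋯ ⊕ h)` of `f : k → l` and `h : m → n`,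
with `n` copies of `f` and `k` copies of `h`. -/
def kron (P : PropData.{u}) {k l m n : ℕ} (f : P.Hom k l) (h : P.Hom m n) :
    P.Hom (k * m) (l * n) :=
  P.comp (P.mulSwap n l) (P.comp (P.copies f n) (P.comp (P.mulSwap k n) (P.copies h k)))

/-- The full subcategory on the powers of `2`, with the tensor product and its symmetry; the
object `2 ^ n` is named `n`. -/
def powTwo (P : PropData.{u}) : PropData.{u} where
  Hom m n := P.Hom (2 ^ m) (2 ^ n)
  id n := P.id (2 ^ n)
  comp g f := P.comp g f
  add {k l m n} f h := P.cast (pow_add 2 k m).symm (pow_add 2 l n).symm (P.kron f h)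
  swap m n := P.cast (pow_add 2 m n).symm (pow_add 2 n m).symm (P.mulSwap (2 ^ m) (2 ^ n))

end PropData

/-- A prop. -/
structure StrictProp extends PropData.{u} where
  isProp : toPropData.IsProp

/-- A controllable prop: every morphism is an endomorphism, and `x : 1 → 1` is a distinguished
involution. -/
structure ControllableProp extends StrictProp.{u} where
  endo : ∀ {m n : ℕ}, Hom m n → m = n
  x : Hom 1 1
  x_involutive : comp x x = id 1

/-! ### Props presented by generators and relations -/

/-- Formal prop expressions over generators `G`. -/
inductive PropTerm (G : ℕ → ℕ → Type u) : ℕ → ℕ → Type u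
  | gen {m n : ℕ} (g : G m n) : PropTerm G m n
  | id (n : ℕ) : PropTerm G n n
  | comp {l m n : ℕ} (g : PropTerm G m n) (f : PropTerm G l m) : PropTerm G l n
  | add {k l m n : ℕ} (f : PropTerm G k l) (g : PropTerm G m n) : PropTerm G (k + m) (l + n)
  | swap (m n : ℕ) : PropTerm G (m + n) (n + m)

namespace PropTerm

/-- The formal expressions, before any law is imposed. -/
abbrev data (G : ℕ → ℕ → Type u) : PropData.{u} where
  Hom := PropTerm G
  id := PropTerm.id
  comp := PropTerm.comp
  add := PropTerm.add
  swap := PropTerm.swap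

/-- The value of a formal expression under an interpretation of the generators. -/
def eval {G : ℕ → ℕ → Type v} (P : PropData.{u}) (i : ∀ m n : ℕ, G m n → P.Hom m n) :
    ∀ {m n : ℕ}, PropTerm G m n → P.Hom m n
  | _, _, gen g => i _ _ g
  | _, _, id n => P.id n
  | _, _, comp g f => P.comp (eval P i g) (eval P i f)
  | _, _, add f g => P.add (eval P i f) (eval P i g)
  | _, _, swap m n => P.swap m n

/-- The least congruence on formal expressions that contains `R` and the laws of a prop. -/
inductive Cong {G : ℕ → ℕ → Type u} (R : ∀ m n : ℕ, PropTerm G m n → PropTerm G m n → Prop) :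
    ∀ {m n : ℕ}, PropTerm G m n → PropTerm G m n → Prop
  | rel {m n : ℕ} {s t : PropTerm G m n} : R m n s t → Cong R s t
  | refl {m n : ℕ} (s : PropTerm G m n) : Cong R s s
  | symm {m n : ℕ} {s t : PropTerm G m n} : Cong R s t → Cong R t s
  | trans {m n : ℕ} {s t r : PropTerm G m n} : Cong R s t → Cong R t r → Cong R s r
  | comp_congr {l m n : ℕ} {s s' : PropTerm G m n} {t t' : PropTerm G l m} :
      Cong R s s' → Cong R t t' → Cong R (comp s t) (comp s' t')
  | add_congr {k l m n : ℕ} {s s' : PropTerm G k l} {t t' : PropTerm G m n} :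
      Cong R s s' → Cong R t t' → Cong R (add s t) (add s' t')
  | id_comp {m n : ℕ} (f : PropTerm G m n) : Cong R (comp (id n) f) f
  | comp_id {m n : ℕ} (f : PropTerm G m n) : Cong R (comp f (id m)) f
  | comp_assoc {k l m n : ℕ} (h : PropTerm G m n) (g : PropTerm G l m) (f : PropTerm G k l) :
      Cong R (comp (comp h g) f) (comp h (comp g f))
  | add_id (m n : ℕ) : Cong R (add (id m) (id n)) (id (m + n))
  | add_comp {k l m k' l' m' : ℕ} (g : PropTerm G l m) (f : PropTerm G k l)
      (g' : PropTerm G l' m') (f' : PropTerm G k' l') :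
      Cong R (add (comp g f) (comp g' f')) (comp (add g g') (add f f'))
  | add_assoc {k l m k' l' m' : ℕ} (f : PropTerm G k k') (g : PropTerm G l l')
      (h : PropTerm G m m') :
      Cong R
        ((data G).cast (Nat.add_assoc k l m) (Nat.add_assoc k' l' m') (add (add f g) h))
        (add f (add g h))
  | zero_add {m n : ℕ} (f : PropTerm G m n) :
      Cong R ((data G).cast (Nat.zero_add m) (Nat.zero_add n) (add (id 0) f)) f
  | add_zero {m n : ℕ} (f : PropTerm G m n) :
      Cong R ((data G).cast (Nat.add_zero m) (Nat.add_zero n) (add f (id 0))) f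
  | swap_natural {k l m n : ℕ} (f : PropTerm G k l) (g : PropTerm G m n) :
      Cong R (comp (swap l n) (add f g)) (comp (add g f) (swap k m))
  | swap_swap (m n : ℕ) : Cong R (comp (swap n m) (swap m n)) (id (m + n))
  | swap_add (k m n : ℕ) :
      Cong R (swap k (m + n))
        ((data G).cast (Nat.add_assoc k m n) (Nat.add_assoc m n k).symm
          (comp
            ((data G).cast (Nat.add_assoc m k n).symm rfl (add (id m) (swap k n)))
            (add (swap k m) (id n))))

/-- `Cong R` as an equivalence relation. -/
def setoid {G : ℕ → ℕ → Type u} (R : ∀ m n : ℕ, PropTerm G m n → PropTerm G m n → Prop)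
    (m n : ℕ) : Setoid (PropTerm G m n) where
  r := Cong R
  iseqv := ⟨Cong.refl, Cong.symm, Cong.trans⟩

end PropTerm

/-- The data of the prop generated by `G` subject to `R`. -/
def presentedData (G : ℕ → ℕ → Type u)
    (R : ∀ m n : ℕ, PropTerm G m n → PropTerm G m n → Prop) : PropData.{u} where
  Hom m n := Quotient (PropTerm.setoid R m n)
  id n := Quotient.mk _ (PropTerm.id n)
  comp := Quotient.map₂ PropTerm.comp fun _ _ h _ _ h' => PropTerm.Cong.comp_congr h h'
  add := Quotient.map₂ PropTerm.add fun _ _ h _ _ h' => PropTerm.Cong.add_congr h h'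
  swap m n := Quotient.mk _ (PropTerm.swap m n)

theorem presentedData_cast_mk (G : ℕ → ℕ → Type u)
    (R : ∀ m n : ℕ, PropTerm G m n → PropTerm G m n → Prop) {m m' n n' : ℕ} (hm : m = m')
    (hn : n = n') (t : PropTerm G m n) :
    (presentedData G R).cast hm hn (Quotient.mk (PropTerm.setoid R m n) t) =
      Quotient.mk (PropTerm.setoid R m' n') ((PropTerm.data G).cast hm hn t) := by
  subst hm hn
  rfl

/-- The prop generated by `G` subject to `R`. -/
def presentedProp (G : ℕ → ℕ → Type u)
    (R : ∀ m n : ℕ, PropTerm G m n → PropTerm G m n → Prop) : StrictProp.{u} where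
  toPropData := presentedData G R
  isProp := {
    id_comp := by rintro m n ⟨f⟩; exact Quotient.sound (.id_comp f)
    comp_id := by rintro m n ⟨f⟩; exact Quotient.sound (.comp_id f)
    comp_assoc := by rintro k l m n ⟨h⟩ ⟨g⟩ ⟨f⟩; exact Quotient.sound (.comp_assoc h g f)
    add_id := fun m n => Quotient.sound (.add_id m n)
    add_comp := by
      rintro k l m k' l' m' ⟨g⟩ ⟨f⟩ ⟨g'⟩ ⟨f'⟩
      exact Quotient.sound (.add_comp g f g' f')
    add_assoc := by
      rintro k l m k' l' m' ⟨f⟩ ⟨g⟩ ⟨h⟩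
      exact (presentedData_cast_mk G R _ _ _).trans (Quotient.sound (.add_assoc f g h))
    zero_add := by
      rintro m n ⟨f⟩
      exact (presentedData_cast_mk G R _ _ _).trans (Quotient.sound (.zero_add f))
    add_zero := by
      rintro m n ⟨f⟩
      exact (presentedData_cast_mk G R _ _ _).trans (Quotient.sound (.add_zero f))
    swap_natural := by rintro k l m n ⟨f⟩ ⟨g⟩; exact Quotient.sound (.swap_natural f g)
    swap_swap := fun m n => Quotient.sound (.swap_swap m n)
    swap_add := by
      intro k m n
      refine (Quotient.sound (PropTerm.Cong.swap_add (R := R) k m n)).trans ?_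
      rw [← presentedData_cast_mk]
      congr 1
      refine (congrArg (fun z => (presentedData G R).comp z
        ((presentedData G R).add ((presentedData G R).swap k m) ((presentedData G R).id n)))
        (presentedData_cast_mk G R _ _ _)).symm }

/-- `P` is presented by generators `Gen`, interpreted in `P`, and relations `Rel`: every
morphism is the value of an expression, and two expressions have the same value exactly when
the relations and the laws of a prop identify them. -/
structure PropPresentation (P : StrictProp.{u}) where
  Gen : ℕ → ℕ → Type v
  Rel : ∀ m n : ℕ, PropTerm Gen m n → PropTerm Gen m n → Prop
  interp : ∀ m n : ℕ, Gen m n → P.Hom m n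
  surjective : ∀ {m n : ℕ} (f : P.Hom m n),
    ∃ t : PropTerm Gen m n, t.eval P.toPropData interp = f
  eval_eq_iff : ∀ {m n : ℕ} (s t : PropTerm Gen m n),
    s.eval P.toPropData interp = t.eval P.toPropData interp ↔ PropTerm.Cong Rel s t

/-! ### The controlled prop -/

/-- Formal expressions over the morphisms of `P` and the control operators;
`ctrl true f` is `C¹(f)` and `ctrl false f` is `C⁰(f)`. -/
inductive CtrlTerm (P : PropData.{u}) : ℕ → ℕ → Type u
  | of {m n : ℕ} (f : P.Hom m n) : CtrlTerm P m n
  | id (n : ℕ) : CtrlTerm P n n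
  | comp {l m n : ℕ} (g : CtrlTerm P m n) (f : CtrlTerm P l m) : CtrlTerm P l n
  | add {k l m n : ℕ} (f : CtrlTerm P k l) (g : CtrlTerm P m n) : CtrlTerm P (k + m) (l + n)
  | swap (m n : ℕ) : CtrlTerm P (m + n) (n + m)
  | ctrl (b : Bool) {n : ℕ} (f : CtrlTerm P n n) : CtrlTerm P (1 + n) (1 + n)

namespace CtrlTerm

/-- The formal expressions, before any law is imposed. -/
abbrev data (P : PropData.{u}) : PropData.{u} where
  Hom := CtrlTerm P
  id := CtrlTerm.id
  comp := CtrlTerm.comp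
  add := CtrlTerm.add
  swap := CtrlTerm.swap

/-- The least congruence on formal expressions that contains the laws of a prop, the prop
structure of `P`, and the eight control equations. -/
inductive Cong (P : ControllableProp.{u}) :
    ∀ {m n : ℕ}, CtrlTerm P.toPropData m n → CtrlTerm P.toPropData m n → Prop
  | refl {m n : ℕ} (s : CtrlTerm P.toPropData m n) : Cong P s s
  | symm {m n : ℕ} {s t : CtrlTerm P.toPropData m n} : Cong P s t → Cong P t s
  | trans {m n : ℕ} {s t r : CtrlTerm P.toPropData m n} :
      Cong P s t → Cong P t r → Cong P s r
  | comp_congr {l m n : ℕ} {s s' : CtrlTerm P.toPropData m n}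
      {t t' : CtrlTerm P.toPropData l m} :
      Cong P s s' → Cong P t t' → Cong P (comp s t) (comp s' t')
  | add_congr {k l m n : ℕ} {s s' : CtrlTerm P.toPropData k l}
      {t t' : CtrlTerm P.toPropData m n} :
      Cong P s s' → Cong P t t' → Cong P (add s t) (add s' t')
  | ctrl_congr (b : Bool) {n : ℕ} {s t : CtrlTerm P.toPropData n n} :
      Cong P s t → Cong P (ctrl b s) (ctrl b t)
  -- the laws of a prop
  | id_comp {m n : ℕ} (f : CtrlTerm P.toPropData m n) : Cong P (comp (id n) f) f
  | comp_id {m n : ℕ} (f : CtrlTerm P.toPropData m n) : Cong P (comp f (id m)) f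
  | comp_assoc {k l m n : ℕ} (h : CtrlTerm P.toPropData m n) (g : CtrlTerm P.toPropData l m)
      (f : CtrlTerm P.toPropData k l) :
      Cong P (comp (comp h g) f) (comp h (comp g f))
  | add_id (m n : ℕ) : Cong P (add (id m) (id n)) (id (m + n))
  | add_comp {k l m k' l' m' : ℕ} (g : CtrlTerm P.toPropData l m)
      (f : CtrlTerm P.toPropData k l) (g' : CtrlTerm P.toPropData l' m')
      (f' : CtrlTerm P.toPropData k' l') :
      Cong P (add (comp g f) (comp g' f')) (comp (add g g') (add f f'))
  | add_assoc {k l m k' l' m' : ℕ} (f : CtrlTerm P.toPropData k k')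
      (g : CtrlTerm P.toPropData l l') (h : CtrlTerm P.toPropData m m') :
      Cong P
        ((data P.toPropData).cast (Nat.add_assoc k l m) (Nat.add_assoc k' l' m')
          (add (add f g) h))
        (add f (add g h))
  | zero_add {m n : ℕ} (f : CtrlTerm P.toPropData m n) :
      Cong P ((data P.toPropData).cast (Nat.zero_add m) (Nat.zero_add n) (add (id 0) f)) f
  | add_zero {m n : ℕ} (f : CtrlTerm P.toPropData m n) :
      Cong P ((data P.toPropData).cast (Nat.add_zero m) (Nat.add_zero n) (add f (id 0))) f
  | swap_natural {k l m n : ℕ} (f : CtrlTerm P.toPropData k l)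
      (g : CtrlTerm P.toPropData m n) :
      Cong P (comp (swap l n) (add f g)) (comp (add g f) (swap k m))
  | swap_swap (m n : ℕ) : Cong P (comp (swap n m) (swap m n)) (id (m + n))
  | swap_add (k m n : ℕ) :
      Cong P (swap k (m + n))
        ((data P.toPropData).cast (Nat.add_assoc k m n) (Nat.add_assoc m n k).symm
          (comp
            ((data P.toPropData).cast (Nat.add_assoc m k n).symm rfl (add (id m) (swap k n)))
            (add (swap k m) (id n))))
  -- the prop structure of `P`
  | of_id (n : ℕ) : Cong P (of (P.id n)) (id n)
  | of_comp {l m n : ℕ} (g : P.Hom m n) (f : P.Hom l m) :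
      Cong P (of (P.comp g f)) (comp (of g) (of f))
  | of_add {k l m n : ℕ} (f : P.Hom k l) (g : P.Hom m n) :
      Cong P (of (P.add f g)) (add (of f) (of g))
  | of_swap (m n : ℕ) : Cong P (of (P.swap m n)) (swap m n)
  -- the control equations
  | composition {n : ℕ} (g f : CtrlTerm P.toPropData n n) :
      Cong P (ctrl true (comp g f)) (comp (ctrl true g) (ctrl true f))
  | identity (n : ℕ) : Cong P (ctrl true (id n)) (id (1 + n))
  | strength {n : ℕ} (m : ℕ) (f : CtrlTerm P.toPropData n n) :
      Cong P (ctrl true (add f (id m)))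
        ((data P.toPropData).cast (Nat.add_assoc 1 n m) (Nat.add_assoc 1 n m)
          (add (ctrl true f) (id m)))
  | colour {n : ℕ} (f : CtrlTerm P.toPropData n n) :
      Cong P (comp (add (of P.x) (id n)) (comp (ctrl false f) (add (of P.x) (id n))))
        (ctrl true f)
  | complementarity {n : ℕ} (f : CtrlTerm P.toPropData n n) :
      Cong P (comp (ctrl false f) (ctrl true f)) (add (id 1) f)
  | commutativity {n : ℕ} (f₁ f₂ : CtrlTerm P.toPropData n n) :
      Cong P (comp (ctrl false f₁) (ctrl true f₂)) (comp (ctrl true f₂) (ctrl false f₁))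
  | swap_eq :
      Cong P
        (comp (ctrl true (of P.x)) (comp (swap 1 1) (comp (ctrl true (of P.x))
          (comp (swap 1 1) (ctrl true (of P.x))))))
        (swap 1 1)
  | swap_coherence {n : ℕ} (f : CtrlTerm P.toPropData n n) :
      Cong P
        (comp
          ((data P.toPropData).cast (Nat.add_assoc 1 1 n) (Nat.add_assoc 1 1 n)
            (add (swap 1 1) (id n)))
          (ctrl true (ctrl true f)))
        (comp (ctrl true (ctrl true f))
          ((data P.toPropData).cast (Nat.add_assoc 1 1 n) (Nat.add_assoc 1 1 n)
            (add (swap 1 1) (id n))))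

/-- `Cong P` as an equivalence relation. -/
def setoid (P : ControllableProp.{u}) (m n : ℕ) : Setoid (CtrlTerm P.toPropData m n) where
  r := Cong P
  iseqv := ⟨Cong.refl, Cong.symm, Cong.trans⟩

theorem endo (P : ControllableProp.{u}) {m n : ℕ} (t : CtrlTerm P.toPropData m n) : m = n := by
  induction t with
  | of f => exact P.endo f
  | id n => rfl
  | comp g f hg hf => exact hf.trans hg
  | add f g hf hg => rw [hf, hg]
  | swap m n => exact Nat.add_comm m n
  | ctrl b f hf => rfl

end CtrlTerm

/-- The data of the controlled prop. -/
def controlledData (P : ControllableProp.{u}) : PropData.{u} where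
  Hom m n := Quotient (CtrlTerm.setoid P m n)
  id n := Quotient.mk _ (CtrlTerm.id n)
  comp := Quotient.map₂ CtrlTerm.comp fun _ _ h _ _ h' => CtrlTerm.Cong.comp_congr h h'
  add := Quotient.map₂ CtrlTerm.add fun _ _ h _ _ h' => CtrlTerm.Cong.add_congr h h'
  swap m n := Quotient.mk _ (CtrlTerm.swap m n)

theorem controlledData_cast_mk (P : ControllableProp.{u}) {m m' n n' : ℕ} (hm : m = m')
    (hn : n = n') (t : CtrlTerm P.toPropData m n) :
    (controlledData P).cast hm hn (Quotient.mk (CtrlTerm.setoid P m n) t) =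
      Quotient.mk (CtrlTerm.setoid P m' n') ((CtrlTerm.data P.toPropData).cast hm hn t) := by
  subst hm hn
  rfl

namespace ControllableProp

/-- The inclusion of `P` in its controlled prop. -/
def toControlled (P : ControllableProp.{u}) {m n : ℕ} (f : P.Hom m n) :
    (controlledData P).Hom m n :=
  Quotient.mk _ (CtrlTerm.of f)

/-- The controlled prop of `P`, which is again controllable. -/
def controlled (P : ControllableProp.{u}) : ControllableProp.{u} where
  toPropData := controlledData P
  isProp := {
    id_comp := by rintro m n ⟨f⟩; exact Quotient.sound (.id_comp f)
    comp_id := by rintro m n ⟨f⟩; exact Quotient.sound (.comp_id f)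
    comp_assoc := by rintro k l m n ⟨h⟩ ⟨g⟩ ⟨f⟩; exact Quotient.sound (.comp_assoc h g f)
    add_id := fun m n => Quotient.sound (.add_id m n)
    add_comp := by
      rintro k l m k' l' m' ⟨g⟩ ⟨f⟩ ⟨g'⟩ ⟨f'⟩
      exact Quotient.sound (.add_comp g f g' f')
    add_assoc := by
      rintro k l m k' l' m' ⟨f⟩ ⟨g⟩ ⟨h⟩
      exact (controlledData_cast_mk P _ _ _).trans (Quotient.sound (.add_assoc f g h))
    zero_add := by
      rintro m n ⟨f⟩
      exact (controlledData_cast_mk P _ _ _).trans (Quotient.sound (.zero_add f))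
    add_zero := by
      rintro m n ⟨f⟩
      exact (controlledData_cast_mk P _ _ _).trans (Quotient.sound (.add_zero f))
    swap_natural := by rintro k l m n ⟨f⟩ ⟨g⟩; exact Quotient.sound (.swap_natural f g)
    swap_swap := fun m n => Quotient.sound (.swap_swap m n)
    swap_add := by
      intro k m n
      refine (Quotient.sound (CtrlTerm.Cong.swap_add (P := P) k m n)).trans ?_
      rw [← controlledData_cast_mk]
      congr 1
      refine (congrArg (fun z => (controlledData P).comp z
        ((controlledData P).add ((controlledData P).swap k m) ((controlledData P).id n)))
        (controlledData_cast_mk P _ _ _)).symm }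
  endo := by rintro m n ⟨f⟩; exact CtrlTerm.endo P f
  x := P.toControlled P.x
  x_involutive := by
    refine (Quotient.sound (CtrlTerm.Cong.of_comp P.x P.x)).symm.trans ?_
    rw [P.x_involutive]
    exact Quotient.sound (.of_id 1)

/-- The control operators of the controlled prop: `C true` is `C¹` and `C false` is `C⁰`. -/
def C (P : ControllableProp.{u}) (b : Bool) {n : ℕ} :
    P.controlled.Hom n n → P.controlled.Hom (1 + n) (1 + n) :=
  Quotient.map (CtrlTerm.ctrl b) fun _ _ h => CtrlTerm.Cong.ctrl_congr b h

end ControllableProp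

/-! ### The rigged crop -/

/-- The generators `g̃ : 2 ^ k → 2 ^ l`, one for each generator `g : k → l`. -/
inductive RigGen (G : ℕ → ℕ → Type u) : ℕ → ℕ → Type u
  | tilde {k l : ℕ} (g : G k l) : RigGen G (2 ^ k) (2 ^ l)

/-- The translation `f ↦ f̃` of expressions: sums of `f` and `h` become tensor products of `f̃`
and `h̃`, and symmetries become symmetries of the tensor product. -/
def PropTerm.tilde {G : ℕ → ℕ → Type u} :
    ∀ {m n : ℕ}, PropTerm G m n → (PropTerm.data (RigGen G)).powTwo.Hom m n :=
  PropTerm.eval (PropTerm.data (RigGen G)).powTwo fun _ _ g => PropTerm.gen (RigGen.tilde g)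

/-- The relations of the rigged crop. Here `R` are the relations of the base prop and `X` is an
expression for its involution. -/
inductive RigRel {G : ℕ → ℕ → Type u}
    (R : ∀ m n : ℕ, PropTerm G m n → PropTerm G m n → Prop) (X : PropTerm G 1 1) :
    ∀ m n : ℕ, PropTerm (RigGen G) m n → PropTerm (RigGen G) m n → Prop
  | interchange {k l m n : ℕ} (f : G k l) (h : G m n) :
      RigRel R X (2 ^ (k + m)) (2 ^ (l + n))
        (.comp (PropTerm.tilde (.add (.gen f) (.id n))) (PropTerm.tilde (.add (.id k) (.gen h))))
        (.comp (PropTerm.tilde (.add (.id l) (.gen h))) (PropTerm.tilde (.add (.gen f) (.id m))))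
  | base {m n : ℕ} {s t : PropTerm G m n} :
      R m n s t → RigRel R X (2 ^ m) (2 ^ n) s.tilde t.tilde
  | not : RigRel R X (2 ^ 1) (2 ^ 1) X.tilde
      ((PropTerm.data (RigGen G)).cast (pow_one 2).symm (pow_one 2).symm (.swap 1 1))

/-- The rigged crop of the prop with generators `G`, relations `R` and involution `X`; its
product is the direct sum `⊕`. -/
def riggedCrop (G : ℕ → ℕ → Type u)
    (R : ∀ m n : ℕ, PropTerm G m n → PropTerm G m n → Prop) (X : PropTerm G 1 1) :
    StrictProp.{u} :=
  presentedProp (RigGen G) (RigRel R X)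

/-- The class in the rigged crop of the generator `g̃`. -/
def riggedGen {G : ℕ → ℕ → Type u}
    (R : ∀ m n : ℕ, PropTerm G m n → PropTerm G m n → Prop) (X : PropTerm G 1 1) {k l : ℕ}
    (g : G k l) : (riggedCrop G R X).Hom (2 ^ k) (2 ^ l) :=
  Quotient.mk (PropTerm.setoid (RigRel R X) (2 ^ k) (2 ^ l)) (PropTerm.gen (RigGen.tilde g))

theorem two_pow_add_self (n : ℕ) : 2 ^ n + 2 ^ n = 2 ^ (1 + n) := by
  ring

/-!
The two directions of the isomorphism rest on one device: a morphism `m → n` is placed at a sequence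
of `m` distinct positions of a larger object, and is studied through the operations obtained in this
way. A `Realisation` of a prop is such an action on positions in a set `X`, in a monoid where the
permutations of `X` act too. All props here have endomorphisms only, and such a prop is realised in
its own endomorphism monoids (`StrictProp.selfRealisation`), after its symmetries have been shown to
give homomorphisms `permHom` from the symmetric groups.

*From the controlled prop to the rigged crop.* For positions arranged in a grid, `f ⊗ h` is a copy
of `f` on each column times a copy of `h` on each row (`Realisation.val_kron`). Hence the tensor
product is always associative, and it is functorial with natural symmetry as soon as copies on the
columns commute with copies on the rows. In the rigged crop this `Interchange` is imposed on
generators, and it propagates through composites and sums, and to symmetries, which merely permute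
the rows (`riggedCrop_interchange`). So the powers of `2` form a prop (`riggedCrop_powTwo_isProp`).
The block sums `id ⊕ f` and `f ⊕ id` satisfy the control equations, and interpreting `C¹` and `C⁰`
by them defines a map of props `PropPresentation.ctrlMap`.

*The inverse.* The endomorphism monoids of the controlled prop form a `ControlTower`. In any such
tower, the negation of a first wire controlled by a word `a` in the other wires (`mcx`) behaves as
the transposition of the words `(false, a)` and `(true, a)`. Together with the transpositions of
words with equal first bits, which are controlled transpositions of shorter words, these generate
an action `ControlTower.rho` of all permutations of the words of length `n`, built by recursion on
`n` from the presentation of the symmetric group by its transpositions. Under it negation of a bit,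
exchange of bits and permutations of wires are what they should be (`rho_flip`, `rho_exch`,
`rho_wire`). A permutation that fixes the words beginning with `k` ones commutes with the operations
under `k` controls (`rho_comm_Cpow`), so an operation on `k` wires can be placed at any `2 ^ k`
distinct words, by conjugating a multiply controlled operation with a permutation of words
(`ControlTower.place`). Letting `g̃` act as `g` placed in this way gives a realisation of the
expressions of the rigged crop on words. There, copies on the rows and columns of the grid of all
words of length `k + m` are the sums `id + h` and `f + id` (`wordRealisation_rows`,
`wordRealisation_cols`), so tensor products become sums; therefore the relations of the rigged crop
hold (`wordRealisation_val_eq_of_rel`), and the action of a morphism at all words is a map of props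
`PropPresentation.rigMap`, with `rigMap_ctrlMap` as its composite with `ctrlMap`. So `ctrlMap` is
injective.

*Surjectivity.* The image of `ctrlMap` contains all permutations of `2 ^ n` positions, since `rho`
is sent to the action of permutations of positions (`isWordPerm_rho`), and it contains each
generator at the last positions, as an iterated control. By conjugation it contains the generators
at all positions, and by induction on expressions every morphism placed at any of the positions
(`exists_ctrlHom_eq_val`), in particular every endomorphism of `2 ^ n`.
-/

open Equiv

/-! ### Homomorphisms out of symmetric groups -/

/-- A homomorphism on the permutations of `ι` extends to the permutations of `ι` with one more
point `none`, given elements `d a` to be the images of the transpositions `(none a)`. Every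
permutation of `Option ι` is uniquely a transposition `(none i)` times a permutation of `ι`, so the
extension is determined, and the hypotheses are what its multiplicativity needs. -/
theorem exists_hom_perm_option {ι M : Type*} [DecidableEq ι] [Monoid M] (ρ : Perm ι →* M)
    (d : ι → M) (hd : ∀ a, d a * d a = 1)
    (hconj : ∀ σ a, SemiconjBy (ρ σ) (d a) (d (σ a)))
    (hmul : ∀ a b, a ≠ b → d a * d b = ρ (swap a b) * d a) :
    ∃ ρ' : Perm (Option ι) →* M, (∀ σ : Perm ι, ρ' (optionCongr σ) = ρ σ) ∧
      ∀ a, ρ' (swap none (some a)) = d a := by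
  let D : Option ι → M := fun i => i.elim 1 d
  let f : Perm (Option ι) → M := fun σ => D (σ none) * ρ (removeNone σ)
  have hsurj : ∀ σ : Perm (Option ι), ∃ i τ, σ = swap none i * optionCongr τ := fun σ =>
    ⟨_, _, (Perm.decomposeOption.symm_apply_apply σ).symm⟩
  have hf : ∀ i τ, f (swap none i * optionCongr τ) = D i * ρ τ := by
    intro i τ
    have := Perm.decomposeOption.apply_symm_apply (i, τ)
    have h1 := congrArg Prod.fst this
    have h2 := congrArg Prod.snd this
    simp only [Perm.decomposeOption_apply, Perm.decomposeOption_symm_apply] at h1 h2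
    change D _ * ρ _ = _
    rw [h1, h2]
  have h1 : f 1 = 1 := by
    have := hf none 1
    rw [map_one, swap_self, optionCongr_one] at this
    exact this.trans (one_mul 1)
  have hsw : ∀ (σ : Perm ι) (b : ι), (optionCongr σ : Perm (Option ι)) * swap none (some b) =
      swap none (some (σ b)) * optionCongr σ := by
    intro σ b
    rw [Equiv.mul_swap_eq_swap_mul]
    simp
  have hoc : ∀ σ τ : Perm ι, (optionCongr (σ * τ) : Perm (Option ι)) =
      optionCongr σ * optionCongr τ := by
    intro σ τ
    ext1 x
    cases x <;> rfl
  have hmulf : ∀ σ τ, f (σ * τ) = f σ * f τ := by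
    intro σ τ
    obtain ⟨i, σ, rfl⟩ := hsurj σ
    obtain ⟨j, τ, rfl⟩ := hsurj τ
    rw [hf, hf]
    rcases j with _ | b
    · have : swap none i * optionCongr σ * (swap none none * optionCongr τ) =
          swap none i * optionCongr (σ * τ) := by
        rw [hoc, swap_self]; rfl
      rw [this, hf, map_mul]
      simp [D, mul_assoc]
    · have e1 : swap none i * optionCongr σ * (swap none (some b) * optionCongr τ) =
          swap none i * swap none (some (σ b)) * optionCongr (σ * τ) := by
        rw [mul_assoc, ← mul_assoc (optionCongr σ), hsw, hoc]; simp only [mul_assoc]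
      have e2 : D i * ρ σ * (D (some b) * ρ τ) = D i * d (σ b) * ρ (σ * τ) := by
        rw [mul_assoc, ← mul_assoc (ρ σ), map_mul]
        have := (hconj σ b).eq
        change D i * (ρ σ * d b * ρ τ) = _
        rw [this]; simp only [mul_assoc]
      rw [e1, e2]
      rcases i with _ | a
      · rw [swap_self]
        change f (1 * swap none (some (σ b)) * optionCongr (σ * τ)) = 1 * d (σ b) * _
        rw [one_mul, one_mul, hf]; rfl
      · by_cases hab : a = σ b
        · subst hab
          have := hf none (σ * τ)
          rw [swap_self] at this
          change f (1 * _) = 1 * _ at this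
          change _ = d (σ b) * d (σ b) * _
          rw [hd, swap_mul_self, this]
        · have e3 : swap none (some a) * swap none (some (σ b)) * optionCongr (σ * τ) =
              swap none (some (σ b)) * optionCongr (swap a (σ b) * (σ * τ)) := by
            rw [hoc _ (σ * τ), ← mul_assoc]
            congr 1
            rw [optionCongr_swap, Equiv.swap_mul_eq_mul_swap]
            simp only [swap_inv]
            rw [swap_apply_left, swap_apply_of_ne_of_ne (by simp) (by simpa using hab)]
            rw [swap_comm (some a)]
          rw [e3, hf]
          change d (σ b) * _ = d a * d (σ b) * _
          rw [hmul _ _ hab, map_mul, (hconj (swap a (σ b)) a).eq, swap_apply_left, mul_assoc]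
  refine ⟨⟨⟨f, h1⟩, hmulf⟩, fun σ => ?_, fun a => ?_⟩
  · have := hf none σ
    rw [swap_self] at this
    change f _ = _
    exact this.trans (one_mul _)
  · have := hf (some a) 1
    change f _ = _
    rw [map_one, mul_one] at this
    rw [← show D (some a) = d a from rfl, ← this]
    congr 1
    simp [Perm.one_def]

/-- Presentation of a finite symmetric group by its transpositions: involutions `t a b` that
conjugate each other as transpositions do define a homomorphism. -/
theorem exists_hom_of_swap {ι : Type*} [Finite ι] {M : Type*} [Monoid M] :
    ∀ [DecidableEq ι] (t : ι → ι → M) (_ : ∀ a, t a a = 1) (_ : ∀ a b, t a b * t a b = 1)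
    (_ : ∀ a b c d, SemiconjBy (t a b) (t c d) (t (swap a b c) (swap a b d))),
    ∃ ρ : Perm ι →* M, ∀ a b, ρ (swap a b) = t a b := by
  induction ι using Finite.induction_empty_option with
  | @of_equiv α β e ih =>
    intro _ t h1 h2 h3
    classical
    obtain ⟨ρ, hρ⟩ := ih (fun a b => t (e a) (e b)) (fun a => h1 _) (fun a b => h2 _ _)
      (fun a b c d => by
        have := h3 (e a) (e b) (e c) (e d)
        rwa [← e.injective.map_swap, ← e.injective.map_swap] at this)
    refine ⟨ρ.comp e.symm.permCongrHom.toMonoidHom, fun a b => ?_⟩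
    have : e.symm.permCongrHom (swap a b) = swap (e.symm a) (e.symm b) := by
      ext x; simp [Equiv.permCongrHom, Equiv.swap_apply_def, Equiv.eq_symm_apply, apply_ite e.symm]
    change ρ (e.symm.permCongrHom (swap a b)) = _
    rw [this, hρ]; simp
  | h_empty =>
    intro _ t h1 h2 h3
    exact ⟨1, fun a => a.elim⟩
  | @h_option α _ ih =>
    intro inst t h1 h2 h3
    classical
    have hsymm : ∀ a b, t a b = t b a := by
      intro a b
      have := (h3 a b a b).eq
      rw [swap_apply_left, swap_apply_right, h2] at this
      have h := congrArg (· * t a b) this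
      simp only [one_mul, mul_assoc, h2, mul_one] at h
      exact h
    obtain ⟨ρ, hρ⟩ := ih (fun a b => t (some a) (some b)) (fun a => h1 _) (fun a b => h2 _ _)
      (fun a b c d => by
        have := h3 (some a) (some b) (some c) (some d)
        rwa [← (Option.some_injective _).map_swap, ← (Option.some_injective _).map_swap] at this)
    obtain ⟨ρ', hρ1, hρ2⟩ := exists_hom_perm_option ρ (fun a => t none (some a)) (fun a => h2 _ _)
      (fun σ => by
        induction σ using Perm.swap_induction_on with
        | one => intro a; simp
        | swap_mul f x y hxy ih =>
          intro a
          rw [map_mul, hρ]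
          refine SemiconjBy.mul_left ?_ (ih a)
          have := h3 (some x) (some y) none (some (f a))
          rwa [swap_apply_of_ne_of_ne (by simp) (by simp), ← (Option.some_injective _).map_swap]
            at this)
      (fun a b hab => by
        rw [hρ]
        have := (h3 none (some a) none (some b)).eq
        rwa [swap_apply_left, swap_apply_of_ne_of_ne (by simp) (by simpa using hab.symm)] at this)
    refine ⟨ρ', ?_⟩
    rintro (_ | a) (_ | b)
    · rw [h1, swap_self]; exact map_one _
    · convert hρ2 b
    · rw [swap_comm, hsymm]; convert hρ2 a
    · rw [← hρ, ← hρ1, optionCongr_swap]; convert rfl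

/-- Conjugation by an involution is its own inverse. -/
theorem SemiconjBy.involutive_symm {M : Type*} [Monoid M] {g x y : M} (hg : g * g = 1)
    (h : SemiconjBy g x y) : SemiconjBy g y x := by
  have : g * (g * x) * g = g * (y * g) * g := by rw [h.eq]
  rw [← mul_assoc, hg, one_mul, mul_assoc, mul_assoc, hg, mul_one] at this
  exact this.symm

theorem Equiv.swap_prodMk_same {α β : Type*} [DecidableEq α] [DecidableEq β] (c : α) (a b : β)
    (x : α × β) : swap (c, a) (c, b) x = if x.1 = c then (c, swap a b x.2) else x := by
  obtain ⟨d, y⟩ := x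
  simp only [swap_apply_def, Prod.mk.injEq]
  by_cases h : d = c <;> (simp [h]; try grind)

section doubling

variable {ι M : Type*} [Finite ι] [DecidableEq ι] [Monoid M]

/-- Homomorphisms `ρ false` and `ρ true` on the permutations of `ι` with commuting values extend to
the permutations of two copies of `ι`, given elements `v a` to be the images of the vertical
transpositions `(false, a) ↔ (true, a)`. -/
theorem exists_hom_perm_bool_prod (ρ : Bool → Perm ι →* M) (v : ι → M)
    (hρ : ∀ σ τ, Commute (ρ false σ) (ρ true τ)) (hv : ∀ a, v a * v a = 1)
    (hvv : ∀ a b, Commute (v a) (v b))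
    (hfix : ∀ c σ a, σ a = a → Commute (ρ c σ) (v a))
    (hmove : ∀ σ a, SemiconjBy (ρ false σ * ρ true σ) (v a) (v (σ a)))
    (hbraid : ∀ c a b, a ≠ b →
      v a * ρ c (swap a b) * v a = ρ c (swap a b) * v a * ρ c (swap a b)) :
    ∃ ρ' : Perm (Bool × ι) →* M, (∀ c σ, ρ' (Perm.prodExtendRight c σ) = ρ c σ) ∧
      ∀ a, ρ' (swap (false, a) (true, a)) = v a := by
  have hsq : ∀ c a b, ρ c (swap a b) * ρ c (swap a b) = 1 := fun c a b => by
    rw [← map_mul, swap_mul_self, map_one]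
  -- the transposition `(false, a) ↔ (true, b)` is the vertical one at `a`, conjugated by the
  -- transposition `a ↔ b` of the half `true`
  let D : ι → ι → M := fun a b => ρ true (swap a b) * v a * ρ true (swap a b)
  have hDaa : ∀ a, D a a = v a := fun a => by
    change ρ true (swap a a) * v a * ρ true (swap a a) = v a
    rw [swap_self]; change ρ true 1 * v a * ρ true 1 = _
    rw [map_one, one_mul, mul_one]
  have hDv : ∀ τ a, SemiconjBy (ρ true τ) (v a) (D a (τ a)) := by
    intro τ a
    have h := (hfix true (swap a (τ a) * τ) a (by simp)).eq
    rw [map_mul] at h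
    change _ = ρ true _ * v a * ρ true _ * ρ true τ
    calc ρ true τ * v a = ρ true (swap a (τ a)) * (ρ true (swap a (τ a)) * ρ true τ * v a) := by
          rw [← mul_assoc, ← mul_assoc, hsq, one_mul]
      _ = _ := by rw [h]; simp only [mul_assoc]
  have hD1 : ∀ σ a b, SemiconjBy (ρ true σ) (D a b) (D a (σ b)) := by
    intro σ a b
    have h1 := hDv (σ * swap a b) a
    rw [map_mul, Perm.mul_apply, swap_apply_left] at h1
    change ρ true σ * (ρ true _ * v a * ρ true _) = _
    rw [← mul_assoc, ← mul_assoc, h1.eq, mul_assoc (D a (σ b)), mul_assoc (ρ true σ), hsq, mul_one]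
  have hinv : ∀ c σ, ρ c σ * ρ c σ⁻¹ = 1 := fun c σ => by rw [← map_mul, mul_inv_cancel, map_one]
  have hinv' : ∀ c σ, ρ c σ⁻¹ * ρ c σ = 1 := fun c σ => by rw [← map_mul, inv_mul_cancel, map_one]
  have hD0v : ∀ σ a, SemiconjBy (ρ false σ) (v a) (D (σ a) a) := by
    intro σ a
    have h1 := (hmove σ a).eq
    have h2 := (hDv σ⁻¹ (σ a)).eq
    rw [show σ⁻¹ (σ a) = a from σ.symm_apply_apply a] at h2
    change _ = _
    rw [(hρ σ σ).eq] at h1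
    calc ρ false σ * v a = ρ true σ⁻¹ * (ρ true σ * ρ false σ * v a) := by
          rw [← mul_assoc, ← mul_assoc, hinv', one_mul]
      _ = ρ true σ⁻¹ * v (σ a) * (ρ true σ * ρ false σ) := by rw [h1, mul_assoc]
      _ = _ := by rw [h2, mul_assoc, ← mul_assoc (ρ true σ⁻¹), hinv', one_mul]
  have hD0 : ∀ σ a b, SemiconjBy (ρ false σ) (D a b) (D (σ a) b) := by
    intro σ a b
    have h1 : SemiconjBy (ρ false σ) (D a b) (ρ true (swap a b) * D (σ a) a * ρ true (swap a b)) :=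
      (SemiconjBy.mul_right (SemiconjBy.mul_right (hρ σ _) (hD0v σ a)) (hρ σ _))
    have h2 := (hD1 (swap a b) (σ a) a).eq
    rw [swap_apply_left] at h2
    rwa [h2, mul_assoc, hsq, mul_one] at h1
  have hDsq : ∀ a b, D a b * D a b = 1 := by
    intro a b
    have h := (hD1 (swap a b) a a).eq
    rw [swap_apply_left, hDaa] at h
    have : D a b * D a b = D a b * D a b * (ρ true (swap a b) * ρ true (swap a b)) := by
      rw [hsq, mul_one]
    rw [this, mul_assoc, ← mul_assoc (D a b) (ρ true _), ← h, mul_assoc _ (v a),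
      ← mul_assoc (D a b), ← h, mul_assoc, ← mul_assoc (v a), hv, one_mul, hsq]
  have hva1 : ∀ a d, a ≠ d → SemiconjBy (v a) (ρ true (swap a d)) (D a d) := by
    intro a d had
    have := hbraid true a d had
    change _ = ρ true (swap a d) * v a * ρ true (swap a d) * v a
    rw [← this, mul_assoc _ (v a) (v a), hv, mul_one]
  have hva0 : ∀ a d, a ≠ d → SemiconjBy (v a) (ρ false (swap a d)) (D d a) := by
    intro a d had
    have h := hbraid false a d had
    have h2 := (hD0v (swap a d) a).eq
    rw [swap_apply_left] at h2
    change _ = _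
    rw [h2, mul_assoc (D d a), hsq, mul_one] at h
    rw [← h, mul_assoc _ (v a) (v a), hv, mul_one]
  have hvD : ∀ a c d, c ≠ a → d ≠ a → SemiconjBy (v a) (D c d) (D c d) := by
    intro a c d hc hd
    have h1 : Commute (v a) (ρ true (swap c d)) :=
      (hfix true _ a (swap_apply_of_ne_of_ne hc.symm hd.symm)).symm
    exact (h1.mul_right (hvv a c)).mul_right h1
  let t : Bool × ι → Bool × ι → M := fun p q =>
    match p, q with
    | (false, a), (false, b) => ρ false (swap a b)
    | (true, a), (true, b) => ρ true (swap a b)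
    | (false, a), (true, b) => D a b
    | (true, b), (false, a) => D a b
  have tρ : ∀ c a b, t (c, a) (c, b) = ρ c (swap a b) := by rintro (_ | _) a b <;> rfl
  have tD : ∀ a b, t (false, a) (true, b) = D a b := fun _ _ => rfl
  have tD' : ∀ a b, t (true, b) (false, a) = D a b := fun _ _ => rfl
  clear_value t D
  have t1 : ∀ a, t a a = 1 := by
    rintro ⟨c, a⟩
    rw [tρ, swap_self]; exact map_one (ρ c)
  have t2 : ∀ a b, t a b * t a b = 1 := by
    rintro ⟨_ | _, a⟩ ⟨_ | _, b⟩ <;> simp only [tρ, tD, tD', hsq, hDsq]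
  have tsymm : ∀ a b, t a b = t b a := by
    rintro ⟨_ | _, a⟩ ⟨_ | _, b⟩
    simp only [tρ, swap_comm]; simp only [tD, tD']; simp only [tD, tD']; simp only [tρ, swap_comm]
  have hflip : ∀ u x y x' y', SemiconjBy u (t x y) (t x' y') →
      SemiconjBy u (t y x) (t y' x') := by
    intro u x y x' y' h
    rwa [tsymm y x, tsymm y' x']
  have hρconj : ∀ c a b x y,
      SemiconjBy (ρ c (swap a b)) (ρ c (swap x y)) (ρ c (swap (swap a b x) (swap a b y))) := by
    intro c a b x y
    change _ = _
    rw [← map_mul, ← map_mul, Equiv.mul_swap_eq_swap_mul]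
  have key1 : ∀ c a b x y, SemiconjBy (t (c, a) (c, b)) (t x y)
      (t (swap (c, a) (c, b) x) (swap (c, a) (c, b) y)) := by
    rintro (_ | _) a b ⟨_ | _, x⟩ ⟨_ | _, y⟩ <;> simp only [swap_prodMk_same] <;>
      simp only [Bool.false_eq_true, Bool.true_eq_false, if_true, if_false, tρ, tD, tD']
    · exact hρconj _ _ _ _ _
    · exact hD0 _ _ _
    · exact hD0 _ _ _
    · exact hρ _ _
    · exact (hρ _ _).symm
    · exact hD1 _ _ _
    · exact hD1 _ _ _
    · exact hρconj _ _ _ _ _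
  have key2' : ∀ a x y, SemiconjBy (v a) (t (false, x) (true, y))
      (t (swap (false, a) (true, a) (false, x)) (swap (false, a) (true, a) (true, y))) := by
    intro a x y
    by_cases hx : x = a <;> by_cases hy : y = a
    · subst hx hy
      rw [swap_apply_left, swap_apply_right]
      rw [tD, tD', hDaa]
      exact Commute.refl _
    · subst hx
      rw [swap_apply_left, swap_apply_of_ne_of_ne (by simp) (by simpa using hy)]
      rw [tD, tρ]
      exact (hva1 x y (Ne.symm hy)).involutive_symm (hv x)
    · subst hy
      rw [swap_apply_right, swap_apply_of_ne_of_ne (by simpa using hx) (by simp)]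
      have := (hva0 y x (Ne.symm hx)).involutive_symm (hv y)
      rw [swap_comm] at this
      rwa [tD, tρ]
    · rw [swap_apply_of_ne_of_ne (by simpa using hx) (by simp),
        swap_apply_of_ne_of_ne (by simp) (by simpa using hy)]
      rw [tD]; exact hvD a x y hx hy
  have key2'' : ∀ a c x y, SemiconjBy (v a) (t (c, x) (c, y))
      (t (swap (false, a) (true, a) (c, x)) (swap (false, a) (true, a) (c, y))) := by
    intro a c x y
    by_cases hxy : x = y
    · subst hxy
      rw [t1, t1]; exact SemiconjBy.one_right _
    have aux : ∀ y, a ≠ y → SemiconjBy (v a) (t (c, a) (c, y))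
        (t (swap (false, a) (true, a) (c, a)) (swap (false, a) (true, a) (c, y))) := by
      intro y hy
      cases c
      · rw [swap_apply_left, swap_apply_of_ne_of_ne (by simpa using hy.symm) (by simp)]
        rw [tρ, tD']; exact hva0 a y hy
      · rw [swap_apply_right, swap_apply_of_ne_of_ne (by simp) (by simpa using hy.symm)]
        rw [tρ, tD]; exact hva1 a y hy
    by_cases hx : a = x
    · subst hx; exact aux y hxy
    by_cases hy : a = y
    · subst hy
      rw [tsymm (c, x), tsymm (swap _ _ (c, x))]; exact aux x hx
    · rw [swap_apply_of_ne_of_ne (by simp [Ne.symm hx]) (by simp [Ne.symm hx]),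
        swap_apply_of_ne_of_ne (by simp [Ne.symm hy]) (by simp [Ne.symm hy])]
      rw [tρ]
      exact (hfix c _ a (swap_apply_of_ne_of_ne hx hy)).symm
  have key2 : ∀ a x y, SemiconjBy (t (false, a) (true, a)) (t x y)
      (t (swap (false, a) (true, a) x) (swap (false, a) (true, a) y)) := by
    intro a x y
    rw [tD, hDaa]
    obtain ⟨_ | _, x⟩ := x <;> obtain ⟨_ | _, y⟩ := y
    · exact key2'' a false x y
    · exact key2' a x y
    · have := key2' a y x
      exact hflip _ _ _ _ _ this
    · exact key2'' a true x y
  -- a transposition across the halves is conjugate to a vertical one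
  have key3 : ∀ a b x y, SemiconjBy (t (false, a) (true, b)) (t x y)
      (t (swap (false, a) (true, b) x) (swap (false, a) (true, b) y)) := by
    intro a b x y
    by_cases hab : a = b
    · subst hab; exact key2 a x y
    set g := swap (true, a) (true, b) with hg
    have h1 : t (false, a) (true, b) =
        t (true, a) (true, b) * t (false, a) (true, a) * t (true, a) (true, b) := by
      have := (hD1 (swap a b) a a).eq
      rw [swap_apply_left] at this
      rw [tρ, tD, tD, this, mul_assoc, hsq, mul_one]
    have h2 : ∀ z, swap (false, a) (true, b) z = g (swap (false, a) (true, a) (g z)) := by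
      have : swap (false, a) (true, b) = g * swap (false, a) (true, a) * g := by
        have := swap_apply_apply g (false, a) (true, a)
        rwa [hg, swap_apply_left, swap_apply_of_ne_of_ne (by simp) (by simp), swap_inv] at this
      intro z; rw [this]; rfl
    rw [h1, h2, h2]
    exact ((key1 _ _ _ _ _).mul_left (key2 _ _ _)).mul_left (key1 _ _ _ _ _)
  obtain ⟨ρ', hρ'⟩ := exists_hom_of_swap t t1 t2 (by
    rintro ⟨_ | _, a⟩ ⟨_ | _, b⟩ x y
    · exact key1 _ _ _ _ _
    · exact key3 _ _ _ _
    · rw [tsymm, swap_comm]; exact key3 _ _ _ _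
    · exact key1 _ _ _ _ _)
  refine ⟨ρ', fun c σ => ?_, fun a => by rw [hρ', tD, hDaa]⟩
  induction σ using Perm.swap_induction_on with
  | one =>
    rw [map_one, ← map_one ρ']
    congr 1
    ext1 ⟨d, x⟩
    by_cases h : d = c
    · subst h; simp
    · rw [Perm.prodExtendRight_apply_ne _ h]; rfl
  | swap_mul f x y hxy ih =>
    have : Perm.prodExtendRight c (swap x y * f) =
        swap (c, x) (c, y) * Perm.prodExtendRight c f := by
      ext1 ⟨d, z⟩
      rw [Perm.mul_apply, swap_prodMk_same]
      by_cases h : d = c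
      · subst h; simp
      · rw [Perm.prodExtendRight_apply_ne _ h, Perm.prodExtendRight_apply_ne _ h]; simp [h]
    rw [this, map_mul, ih, hρ', map_mul, tρ]

end doubling

/-- The permutations that fix every point of `S` are generated by the transpositions of points
outside `S`, so an element that commutes with the latter commutes with the former. -/
theorem commute_perm_of_fix {ι M : Type*} [Finite ι] [DecidableEq ι] [Monoid M]
    (ρ : Perm ι →* M) (S : Set ι) (m : M)
    (h : ∀ x y, x ∉ S → y ∉ S → x ≠ y → Commute (ρ (swap x y)) m) (σ : Perm ι)
    (hσ : ∀ x ∈ S, σ x = x) : Commute (ρ σ) m := by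
  classical
  have key : ∀ τ : Perm {x // x ∉ S}, Commute (ρ (Perm.ofSubtype τ)) m := by
    intro τ
    induction τ using Perm.swap_induction_on with
    | one => rw [map_one, map_one]; exact Commute.one_left m
    | swap_mul f x y hxy ih =>
      rw [map_mul, map_mul]
      refine Commute.mul_left ?_ ih
      have : Perm.ofSubtype (swap x y) = swap x.1 y.1 := by
        ext z
        by_cases hz : z ∈ S
        · rw [Perm.ofSubtype_apply_of_not_mem _ (by simpa using hz),
            swap_apply_of_ne_of_ne (by rintro rfl; exact x.2 hz) (by rintro rfl; exact y.2 hz)]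
        · rw [Perm.ofSubtype_apply_of_mem (p := fun x => x ∉ S) _ hz]
          simp only [swap_apply_def, Subtype.ext_iff]
          split_ifs <;> rfl
      rw [this]
      exact h _ _ x.2 y.2 (fun e => hxy (Subtype.ext e))
  have hS : ∀ x, x ∉ S ↔ σ x ∉ S := by
    intro x
    rw [not_iff_not]
    refine ⟨fun hx => by rwa [hσ x hx], fun hx => ?_⟩
    have : σ x = x := σ.injective (hσ _ hx)
    rwa [this] at hx
  have := key (σ.subtypePerm (fun x => (hS x).symm))
  rwa [Perm.ofSubtype_subtypePerm] at this
  intro x hx hxS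
  exact hx (hσ x hxS)

/-! ### Towers of monoids with controls -/

/-- Conjugation by an involution, as an endomorphism. -/
def conjInvolution {M : Type*} [Monoid M] (g : M) (hg : g * g = 1) : M →* M where
  toFun x := g * x * g
  map_one' := by rw [mul_one, hg]
  map_mul' x y := by
    rw [mul_assoc (g * x), ← mul_assoc g (g * y), ← mul_assoc g g, hg, one_mul]
    simp only [mul_assoc]

/-- Monoids `E n` of operations on `n` wires with controls. `C b f` applies `f` when a new first
wire has the value `b`, `X n` is the negation of the first of `n + 1` wires, and `T n` exchanges the
first two of `n + 2` wires. The product `C false f * C true f` applies `f` whatever the value of the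
first wire; with it, `T_X` and `T_braid` say that the negation of the second wire is conjugate to
that of the first, and that exchanges satisfy the braid relation. `T_eq` writes an exchange as three
controlled negations. -/
structure ControlTower (E : ℕ → Type u) [∀ n, Monoid (E n)] where
  C (b : Bool) {n : ℕ} : E n →* E (n + 1)
  X (n : ℕ) : E (n + 1)
  T (n : ℕ) : E (n + 2)
  C_comm {n : ℕ} (f g : E n) : Commute (C false f) (C true g)
  X_mul_X (n : ℕ) : X n * X n = 1
  X_C {n : ℕ} (f : E n) : X n * C true f * X n = C false f
  T_mul_T (n : ℕ) : T n * T n = 1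
  T_C {n : ℕ} (b c : Bool) (f : E n) : T n * C b (C c f) * T n = C c (C b f)
  T_X (n : ℕ) : T n * (C false (X n) * C true (X n)) * T n = X (n + 1)
  T_braid (n : ℕ) : (C false (T n) * C true (T n)) * T (n + 1) * (C false (T n) * C true (T n)) =
    T (n + 1) * (C false (T n) * C true (T n)) * T (n + 1)
  T_eq (n : ℕ) : C true (X n) * (T n * C true (X n) * T n) * C true (X n) = T n

/-- Binary words of length `n`. -/
abbrev Bits : ℕ → Type
  | 0 => Unit
  | n + 1 => Bool × Bits n

namespace Bits

instance instDecidableEq : ∀ n, DecidableEq (Bits n)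
  | 0 => inferInstanceAs (DecidableEq Unit)
  | n + 1 => have := instDecidableEq n; inferInstanceAs (DecidableEq (Bool × Bits n))

instance instFinite : ∀ n, Finite (Bits n)
  | 0 => inferInstanceAs (Finite Unit)
  | n + 1 => have := instFinite n; inferInstanceAs (Finite (Bool × Bits n))

instance : Subsingleton (Bits 0) := inferInstanceAs (Subsingleton Unit)

end Bits

namespace ControlTower

variable {E : ℕ → Type u} [∀ n, Monoid (E n)] (K : ControlTower E)

theorem C_comm' {n : ℕ} {b c : Bool} (h : b ≠ c) (f g : E n) : Commute (K.C b f) (K.C c g) := by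
  cases b <;> cases c
  exacts [absurd rfl h, K.C_comm _ _, (K.C_comm _ _).symm, absurd rfl h]

/-- The operation `f` on all wires but the first. -/
def I {n : ℕ} : E n →* E (n + 1) where
  toFun f := K.C false f * K.C true f
  map_one' := by simp
  map_mul' f g := by
    rw [map_mul, map_mul, mul_assoc, ← mul_assoc (K.C false g), (K.C_comm g f).eq]
    simp only [mul_assoc]

theorem I_apply {n : ℕ} (f : E n) : K.I f = K.C false f * K.C true f := rfl

theorem I_apply' {n : ℕ} (b : Bool) (f : E n) : K.I f = K.C (!b) f * K.C b f := by
  cases b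
  · exact (K.C_comm f f).eq
  · rfl

theorem I_T_mul (n : ℕ) : K.I (K.T n) * K.I (K.T n) = 1 := by
  rw [← map_mul, K.T_mul_T, map_one]

/-- Conjugation by the exchange of the first two wires. -/
def conjT (n : ℕ) : E (n + 2) →* E (n + 2) := conjInvolution (K.T n) (K.T_mul_T n)

/-- Conjugation by the exchange of the second and third wires. -/
def conjIT (n : ℕ) : E (n + 3) →* E (n + 3) := conjInvolution (K.I (K.T n)) (K.I_T_mul n)

/-- Conjugation by the negation of the first wire. -/
def conjX (n : ℕ) : E (n + 1) →* E (n + 1) := conjInvolution (K.X n) (K.X_mul_X n)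

theorem conjT_apply {n : ℕ} (f : E (n + 2)) : K.conjT n f = K.T n * f * K.T n := rfl
theorem conjX_apply {n : ℕ} (f : E (n + 1)) : K.conjX n f = K.X n * f * K.X n := rfl

theorem conjInvolution_conj {M : Type*} [Monoid M] (g : M) (hg : g * g = 1) (x : M) :
    conjInvolution g hg (conjInvolution g hg x) = x := by
  change g * (g * x * g) * g = x
  rw [← mul_assoc, ← mul_assoc, hg, one_mul, mul_assoc, hg, mul_one]

theorem conjT_conjT {n : ℕ} (f : E (n + 2)) : K.conjT n (K.conjT n f) = f :=
  conjInvolution_conj _ _ _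

theorem conjX_conjX {n : ℕ} (f : E (n + 1)) : K.conjX n (K.conjX n f) = f :=
  conjInvolution_conj _ _ _

theorem conjX_C {n : ℕ} (b : Bool) (f : E n) : K.conjX n (K.C b f) = K.C (!b) f := by
  cases b
  · rw [← K.X_C]; exact K.conjX_conjX _
  · exact K.X_C f

theorem conjT_C {n : ℕ} (b c : Bool) (f : E n) : K.conjT n (K.C b (K.C c f)) = K.C c (K.C b f) :=
  K.T_C b c f

theorem conjT_I_C {n : ℕ} (b : Bool) (f : E n) : K.conjT n (K.C b (K.I f)) = K.I (K.C b f) := by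
  rw [I_apply, map_mul, map_mul, conjT_C, conjT_C]; rfl

theorem conjIT_C {n : ℕ} (b : Bool) (f : E (n + 2)) :
    K.conjIT n (K.C b f) = K.C b (K.conjT n f) := by
  have h1 : K.I (K.T n) = K.C b (K.T n) * K.C (!b) (K.T n) := by
    rw [K.I_apply' b]; exact (K.C_comm' (by simp) _ _).eq
  have h2 : K.C (!b) (K.T n) * K.C (!b) (K.T n) = 1 := by rw [← map_mul, K.T_mul_T, map_one]
  calc K.I (K.T n) * K.C b f * K.I (K.T n)
      = K.C (!b) (K.T n) * K.C b (K.T n) * K.C b f * (K.C b (K.T n) * K.C (!b) (K.T n)) := by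
        rw [← h1, ← K.I_apply' b]
    _ = K.C (!b) (K.T n) * K.C b (K.T n * f * K.T n) * K.C (!b) (K.T n) := by
        simp only [map_mul, mul_assoc]
    _ = K.C b (K.T n * f * K.T n) := by
        rw [(K.C_comm' (by simp) (K.T n) _).eq, mul_assoc, h2, mul_one]

/-- The braid relation, for conjugations. -/
theorem conj_braid {n : ℕ} (f : E (n + 3)) :
    K.conjT (n + 1) (K.conjIT n (K.conjT (n + 1) f)) =
      K.conjIT n (K.conjT (n + 1) (K.conjIT n f)) := by
  have := K.T_braid n
  change K.I (K.T n) * _ * K.I (K.T n) = _ * K.I (K.T n) * _ at this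
  calc K.T (n + 1) * (K.I (K.T n) * (K.T (n + 1) * f * K.T (n + 1)) * K.I (K.T n)) * K.T (n + 1)
      = (K.T (n + 1) * K.I (K.T n) * K.T (n + 1)) * f *
        (K.T (n + 1) * K.I (K.T n) * K.T (n + 1)) := by simp only [mul_assoc]
    _ = K.I (K.T n) * (K.T (n + 1) * (K.I (K.T n) * f * K.I (K.T n)) * K.T (n + 1)) *
        K.I (K.T n) := by rw [← this]; simp only [mul_assoc]

/-- The negation of the first wire, controlled by the value `a` of the other wires. It stands for
the transposition of the words `(false, a)` and `(true, a)`. -/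
def mcx : ∀ {n : ℕ}, Bits n → E (n + 1)
  | 0, _ => K.X 0
  | n + 1, a => K.conjT n (K.C a.1 (mcx a.2))

theorem mcx_cons {n : ℕ} (c : Bool) (a : Bits n) :
    K.mcx (n := n + 1) (c, a) = K.conjT n (K.C c (K.mcx a)) := rfl

theorem mcx_mul_self : ∀ {n : ℕ} (a : Bits n), K.mcx a * K.mcx a = 1
  | 0, _ => K.X_mul_X 0
  | n + 1, a => by
    obtain ⟨c, a⟩ := a
    rw [mcx_cons, ← map_mul, ← map_mul, mcx_mul_self a, map_one, map_one]

theorem mcx_comm : ∀ {n : ℕ} (a b : Bits n), Commute (K.mcx a) (K.mcx b)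
  | 0, _, _ => Commute.refl _
  | n + 1, a, b => by
    obtain ⟨c, a⟩ := a
    obtain ⟨d, b⟩ := b
    refine Commute.map (Commute.eq ?_) (K.conjT n)
    by_cases h : c = d
    · subst h; exact Commute.map (mcx_comm a b) (K.C c)
    · exact K.C_comm' h _ _

/-- Control by a new third wire. A gate on two wires controlled by the word `(b, a)` arises in this
way from the gate controlled by `a`, so that identities between such gates are proved by induction
on the length of the word, starting from two wires. -/
def addControl (c : Bool) {n : ℕ} : E (n + 2) →* E (n + 3) :=
  (K.conjIT n).comp ((K.conjT (n + 1)).comp (K.C c))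

theorem C_mcx_cons {n : ℕ} (c b : Bool) (a : Bits n) :
    K.C c (K.mcx (n := n + 1) (b, a)) = K.addControl b (K.C c (K.mcx a)) := by
  change _ = K.conjIT n (K.conjT _ (K.C b (K.C c (K.mcx a))))
  rw [conjT_C, conjIT_C]; rfl

theorem conjT_C_mcx_cons {n : ℕ} (c b : Bool) (a : Bits n) :
    K.conjT (n + 1) (K.C c (K.mcx (n := n + 1) (b, a))) =
      K.addControl b (K.conjT n (K.C c (K.mcx a))) := by
  change _ = K.conjIT n (K.conjT _ (K.C b (K.conjT n (K.C c (K.mcx a)))))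
  rw [mcx_cons, ← conjIT_C, ← conjIT_C, ← conj_braid, conjT_C]

theorem addControl_comm {n : ℕ} {b c : Bool} (h : b ≠ c) (f g : E (n + 2)) :
    Commute (K.addControl b f) (K.addControl c g) :=
  Commute.map (Commute.map (K.C_comm' h f g) (K.conjT (n + 1))) (K.conjIT n)

/-- Negations of the second and of the first wire commute if the values of the remaining wires that
control them differ. -/
theorem C_mcx_comm : ∀ {n : ℕ} {a b : Bits n}, a ≠ b → ∀ c d : Bool,
    Commute (K.C c (K.mcx b)) (K.conjT n (K.C d (K.mcx a)))
  | 0, a, b, h => absurd (Subsingleton.elim a b) h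
  | n + 1, a, b, h => by
    intro c d
    obtain ⟨a0, a⟩ := a
    obtain ⟨b0, b⟩ := b
    rw [C_mcx_cons, conjT_C_mcx_cons]
    by_cases h0 : b0 = a0
    · subst h0
      exact Commute.map (C_mcx_comm (fun e => h (by rw [e])) c d) (K.addControl b0)
    · exact K.addControl_comm h0 _ _

/-- Negating the second wire when the remaining wires have the value `a` turns the control value
`d` of the second wire into its opposite. -/
theorem I_mcx_semiconj : ∀ {n : ℕ} (a : Bits n) (d : Bool),
    SemiconjBy (K.I (K.mcx a)) (K.conjT n (K.C d (K.mcx a))) (K.conjT n (K.C (!d) (K.mcx a)))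
  | 0, _, d => by
    change SemiconjBy (K.I (K.X 0)) (K.conjT 0 (K.C d (K.X 0))) (K.conjT 0 (K.C (!d) (K.X 0)))
    have h1 : K.conjT 0 (K.X 1) = K.I (K.X 0) := by rw [← K.T_X]; exact K.conjT_conjT _
    rw [← h1]
    refine SemiconjBy.map ?_ (K.conjT 0)
    rw [← K.conjX_C, SemiconjBy, conjX_apply, mul_assoc, K.X_mul_X, mul_one]
  | n + 1, a, d => by
    obtain ⟨a0, a⟩ := a
    have h1 : K.I (K.mcx (n := n + 1) (a0, a)) = K.addControl a0 (K.I (K.mcx a)) := by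
      rw [I_apply, I_apply, map_mul, C_mcx_cons, C_mcx_cons]
    rw [h1, conjT_C_mcx_cons, conjT_C_mcx_cons]
    exact SemiconjBy.map (I_mcx_semiconj a d) (K.addControl a0)

theorem X_comm_C_X (n : ℕ) (c : Bool) : Commute (K.I (K.X n)) (K.C c (K.X n)) := by
  rw [K.I_apply' c]
  exact (K.C_comm' (by simp) _ _).mul_left (Commute.refl _)

/-- Two controlled negations that stand for transpositions of words with one word in common satisfy
the braid relation. -/
theorem mcx_braid : ∀ {n : ℕ} (a : Bits n) (d : Bool),
    K.conjT n (K.C d (K.mcx a)) * K.C true (K.mcx a) * K.conjT n (K.C d (K.mcx a)) =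
      K.C true (K.mcx a) * K.conjT n (K.C d (K.mcx a)) * K.C true (K.mcx a)
  | 0, _, d => by
    change K.conjT 0 (K.C d (K.X 0)) * K.C true (K.X 0) * K.conjT 0 (K.C d (K.X 0)) =
      K.C true (K.X 0) * K.conjT 0 (K.C d (K.X 0)) * K.C true (K.X 0)
    -- both sides are the exchange, by `T_eq` and its conjugate by the exchange
    have h1 : K.conjT 0 (K.C true (K.X 0)) * K.C true (K.X 0) * K.conjT 0 (K.C true (K.X 0)) =
        K.C true (K.X 0) * K.conjT 0 (K.C true (K.X 0)) * K.C true (K.X 0) := by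
      have h := K.T_eq 0
      have h' := congrArg (K.conjT 0) h
      change _ * K.conjT 0 _ * _ = _ at h
      rw [map_mul, map_mul] at h'
      change _ * K.conjT 0 (K.conjT 0 _) * _ = _ at h'
      rw [conjT_conjT] at h'
      rw [h, h', conjT_apply, K.T_mul_T, one_mul]
    -- the case `d = false` is obtained from `h1` by negating the second wire
    cases d
    · have hI : K.I (K.X 0) * K.I (K.X 0) = 1 := by rw [← map_mul, K.X_mul_X, map_one]
      let φ := conjInvolution _ hI
      have e1 : φ (K.C true (K.X 0)) = K.C true (K.X 0) := by
        change K.I (K.X 0) * K.C true (K.X 0) * K.I (K.X 0) = _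
        rw [(K.X_comm_C_X 0 true).eq, mul_assoc, hI, mul_one]
      have e2 : φ (K.conjT 0 (K.C true (K.X 0))) = K.conjT 0 (K.C false (K.X 0)) := by
        change K.I (K.X 0) * K.conjT 0 (K.C true (K.X 0)) * K.I (K.X 0) = _
        have := (K.I_mcx_semiconj (n := 0) () true).eq
        change K.I (K.X 0) * K.conjT 0 (K.C true (K.X 0)) =
          K.conjT 0 (K.C false (K.X 0)) * K.I (K.X 0) at this
        rw [this, mul_assoc, hI, mul_one]
      have := congrArg φ h1
      simpa only [map_mul, e1, e2] using this
    · exact h1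
  | n + 1, a, d => by
    obtain ⟨a0, a⟩ := a
    rw [conjT_C_mcx_cons, C_mcx_cons]
    simp only [← map_mul]
    rw [mcx_braid a d]

theorem X_succ (n : ℕ) : K.X (n + 1) = K.conjT n (K.I (K.X n)) := (K.T_X n).symm

theorem X_comm_mcx : ∀ {n : ℕ} (a : Bits n), Commute (K.X n) (K.mcx a)
  | 0, _ => Commute.refl _
  | n + 1, a => by
    obtain ⟨c, a⟩ := a
    rw [X_succ, mcx_cons]
    refine Commute.map ?_ (K.conjT n)
    rw [K.I_apply' c]
    exact (K.C_comm' (by simp) _ _).mul_left ((X_comm_mcx a).map (K.C c))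

end ControlTower

/-! ### The action of permutations of words -/

theorem Equiv.Perm.prodExtendRight_swap {α β : Type*} [DecidableEq α] [DecidableEq β] (c : α)
    (a b : β) : Perm.prodExtendRight c (swap a b) = swap (c, a) (c, b) := by
  ext1 ⟨d, z⟩
  rw [swap_prodMk_same]
  by_cases h : d = c
  · subst h; simp
  · rw [Perm.prodExtendRight_apply_ne _ h]; simp [h]

/-- A transposition across the two halves is conjugate to a vertical one. -/
theorem swap_eq_conj_prodExtendRight {ι : Type*} [DecidableEq ι] (c : Bool) (a b : ι) :
    swap (c, a) (!c, b) = Perm.prodExtendRight (!c) (swap a b) * swap (c, a) (!c, a) *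
      Perm.prodExtendRight (!c) (swap a b) := by
  have := swap_apply_apply (Perm.prodExtendRight (!c) (swap a b)) (c, a) (!c, a)
  rw [Perm.prodExtendRight_apply_ne _ (by simp), Perm.prodExtendRight_apply_eq, swap_apply_left]
    at this
  rw [this, Perm.prodExtendRight_swap, swap_inv]

namespace ControlTower

variable {E : ℕ → Type u} [∀ n, Monoid (E n)] (K : ControlTower E)

/-- The relations between an action `ρ` of permutations of words and the controlled negations that
let the action be extended to words with one more bit: `K.mcx a` commutes with controlled
permutations that fix `a`, is moved by uncontrolled ones as `a` is, and satisfies the braid relation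
with controlled transpositions that move `a`. -/
structure IsAction {n : ℕ} (ρ : Perm (Bits n) →* E n) : Prop where
  fix : ∀ σ a, σ a = a → Commute (K.C true (ρ σ)) (K.mcx a)
  move : ∀ σ a, SemiconjBy (K.I (ρ σ)) (K.mcx a) (K.mcx (σ a))
  braid : ∀ a b, a ≠ b → K.mcx a * K.C true (ρ (swap a b)) * K.mcx a =
    K.C true (ρ (swap a b)) * K.mcx a * K.C true (ρ (swap a b))

variable {K}

theorem IsAction.fix' {n : ℕ} {ρ : Perm (Bits n) →* E n} (h : K.IsAction ρ) (c : Bool)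
    (σ : Perm (Bits n)) (a : Bits n) (ha : σ a = a) : Commute (K.C c (ρ σ)) (K.mcx a) := by
  cases c
  · have h1 : K.C false (ρ σ) = K.conjX n (K.C true (ρ σ)) := (K.conjX_C true _).symm
    have h2 : K.mcx a = K.conjX n (K.mcx a) := by
      rw [conjX_apply, (K.X_comm_mcx a).eq, mul_assoc, K.X_mul_X, mul_one]
    rw [h1, h2]
    exact (h.fix σ a ha).map (K.conjX n)
  · exact h.fix σ a ha

theorem IsAction.braid' {n : ℕ} {ρ : Perm (Bits n) →* E n} (h : K.IsAction ρ) (c : Bool)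
    (a b : Bits n) (hab : a ≠ b) : K.mcx a * K.C c (ρ (swap a b)) * K.mcx a =
    K.C c (ρ (swap a b)) * K.mcx a * K.C c (ρ (swap a b)) := by
  cases c
  · have h1 : K.C false (ρ (swap a b)) = K.conjX n (K.C true (ρ (swap a b))) :=
      (K.conjX_C true _).symm
    have h2 : K.mcx a = K.conjX n (K.mcx a) := by
      rw [conjX_apply, (K.X_comm_mcx a).eq, mul_assoc, K.X_mul_X, mul_one]
    rw [h1, h2, ← map_mul, ← map_mul, h.braid a b hab]
    simp only [map_mul]
  · exact h.braid a b hab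

theorem isAction_zero : K.IsAction (n := 0) 1 where
  fix σ a _ := by
    rw [MonoidHom.one_apply, map_one]; exact Commute.one_left _
  move σ a := by
    rw [MonoidHom.one_apply, map_one, Subsingleton.elim (σ a) a]; exact Commute.one_left _
  braid a b h := absurd (Subsingleton.elim a b) h

/-- The relations of `IsAction` pass to the extension of an action to words with one more bit. -/
theorem IsAction.succ {n : ℕ} {ρ : Perm (Bits n) →* E n} (h : K.IsAction ρ)
    {ρ' : Perm (Bits (n + 1)) →* E (n + 1)}
    (hC : ∀ c σ, ρ' (Perm.prodExtendRight c σ) = K.C c (ρ σ))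
    (hv : ∀ a, ρ' (swap (α := Bits (n + 1)) (false, a) (true, a)) = K.mcx a) :
    K.IsAction ρ' := by
  have hv' : ∀ c a, ρ' (swap (α := Bits (n + 1)) (c, a) (!c, a)) = K.mcx a := by
    rintro (_ | _) a
    · exact hv a
    · exact (congrArg ρ' (swap_comm _ _)).trans (hv a)
  have hCs : ∀ c a b, ρ' (swap (α := Bits (n + 1)) (c, a) (c, b)) = K.C c (ρ (swap a b)) := by
    intro c a b
    rw [← hC, Perm.prodExtendRight_swap]
  have hsq : ∀ a b, ρ (swap a b) * ρ (swap a b) = 1 := fun a b => by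
    rw [← map_mul, swap_mul_self, map_one]
  have hcross : ∀ c a b, ρ' (swap (α := Bits (n + 1)) (c, a) (!c, b)) =
      K.C (!c) (ρ (swap a b)) * K.mcx a * K.C (!c) (ρ (swap a b)) := by
    intro c a b
    rw [← hC, ← hv' c, ← map_mul, ← map_mul]
    exact congrArg ρ' (swap_eq_conj_prodExtendRight c a b)
  -- a gate on the half where `a` is not commutes with `mcx a`
  have hne : ∀ (c e : Bool) (f : E n) (a : Bits n), c ≠ e →
      Commute (K.C true (K.C c f)) (K.mcx (n := n + 1) (e, a)) := by
    intro c e f a hce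
    rw [mcx_cons, ← K.conjT_C c true]
    exact (K.C_comm' hce _ _).map _
  have fix : ∀ σ a, σ a = a → Commute (K.C true (ρ' σ)) (K.mcx a) := by
    intro σ a ha
    refine commute_perm_of_fix ((K.C true).comp ρ') {a} (K.mcx a) ?_ σ (by simpa using ha)
    rintro ⟨c, b⟩ ⟨d, b'⟩ hb hb' -
    obtain ⟨e, a⟩ := a
    change Commute (K.C true (ρ' (swap (c, b) (d, b')))) _
    have hsame : ∀ c b b', ((c, b) : Bits (n + 1)) ≠ (e, a) → ((c, b') : Bits (n + 1)) ≠ (e, a) →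
        Commute (K.C true (ρ' (swap (α := Bits (n + 1)) (c, b) (c, b'))))
          (K.mcx (n := n + 1) (e, a)) := by
      intro c b b' hb hb'
      rw [hCs]
      by_cases hce : c = e
      · subst hce
        rw [mcx_cons, ← K.conjT_C]
        refine Commute.map (Commute.map (h.fix _ _ ?_) _) _
        exact swap_apply_of_ne_of_ne (by rintro rfl; exact hb rfl) (by rintro rfl; exact hb' rfl)
      · exact hne c e _ a hce
    have hvert : ∀ c b, b ≠ a → Commute (K.C true (ρ' (swap (α := Bits (n + 1)) (c, b) (!c, b))))
        (K.mcx (n := n + 1) (e, a)) := by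
      intro c b hba
      rw [hv']
      exact K.C_mcx_comm hba.symm true e
    have hfar : ∀ b b', ((!e, b') : Bits (n + 1)) ≠ (e, a) → b ≠ a →
        Commute (K.C true (ρ' (swap (α := Bits (n + 1)) (e, b) (!e, b'))))
          (K.mcx (n := n + 1) (e, a)) := by
      intro b b' _ hba
      rw [hcross, map_mul, map_mul]
      have h1 := hne (!e) e (ρ (swap b b')) a (by simp)
      have h2 := hvert e b hba
      rw [hv'] at h2
      exact (h1.mul_left h2).mul_left h1
    by_cases hcd : c = d
    · subst hcd
      exact hsame c b b' hb hb'
    by_cases hce : c = e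
    · subst hce
      obtain rfl : d = !c := by revert hcd; cases c <;> cases d <;> simp
      exact hfar b b' hb' (by rintro rfl; exact hb rfl)
    · obtain rfl : c = !e := by revert hce; cases c <;> cases e <;> simp
      obtain rfl : d = e := by revert hcd; cases d <;> cases e <;> simp
      rw [swap_comm]
      exact hfar b' b hb (by rintro rfl; exact hb' rfl)
  have fix' : ∀ σ a, σ a = a → Commute (K.I (ρ' σ)) (K.mcx a) := by
    intro σ a ha
    have h1 := fix σ a ha
    refine Commute.mul_left ?_ h1
    have h2 : K.C false (ρ' σ) = K.conjX _ (K.C true (ρ' σ)) := (K.conjX_C true _).symm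
    have h3 : K.mcx a = K.conjX _ (K.mcx a) := by
      rw [conjX_apply, (K.X_comm_mcx a).eq, mul_assoc, K.X_mul_X, mul_one]
    rw [h2, h3]
    exact h1.map _
  have msame : ∀ e a b, SemiconjBy (K.I (ρ' (swap (α := Bits (n + 1)) (e, a) (e, b))))
      (K.mcx (n := n + 1) (e, a)) (K.mcx (n := n + 1) (e, b)) := by
    intro e a b
    rw [hCs, ← K.conjT_I_C, mcx_cons, mcx_cons]
    refine SemiconjBy.map (SemiconjBy.map ?_ _) _
    have := h.move (swap a b) a
    rwa [swap_apply_left] at this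
  have mdiff : ∀ e a b, SemiconjBy (K.I (ρ' (swap (α := Bits (n + 1)) (e, a) (!e, b))))
      (K.mcx (n := n + 1) (e, a)) (K.mcx (n := n + 1) (!e, b)) := by
    intro e a b
    rw [hcross, ← hCs, map_mul, map_mul]
    refine ((msame (!e) a b).mul_left (K.I_mcx_semiconj a e)).mul_left ?_
    exact fix' _ _ (swap_apply_of_ne_of_ne (by simp) (by simp))
  have mswap : ∀ p q : Bits (n + 1), SemiconjBy (K.I (ρ' (swap p q))) (K.mcx p) (K.mcx q) := by
    rintro ⟨c, a⟩ ⟨d, b⟩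
    by_cases hcd : c = d
    · subst hcd; exact msame c a b
    · obtain rfl : d = !c := by revert hcd; cases c <;> cases d <;> simp
      exact mdiff c a b
  refine ⟨fix, fun σ => ?_, ?_⟩
  · induction σ using Perm.swap_induction_on with
    | one => intro a; rw [map_one, map_one]; exact Commute.one_left _
    | swap_mul f x y hxy ih =>
      intro a
      rw [map_mul, map_mul]
      refine SemiconjBy.mul_left ?_ (ih a)
      rw [Perm.mul_apply]
      generalize f a = z
      by_cases hx : z = x
      · subst hx; rw [swap_apply_left]; exact mswap _ _
      by_cases hy : z = y
      · subst hy; rw [swap_apply_right, swap_comm]; exact mswap _ _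
      rw [swap_apply_of_ne_of_ne hx hy]
      exact fix' _ _ (swap_apply_of_ne_of_ne hx hy)
  · rintro ⟨c, a⟩ ⟨d, b⟩ hab
    by_cases hcd : c = d
    · subst hcd
      rw [hCs, mcx_cons, ← K.conjT_C]
      simp only [← map_mul]
      rw [h.braid a b (by rintro rfl; exact hab rfl)]
    · obtain rfl : d = !c := by revert hcd; cases c <;> cases d <;> simp
      rw [hcross, map_mul, map_mul]
      have h1 : Commute (K.C true (K.C (!c) (ρ (swap a b)))) (K.mcx (n := n + 1) (c, a)) :=
        hne (!c) c _ a (by simp)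
      have h2 := K.mcx_braid a c
      rw [← mcx_cons] at h2
      have h3 : K.C true (K.C (!c) (ρ (swap a b))) * K.C true (K.C (!c) (ρ (swap a b))) = 1 := by
        rw [← map_mul, ← map_mul, hsq, map_one, map_one]
      generalize K.C true (K.C (!c) (ρ (swap a b))) = G at *
      generalize K.mcx (n := n + 1) (c, a) = V at *
      generalize K.C true (K.mcx a) = U at *
      calc V * (G * U * G) * V = (V * G) * U * (G * V) := by simp only [mul_assoc]
        _ = (G * V) * U * (V * G) := congrArg₂ (fun p q => p * U * q) h1.eq.symm h1.eq
        _ = G * (V * U * V) * G := by simp only [mul_assoc]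
        _ = G * U * V * (G * G) * U * G := by rw [h2, h3, mul_one]; simp only [mul_assoc]
        _ = G * U * (V * G) * G * U * G := by simp only [mul_assoc]
        _ = G * U * G * V * (G * U * G) := by rw [← h1.eq]; simp only [mul_assoc]

/-- An action on words extends to words with one more bit: permutations of the words with first bit
`c` act under the control `C c`, and `K.mcx a` is the transposition of `(false, a)` and `(true,
a)`. -/
theorem IsAction.exists_succ {n : ℕ} {ρ : Perm (Bits n) →* E n} (h : K.IsAction ρ) :
    ∃ ρ' : Perm (Bits (n + 1)) →* E (n + 1),
      (∀ c σ, ρ' (Perm.prodExtendRight c σ) = K.C c (ρ σ)) ∧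
      ∀ a, ρ' (swap (α := Bits (n + 1)) (false, a) (true, a)) = K.mcx a := by
  obtain ⟨ρ', h1, h2⟩ := exists_hom_perm_bool_prod (fun c => (K.C c).comp ρ) K.mcx
    (fun σ τ => K.C_comm _ _) K.mcx_mul_self K.mcx_comm h.fix' h.move h.braid'
  refine ⟨ρ', h1, fun a => ?_⟩
  rw [← h2 a]

variable (K)

/-- The action of permutations of words, with the relations that its recursive construction needs.
-/
noncomputable def rhoAux : ∀ n, {ρ : Perm (Bits n) →* E n // K.IsAction ρ}
  | 0 => ⟨1, isAction_zero⟩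
  | n + 1 => ⟨(rhoAux n).2.exists_succ.choose,
      (rhoAux n).2.succ (rhoAux n).2.exists_succ.choose_spec.1
        (rhoAux n).2.exists_succ.choose_spec.2⟩

/-- The action of the permutations of the words of length `n` by operations on `n` wires. -/
noncomputable def rho (n : ℕ) : Perm (Bits n) →* E n := (K.rhoAux n).1

theorem rho_prodExtendRight {n : ℕ} (c : Bool) (σ : Perm (Bits n)) :
    K.rho (n + 1) (Perm.prodExtendRight c σ) = K.C c (K.rho n σ) :=
  (K.rhoAux n).2.exists_succ.choose_spec.1 c σ

theorem rho_swap {n : ℕ} (a : Bits n) :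
    K.rho (n + 1) (swap (α := Bits (n + 1)) (false, a) (true, a)) = K.mcx a :=
  (K.rhoAux n).2.exists_succ.choose_spec.2 a

end ControlTower

/-! ### Negation, exchange and repeated control -/

/-- `prodExtendRight` as a homomorphism. -/
def Equiv.Perm.prodExtendRightHom {α β : Type*} [DecidableEq α] (c : α) :
    Perm β →* Perm (α × β) where
  toFun σ := Perm.prodExtendRight c σ
  map_one' := by
    ext1 ⟨d, x⟩
    by_cases h : d = c
    · subst h; simp
    · rw [Perm.prodExtendRight_apply_ne _ h]; rfl
  map_mul' σ τ := by
    ext1 ⟨d, x⟩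
    rw [Perm.mul_apply]
    by_cases h : d = c
    · subst h; simp
    · simp [Perm.prodExtendRight_apply_ne _ h]

namespace Bits

/-- Negation of the first bit. -/
def flip (n : ℕ) : Perm (Bits (n + 1)) where
  toFun a := (!a.1, a.2)
  invFun a := (!a.1, a.2)
  left_inv a := by simp
  right_inv a := by simp

/-- Exchange of the first two bits. -/
def exch (n : ℕ) : Perm (Bits (n + 2)) where
  toFun a := (a.2.1, a.1, a.2.2)
  invFun a := (a.2.1, a.1, a.2.2)
  left_inv _ := rfl
  right_inv _ := rfl

theorem exch_mul_exch (n : ℕ) : exch n * exch n = 1 := rfl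

theorem exch_inv (n : ℕ) : (exch n)⁻¹ = exch n := rfl

/-- The permutation acting as `σ` on all bits but the first. -/
def lift {n : ℕ} (σ : Perm (Bits n)) : Perm (Bits (n + 1)) :=
  Perm.prodExtendRight false σ * Perm.prodExtendRight true σ

theorem lift_apply {n : ℕ} (σ : Perm (Bits n)) (a : Bits (n + 1)) : lift σ a = (a.1, σ a.2) := by
  obtain ⟨_ | _, a⟩ := a
  · simp [lift, Perm.prodExtendRight_apply_ne]
  · simp [lift, Perm.prodExtendRight_apply_ne]

/-- Negation of the first bit is a product of the transpositions `(false, a) ↔ (true, a)`. -/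
theorem flip_mem_closure (n : ℕ) : flip n ∈ Submonoid.closure
    (Set.range fun a : Bits n => swap (α := Bits (n + 1)) (false, a) (true, a)) := by
  classical
  have key : ∀ S : Finset (Bits n), ∃ σ ∈ Submonoid.closure
      (Set.range fun a : Bits n => swap (α := Bits (n + 1)) (false, a) (true, a)),
      ∀ c a, σ (c, a) = if a ∈ S then (!c, a) else (c, a) := by
    intro S
    induction S using Finset.induction_on with
    | empty => exact ⟨1, one_mem _, fun c a => by simp⟩
    | insert b S hb ih =>
      obtain ⟨σ, h1, h2⟩ := ih
      refine ⟨swap (false, b) (true, b) * σ,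
        mul_mem (Submonoid.subset_closure ⟨b, rfl⟩) h1, fun c a => ?_⟩
      rw [Perm.mul_apply, h2]
      by_cases hab : a = b
      · subst hab
        rw [if_neg hb, if_pos (Finset.mem_insert_self _ _)]
        cases c
        · exact swap_apply_left _ _
        · exact swap_apply_right _ _
      · have : ∀ d : Bool, swap (α := Bits (n + 1)) (false, b) (true, b) (d, a) = (d, a) := fun d =>
          swap_apply_of_ne_of_ne (by simp [hab]) (by simp [hab])
        simp only [Finset.mem_insert, hab, false_or]
        split_ifs <;> exact this _
  have := Fintype.ofFinite (Bits n)
  obtain ⟨σ, h1, h2⟩ := key Finset.univ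
  convert h1
  ext1 ⟨c, a⟩
  rw [h2]; simp [flip]

end Bits

namespace ControlTower

open Bits

variable {E : ℕ → Type u} [∀ n, Monoid (E n)] (K : ControlTower E)

theorem rho_lift {n : ℕ} (σ : Perm (Bits n)) : K.rho (n + 1) (lift σ) = K.I (K.rho n σ) := by
  rw [lift, map_mul, rho_prodExtendRight, rho_prodExtendRight]; rfl

theorem rho_exch_conj_of_mem {n : ℕ} (σ : Perm (Bits (n + 1))) (hσ : σ ∈ Submonoid.closure
    (Set.range fun a : Bits n => swap (α := Bits (n + 1)) (false, a) (true, a))) :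
    K.rho (n + 2) (exch n * Perm.prodExtendRight true σ * exch n) =
      K.conjT n (K.C true (K.rho (n + 1) σ)) := by
  let φ : Perm (Bits (n + 1)) →* E (n + 2) := (K.rho (n + 2)).comp
    ((conjInvolution (exch n) (exch_mul_exch n)).comp (Perm.prodExtendRightHom true))
  let ψ : Perm (Bits (n + 1)) →* E (n + 2) :=
    (K.conjT n).comp ((K.C true).comp (K.rho (n + 1)))
  have : Set.EqOn φ ψ (Set.range fun a : Bits n =>
      swap (α := Bits (n + 1)) (false, a) (true, a)) := by
    rintro _ ⟨a, rfl⟩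
    change K.rho (n + 2) (exch n * Perm.prodExtendRight true (swap (false, a) (true, a)) * exch n) =
      K.conjT n (K.C true (K.rho (n + 1) (swap (false, a) (true, a))))
    rw [rho_swap, ← mcx_cons, ← rho_swap, Perm.prodExtendRight_swap]
    congr 1
    exact (swap_apply_apply (exch n) _ _).symm
  exact MonoidHom.eqOn_closureM this hσ

/-- If negation of the first bit acts as `X`, then exchange of the first two bits acts as `T`,
since both are the same product of three controlled negations. -/
theorem rho_exch_of_rho_flip {n : ℕ} (h : K.rho (n + 1) (flip n) = K.X n) :
    K.rho (n + 2) (exch n) = K.T n := by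
  have h1 : exch n = Perm.prodExtendRight true (flip n) *
      (exch n * Perm.prodExtendRight true (flip n) * exch n) *
      Perm.prodExtendRight true (flip n) := by
    ext1 ⟨_ | _, _ | _, a⟩ <;> rfl
  rw [h1, map_mul, map_mul, K.rho_exch_conj_of_mem _ (flip_mem_closure n), rho_prodExtendRight, h]
  exact K.T_eq n

/-- Negation of the first bit acts as `X`. On more than one bit, negation of the first bit is
conjugate by an exchange to negation of the second. -/
theorem rho_flip : ∀ n, K.rho (n + 1) (flip n) = K.X n
  | 0 => by
    have : flip 0 = swap (α := Bits 1) (false, ()) (true, ()) := by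
      ext1 ⟨_ | _, a⟩ <;> rfl
    rw [this]; exact K.rho_swap (n := 0) ()
  | n + 1 => by
    have : flip (n + 1) = exch n * lift (flip n) * exch n := by
      ext1 ⟨c, d, a⟩
      rw [Perm.mul_apply, Perm.mul_apply, lift_apply]; rfl
    have ih := rho_flip n
    rw [this, map_mul, map_mul, K.rho_exch_of_rho_flip ih, rho_lift, ih]
    exact K.T_X n

/-- Exchange of the first two bits acts as `T`. -/
theorem rho_exch (n : ℕ) : K.rho (n + 2) (exch n) = K.T n := K.rho_exch_of_rho_flip (K.rho_flip n)

/-- Adding `k` positive controls. -/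
def Cpow {m : ℕ} : ∀ k : ℕ, E m →* E (m + k)
  | 0 => MonoidHom.id _
  | k + 1 => (K.C true).comp (Cpow k)

theorem Cpow_succ {m k : ℕ} (f : E m) : K.Cpow (k + 1) f = K.C true (K.Cpow k f) := rfl

end ControlTower

namespace Bits

/-- Prefixing a word with `k` ones. -/
def ones {m : ℕ} : ∀ k : ℕ, Bits m → Bits (m + k)
  | 0, a => a
  | k + 1, a => (true, ones k a)

theorem ones_injective {m : ℕ} : ∀ k : ℕ, Function.Injective (ones (m := m) k)
  | 0 => fun _ _ h => h
  | k + 1 => fun _ _ h => ones_injective k (Prod.ext_iff.1 h).2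

end Bits

namespace ControlTower

open Bits

variable {E : ℕ → Type u} [∀ n, Monoid (E n)] (K : ControlTower E)

/-- A negation of the first wire that is controlled by a word which does not begin with `k` ones
commutes with an operation under `k + 1` controls. -/
theorem mcx_comm_Cpow {m : ℕ} (f : E m) : ∀ (k : ℕ) (b : Bits (m + k)), (∀ a, ones k a ≠ b) →
    Commute (K.mcx b) (K.C true (K.Cpow k f))
  | 0, b, hb => absurd rfl (hb b)
  | k + 1, b, hb => by
    obtain ⟨c, b⟩ := b
    rw [Cpow_succ, mcx_cons (n := m + k), ← K.conjT_C]
    refine Commute.map ?_ _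
    cases c
    · exact K.C_comm _ _
    · exact Commute.map (mcx_comm_Cpow f k b fun a ha => hb a (by rw [← ha]; rfl)) _

/-- A transposition of words that do not begin with `k` ones commutes with an operation under `k`
controls. -/
theorem rho_swap_comm_Cpow {m : ℕ} (f : E m) : ∀ (k : ℕ) (x y : Bits (m + k)),
    (∀ a, ones k a ≠ x) → (∀ a, ones k a ≠ y) →
    Commute (K.rho (m + k) (swap x y)) (K.Cpow k f)
  | 0, x, _, hx, _ => absurd rfl (hx x)
  | k + 1, x, y, hx, hy => by
    obtain ⟨c, x⟩ := x
    obtain ⟨d, y⟩ := y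
    have hones : ∀ z, (∀ a : Bits m, (true, ones k a) ≠ (true, z)) → ∀ a : Bits m, ones k a ≠ z :=
      fun z hz a ha => hz a (by rw [ha])
    have hcross : ∀ x y : Bits (m + k), (∀ a : Bits m, ones k a ≠ y) → Commute (K.rho (m + k + 1)
        (swap (α := Bits (m + k + 1)) (false, x) (true, y))) (K.Cpow (k + 1) f) := by
      intro x y hy
      rw [swap_comm]
      have := swap_eq_conj_prodExtendRight true y x
      rw [Bool.not_true] at this
      rw [this, map_mul, map_mul, rho_prodExtendRight, swap_comm (true, y), rho_swap]
      have h1 : Commute (K.C false (K.rho (m + k) (swap y x))) (K.Cpow (k + 1) f) := K.C_comm _ _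
      exact (h1.mul_left (K.mcx_comm_Cpow f k y hy)).mul_left h1
    cases c <;> cases d
    · change Commute (K.rho (m + k + 1) (swap (false, x) (false, y))) _
      rw [← Perm.prodExtendRight_swap, rho_prodExtendRight]
      exact K.C_comm _ _
    · exact hcross x y (hones y hy)
    · rw [swap_comm]; exact hcross y x (hones x hx)
    · change Commute (K.rho (m + k + 1) (swap (true, x) (true, y))) _
      rw [← Perm.prodExtendRight_swap, rho_prodExtendRight]
      exact (rho_swap_comm_Cpow f k x y (hones x hx) (hones y hy)).map _

/-- A permutation that fixes the words beginning with `k` ones commutes with the operations under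
`k` controls, which act on these words only. This makes the placement of an operation at given words
well defined. -/
theorem rho_comm_Cpow {m k : ℕ} (f : E m) (σ : Perm (Bits (m + k)))
    (hσ : ∀ a, σ (ones k a) = ones k a) : Commute (K.rho (m + k) σ) (K.Cpow k f) := by
  refine commute_perm_of_fix (K.rho (m + k)) (Set.range (ones k)) _ ?_ σ ?_
  · intro x y hx hy _
    exact K.rho_swap_comm_Cpow f k x y (fun a ha => hx ⟨a, ha⟩) (fun a ha => hy ⟨a, ha⟩)
  · rintro _ ⟨a, rfl⟩; exact hσ a

end ControlTower

/-! ### Ordered products -/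

/-- The ordered product `F 0 * ⋯ * F (n - 1)`. -/
def seqProd {M : Type*} [Monoid M] (F : ℕ → M) : ℕ → M
  | 0 => 1
  | n + 1 => seqProd F n * F n

section seqProd

variable {M : Type*} [Monoid M]

theorem seqProd_congr {F G : ℕ → M} : ∀ {n : ℕ}, (∀ i < n, F i = G i) → seqProd F n = seqProd G n
  | 0, _ => rfl
  | n + 1, h => by
    rw [seqProd, seqProd, seqProd_congr fun i hi => h i (Nat.lt_succ_of_lt hi), h n n.lt_succ_self]

theorem seqProd_eq_one {F : ℕ → M} : ∀ {n : ℕ}, (∀ i < n, F i = 1) → seqProd F n = 1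
  | 0, _ => rfl
  | n + 1, h => by
    rw [seqProd, seqProd_eq_one fun i hi => h i (Nat.lt_succ_of_lt hi), h n n.lt_succ_self, one_mul]

theorem seqProd_one (F : ℕ → M) : seqProd F 1 = F 0 := one_mul _

theorem seqProd_add (F : ℕ → M) (a : ℕ) :
    ∀ b : ℕ, seqProd F (a + b) = seqProd F a * seqProd (fun i => F (a + i)) b
  | 0 => (mul_one _).symm
  | b + 1 => by
    rw [← Nat.add_assoc, seqProd, seqProd_add F a b, seqProd, mul_assoc]

theorem seqProd_commute {F : ℕ → M} {x : M} :
    ∀ {n : ℕ}, (∀ i < n, Commute (F i) x) → Commute (seqProd F n) x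
  | 0, _ => Commute.one_left _
  | n + 1, h => (seqProd_commute fun i hi => h i (Nat.lt_succ_of_lt hi)).mul_left
      (h n n.lt_succ_self)

theorem seqProd_semiconj {g : M} {F G : ℕ → M} :
    ∀ {n : ℕ}, (∀ i < n, SemiconjBy g (F i) (G i)) → SemiconjBy g (seqProd F n) (seqProd G n)
  | 0, _ => SemiconjBy.one_right _
  | n + 1, h => (seqProd_semiconj fun i hi => h i (Nat.lt_succ_of_lt hi)).mul_right
      (h n n.lt_succ_self)

theorem map_seqProd {N : Type*} [Monoid N] (φ : M →* N) (F : ℕ → M) :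
    ∀ n : ℕ, φ (seqProd F n) = seqProd (fun i => φ (F i)) n
  | 0 => map_one φ
  | n + 1 => by rw [seqProd, map_mul, map_seqProd φ F n, seqProd]

theorem seqProd_mul_distrib {F G : ℕ → M} :
    ∀ {n : ℕ}, (∀ i < n, ∀ j < i, Commute (G j) (F i)) →
      seqProd (fun i => F i * G i) n = seqProd F n * seqProd G n
  | 0, _ => (mul_one _).symm
  | n + 1, h => by
    have h1 : Commute (seqProd G n) (F n) := seqProd_commute fun j hj => h n n.lt_succ_self j hj
    rw [seqProd, seqProd_mul_distrib fun i hi => h i (Nat.lt_succ_of_lt hi), seqProd, seqProd,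
      mul_assoc, ← mul_assoc _ (F n), h1.eq]
    simp only [mul_assoc]

theorem seqProd_mul (F : ℕ → M) (m : ℕ) :
    ∀ k : ℕ, seqProd F (k * m) = seqProd (fun i => seqProd (fun j => F (i * m + j)) m) k
  | 0 => by rw [Nat.zero_mul]; rfl
  | k + 1 => by rw [Nat.succ_mul, seqProd_add, seqProd_mul F m k, seqProd]

theorem seqProd_comm (F : ℕ → ℕ → M) (m : ℕ) : ∀ k : ℕ,
    (∀ i < k, ∀ j < m, ∀ i' < k, ∀ j' < m, i ≠ i' → Commute (F i j) (F i' j')) →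
    seqProd (fun i => seqProd (F i) m) k = seqProd (fun j => seqProd (fun i => F i j) k) m
  | 0, _ => (seqProd_eq_one fun _ _ => rfl).symm
  | k + 1, h => by
    rw [seqProd, seqProd_comm F m k fun i hi j hj i' hi' j' hj' =>
      h i (Nat.lt_succ_of_lt hi) j hj i'
      (Nat.lt_succ_of_lt hi') j' hj', ← seqProd_mul_distrib]
    · rfl
    · intro i hi j hj
      exact (seqProd_commute fun i' hi' => h i' (Nat.lt_succ_of_lt hi') i hi k k.lt_succ_self j
        (hj.trans hi) hi'.ne).symm

end seqProd

/-! ### Permutations along an injection -/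

/-- `σ` sends `e i` to `e (p i)` for `i < N` and fixes all other points. -/
def Along {X : Type*} (e : ℕ → X) (N : ℕ) (p : ℕ → ℕ) (σ : Perm X) : Prop :=
  (∀ i < N, σ (e i) = e (p i)) ∧ ∀ y, (∀ i < N, e i ≠ y) → σ y = y

theorem Along.unique {X : Type*} {e : ℕ → X} {N : ℕ} {p : ℕ → ℕ} {σ τ : Perm X}
    (h : Along e N p σ) (h' : Along e N p τ) : σ = τ := by
  ext1 y
  by_cases hy : ∀ i < N, e i ≠ y
  · rw [h.2 y hy, h'.2 y hy]
  · push Not at hy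
    obtain ⟨i, hi, rfl⟩ := hy
    rw [h.1 i hi, h'.1 i hi]

theorem exists_along {X : Type*} {e : ℕ → X} {N : ℕ} (he : Set.InjOn e (Set.Iio N)) (p : ℕ → ℕ)
    (hp : ∀ i < N, p i < N) (hinj : ∀ i < N, ∀ j < N, p i = p j → i = j) :
    ∃ σ : Perm X, Along e N p σ := by
  classical
  let q : Fin N → Fin N := fun i => ⟨p i, hp i i.2⟩
  have hq : Function.Injective q := fun i j h =>
    Fin.ext (hinj i i.2 j j.2 (Fin.ext_iff.1 h))
  let π : Perm (Fin N) := Equiv.ofBijective q (Finite.injective_iff_bijective.1 hq)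
  have hf : Function.Injective fun i : Fin N => e i := fun i j h => Fin.ext (he i.2 j.2 h)
  let f := Equiv.ofInjective _ hf
  refine ⟨π.extendDomain f, fun i hi => ?_, fun y hy => ?_⟩
  · exact Perm.extendDomain_apply_image π f ⟨i, hi⟩
  · refine Perm.extendDomain_apply_not_subtype π f ?_
    rintro ⟨i, rfl⟩
    exact hy i i.2 rfl

/-- The permutation of positions underlying the symmetry `m + n → n + m`. -/
def swapFun (m n i : ℕ) : ℕ := if i < m then n + i else i - m

theorem exists_along_swapFun {X : Type*} {m n : ℕ} {e : ℕ → X}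
    (he : Set.InjOn e (Set.Iio (m + n))) : ∃ σ : Perm X, Along e (m + n) (swapFun m n) σ :=
  exists_along he _ (fun i hi => by unfold swapFun; split_ifs <;> omega)
    fun i hi j hj h => by unfold swapFun at h; split_ifs at h <;> omega

/-! ### Realisations -/

/-- The morphisms of a prop acting at positions in a set `X`, inside a monoid `M` in which the
permutations of `X` act by `perm`: `val f e` is the morphism `f : m → n` placed at the positions
`e 0, …, e (m - 1)`. The laws are required for sequences of distinct positions only. -/
structure Realisation (Q : PropData.{u}) (X : Type) (M : Type v) [Monoid M] where
  perm : Perm X →* M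
  val {m n : ℕ} (f : Q.Hom m n) (e : ℕ → X) : M
  endo {m n : ℕ} (f : Q.Hom m n) : m = n
  val_id {n : ℕ} {e : ℕ → X} (he : Set.InjOn e (Set.Iio n)) : val (Q.id n) e = 1
  val_comp {l m n : ℕ} (g : Q.Hom m n) (f : Q.Hom l m) {e : ℕ → X}
    (he : Set.InjOn e (Set.Iio l)) : val (Q.comp g f) e = val g e * val f e
  val_add {k l m n : ℕ} (f : Q.Hom k l) (g : Q.Hom m n) {e : ℕ → X}
    (he : Set.InjOn e (Set.Iio (k + m))) :
    val (Q.add f g) e = val f e * val g (fun i => e (k + i))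
  val_swap {m n : ℕ} {e : ℕ → X} (he : Set.InjOn e (Set.Iio (m + n))) {σ : Perm X}
    (hσ : Along e (m + n) (swapFun m n) σ) : val (Q.swap m n) e = perm σ
  val_conj {m n : ℕ} (f : Q.Hom m n) {e : ℕ → X} (he : Set.InjOn e (Set.Iio m)) (σ : Perm X) :
    SemiconjBy (perm σ) (val f e) (val f fun i => σ (e i))
  val_congr {m n : ℕ} (f : Q.Hom m n) {e e' : ℕ → X} (h : ∀ i < m, e i = e' i) :
    val f e = val f e'
  val_comm {k l m n : ℕ} (f : Q.Hom k l) (g : Q.Hom m n) {e e' : ℕ → X}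
    (he : Set.InjOn e (Set.Iio k)) (he' : Set.InjOn e' (Set.Iio m))
    (h : ∀ i < k, ∀ j < m, e i ≠ e' j) : Commute (val f e) (val g e')

namespace Realisation

variable {Q : PropData.{u}} {X : Type} {M : Type v} [Monoid M] (R : Realisation Q X M)

theorem val_cast {m m' n n' : ℕ} (hm : m = m') (hn : n = n') (f : Q.Hom m n) (e : ℕ → X) :
    R.val (Q.cast hm hn f) e = R.val f e := by
  subst hm hn; rfl

theorem injOn_left {a b : ℕ} {e : ℕ → X} (he : Set.InjOn e (Set.Iio (a + b))) :
    Set.InjOn e (Set.Iio a) := he.mono (Set.Iio_subset_Iio (Nat.le_add_right a b))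

theorem injOn_shift {a b N : ℕ} {e : ℕ → X} (he : Set.InjOn e (Set.Iio N)) (h : a + b ≤ N) :
    Set.InjOn (fun i => e (a + i)) (Set.Iio b) := by
  intro i hi j hj hij
  simp only [Set.mem_Iio] at hi hj
  have := he (show a + i < N by omega) (show a + j < N by omega) hij
  omega

theorem injOn_mono {a N : ℕ} {e : ℕ → X} (he : Set.InjOn e (Set.Iio N)) (h : a ≤ N) :
    Set.InjOn e (Set.Iio a) := he.mono (Set.Iio_subset_Iio h)

theorem injOn_comp {a N : ℕ} {e : ℕ → X} (he : Set.InjOn e (Set.Iio N)) (p : ℕ → ℕ)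
    (h : ∀ i < a, p i < N) (hp : ∀ i < a, ∀ j < a, p i = p j → i = j) :
    Set.InjOn (fun i => e (p i)) (Set.Iio a) := fun i hi j hj hij =>
  hp i hi j hj (he (h i hi) (h j hj) hij)

theorem ne_of_injOn {N : ℕ} {e : ℕ → X} (he : Set.InjOn e (Set.Iio N)) {i j : ℕ} (hi : i < N)
    (hj : j < N) (h : i ≠ j) : e i ≠ e j := fun hij => h (he hi hj hij)

theorem grid_lt {a b m n : ℕ} (ha : a < m) (hb : b < n) : a * n + b < m * n := by
  calc a * n + b < a * n + n := by omega
    _ = (a + 1) * n := by ring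
    _ ≤ m * n := Nat.mul_le_mul_right n ha

theorem div_grid {a b n : ℕ} (hb : b < n) : (a * n + b) / n = a := by
  rw [Nat.mul_comm, Nat.mul_add_div (by omega), Nat.div_eq_of_lt hb, Nat.add_zero]

theorem mod_grid {a b n : ℕ} (hb : b < n) : (a * n + b) % n = b := by
  rw [Nat.mul_comm, Nat.mul_add_mod, Nat.mod_eq_of_lt hb]

theorem grid_inj {a b a' b' n : ℕ} (hb : b < n) (hb' : b' < n) (h : a * n + b = a' * n + b') :
    a = a' ∧ b = b' :=
  ⟨by rw [← div_grid (a := a) hb, h, div_grid hb'], by rw [← mod_grid (a := a) hb, h, mod_grid hb']⟩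

theorem injOn_row {k m : ℕ} {e : ℕ → X} (he : Set.InjOn e (Set.Iio (k * m))) {i : ℕ} (hi : i < k) :
    Set.InjOn (fun b => e (i * m + b)) (Set.Iio m) :=
  injOn_comp he _ (fun _ hb => grid_lt hi hb) fun _ _ _ _ h => by omega

theorem injOn_col {k m : ℕ} {e : ℕ → X} (he : Set.InjOn e (Set.Iio (k * m))) {j : ℕ} (hj : j < m) :
    Set.InjOn (fun a => e (a * m + j)) (Set.Iio k) :=
  injOn_comp he _ (fun _ ha => grid_lt ha hj) fun _ _ _ _ h => (grid_inj hj hj h).1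

theorem val_copies {k l : ℕ} (f : Q.Hom k l) : ∀ (N : ℕ) {e : ℕ → X},
    Set.InjOn e (Set.Iio (N * k)) →
    R.val (Q.copies f N) e = seqProd (fun i => R.val f fun b => e (i * k + b)) N
  | 0, e, he => by
    rw [PropData.copies, val_cast, R.val_id (by rwa [Nat.zero_mul] at he)]; rfl
  | N + 1, e, he => by
    rw [Nat.succ_mul] at he
    rw [PropData.copies, val_cast, R.val_add _ _ he, val_copies f N (injOn_left he), seqProd]

/-- The left distributor acts as a permutation of the positions. -/
theorem val_leftDist (n : ℕ) : ∀ (m : ℕ) {e : ℕ → X}, Set.InjOn e (Set.Iio (m * (n + 1))) →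
    ∃ σ : Perm X, R.val (Q.leftDist n m) e = R.perm σ ∧
      (∀ a < m, ∀ b < n, σ (e (a * (n + 1) + b)) = e (a * n + b)) ∧
      (∀ a < m, σ (e (a * (n + 1) + n)) = e (m * n + a)) ∧
      ∀ y, (∀ i < m * (n + 1), e i ≠ y) → σ y = y
  | 0, e, he => by
    refine ⟨1, ?_, by simp, by simp, fun _ _ => rfl⟩
    rw [PropData.leftDist, val_cast, R.val_id (by rwa [Nat.zero_mul] at he), map_one]
  | m + 1, e, he => by
    have hN : (m + 1) * (n + 1) = m * (n + 1) + (n + 1) := by ring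
    have hN' : (m + 1) * (n + 1) = m * n + (m + n) + 1 := by ring
    have hmn : m * (n + 1) = m * n + m := by ring
    have he1 : Set.InjOn e (Set.Iio (m * (n + 1) + (n + 1))) := by rwa [← hN]
    have he2 : Set.InjOn e (Set.Iio (m * n + (m + n) + 1)) := by rwa [← hN']
    obtain ⟨σ, h0, h1, h2, h3⟩ := val_leftDist n m (injOn_left he1)
    have he3 : Set.InjOn (fun i => e (m * n + i)) (Set.Iio (m + n)) :=
      injOn_shift he2 (Nat.le_succ _)
    obtain ⟨τ, hτ1, hτ2⟩ := exists_along_swapFun he3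
    refine ⟨τ * σ, ?_, ?_, ?_, ?_⟩
    · rw [PropData.leftDist, R.val_comp _ _ he, val_cast, val_cast, R.val_add _ _ he2,
        R.val_add _ _ (injOn_left he2), R.val_add _ _ he1, h0,
        R.val_id (injOn_left (injOn_left he2)), R.val_swap he3 ⟨hτ1, hτ2⟩,
        R.val_id (injOn_shift he2 le_rfl), R.val_id (injOn_shift he1 le_rfl), map_mul]
      simp
    · intro a ha b hb
      rw [Perm.mul_apply]
      rcases Nat.lt_succ_iff_lt_or_eq.1 ha with ha | rfl
      · rw [h1 a ha b hb]
        refine hτ2 _ fun i hi => ne_of_injOn he2 (by omega) ?_ ?_ <;>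
          have := grid_lt ha hb <;> omega
      · rw [h3]
        · have := hτ1 (a + b) (by omega)
          simp only [swapFun] at this
          rw [if_neg (by omega), ← Nat.add_assoc, ← hmn] at this
          rw [this]; congr 1; omega
        · intro i hi
          exact ne_of_injOn he1 (by omega) (by omega) (by omega)
    · intro a ha
      rw [Perm.mul_apply]
      rcases Nat.lt_succ_iff_lt_or_eq.1 ha with ha | rfl
      · rw [h2 a ha]
        have := hτ1 a (by omega)
        simp only [swapFun] at this
        rw [if_pos ha] at this
        rw [this]; congr 1; ring
      · rw [h3]
        · rw [hτ2]
          · congr 1; ring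
          · intro i hi
            exact ne_of_injOn he2 (by omega) (by omega) (by omega)
        · intro i hi
          exact ne_of_injOn he1 (by omega) (by omega) (by omega)
    · intro y hy
      rw [Perm.mul_apply, h3 y fun i hi => hy i (by omega), hτ2 y fun i hi => hy _ (by omega)]

/-- The symmetry of the tensor product acts as the permutation that transposes a grid of positions.
-/
theorem val_mulSwap (m : ℕ) : ∀ (n : ℕ) {e : ℕ → X}, Set.InjOn e (Set.Iio (m * n)) →
    ∃ σ : Perm X, R.val (Q.mulSwap m n) e = R.perm σ ∧
      (∀ a < m, ∀ b < n, σ (e (a * n + b)) = e (b * m + a)) ∧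
      ∀ y, (∀ i < m * n, e i ≠ y) → σ y = y
  | 0, e, he => by
    refine ⟨1, ?_, by simp, fun _ _ => rfl⟩
    rw [PropData.mulSwap, val_cast, R.val_id (by simp), map_one]
  | n + 1, e, he => by
    have hN : m * (n + 1) = m * n + m := by ring
    have he' : Set.InjOn e (Set.Iio (m * n + m)) := by rwa [← hN]
    obtain ⟨σ, h0, h1, h2, h3⟩ := R.val_leftDist n m he
    obtain ⟨τ, t0, t1, t2⟩ := val_mulSwap m n (injOn_left he')
    refine ⟨τ * σ, ?_, ?_, ?_⟩
    · rw [PropData.mulSwap, val_cast, R.val_comp _ _ he, R.val_add _ _ he', h0, t0,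
        R.val_id (injOn_shift he' le_rfl), map_mul, mul_one]
    · intro a ha b hb
      rw [Perm.mul_apply]
      rcases Nat.lt_succ_iff_lt_or_eq.1 hb with hb | rfl
      · rw [h1 a ha b hb, t1 a ha b hb]
      · rw [h2 a ha, t2]
        · rw [Nat.mul_comm]
        · intro i hi
          exact ne_of_injOn he' (by omega) (by omega) (by omega)
    · intro y hy
      rw [Perm.mul_apply, h3 y hy, t2 y fun i hi => hy i (by omega)]

theorem forall_grid {m n : ℕ} {p : ℕ → Prop} (h : ∀ a < m, ∀ b < n, p (a * n + b)) :
    ∀ i < m * n, p i := by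
  intro i hi
  have hn : 0 < n := Nat.pos_of_ne_zero (by rintro rfl; simp at hi)
  have := h (i / n) (Nat.div_lt_of_lt_mul (by rwa [Nat.mul_comm])) (i % n) (Nat.mod_lt _ hn)
  rwa [Nat.div_add_mod'] at this

/-- A copy of `f` on each of the `m` columns of the grid `e`, whose entry in row `a` and column `b`
is `e (a * m + b)`. -/
def cols {k l : ℕ} (f : Q.Hom k l) (m : ℕ) (e : ℕ → X) : M :=
  seqProd (fun j => R.val f fun a => e (a * m + j)) m

/-- A copy of `h` on each of the `k` rows of the grid `e`, whose entry in row `a` and column `b`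
is `e (a * m + b)`. -/
def rows {m n : ℕ} (h : Q.Hom m n) (k : ℕ) (e : ℕ → X) : M :=
  seqProd (fun i => R.val h fun b => e (i * m + b)) k

/-- `f ⊗ h` is a copy of `f` on each column times a copy of `h` on each row. -/
theorem val_kron {k l m n : ℕ} (f : Q.Hom k l) (h : Q.Hom m n) {e : ℕ → X}
    (he : Set.InjOn e (Set.Iio (k * m))) :
    R.val (Q.kron f h) e = R.cols f m e * R.rows h k e := by
  obtain rfl := R.endo f
  obtain rfl := R.endo h
  have he' : Set.InjOn e (Set.Iio (m * k)) := by rwa [Nat.mul_comm]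
  obtain ⟨σ, h0, h1, h2⟩ := R.val_mulSwap k m he
  obtain ⟨τ, t0, t1, t2⟩ := R.val_mulSwap m k he'
  have hτσ : τ * σ = 1 := by
    ext1 y
    by_cases hy : ∀ i < k * m, e i ≠ y
    · rw [Perm.mul_apply, h2 y hy, t2 y (by rwa [Nat.mul_comm])]; rfl
    · push Not at hy
      obtain ⟨i, hi, rfl⟩ := hy
      revert i
      refine forall_grid fun a ha b hb => ?_
      rw [Perm.mul_apply, h1 a ha b hb, t1 b hb a ha]; rfl
  rw [PropData.kron, R.val_comp _ _ he, R.val_comp _ _ he, R.val_comp _ _ he, h0, t0,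
    R.val_copies _ _ he, R.val_copies _ _ he', ← mul_assoc, ← mul_assoc]
  congr 1
  have : SemiconjBy (R.perm τ) (seqProd (fun i => R.val f fun b => e (i * k + b)) m)
      (seqProd (fun j => R.val f fun a => e (a * m + j)) m) := by
    refine seqProd_semiconj fun i hi => ?_
    have := R.val_conj f (injOn_row he' hi) τ
    rwa [R.val_congr f fun b hb => t1 i hi b hb] at this
  rw [this.eq, mul_assoc, ← map_mul, hτσ, map_one, mul_one]
  rfl

end Realisation

/-! ### Symmetric groups acting on a tower of monoids -/

/-- Two sequences of distinct points of a finite set are related by a permutation of the set. -/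
theorem exists_perm_map {X : Type*} [Finite X] {N : ℕ} {u e : ℕ → X} (hu : Set.InjOn u (Set.Iio N))
    (he : Set.InjOn e (Set.Iio N)) : ∃ σ : Perm X, ∀ i < N, σ (u i) = e i := by
  classical
  have := Fintype.ofFinite X
  have hu' : Function.Injective fun i : Fin N => u i := fun i j h => Fin.ext (hu i.2 j.2 h)
  have he' : Function.Injective fun i : Fin N => e i := fun i j h => Fin.ext (he i.2 j.2 h)
  let f := (Equiv.ofInjective _ hu').symm.trans (Equiv.ofInjective _ he')
  refine ⟨f.extendSubtype, fun i hi => ?_⟩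
  rw [Equiv.extendSubtype_apply_of_mem f (u i) ⟨⟨i, hi⟩, rfl⟩]
  have : (Equiv.ofInjective _ hu').symm ⟨u i, ⟨⟨i, hi⟩, rfl⟩⟩ = ⟨i, hi⟩ :=
    (Equiv.ofInjective _ hu').symm_apply_apply ⟨i, hi⟩
  simp only [f, Equiv.trans_apply]
  rw [this]; rfl

/-- Monoids `E n` with inclusions `J : E n → E (n + 1)` and involutions `V n` of `E (n + 2)` that
satisfy the relations of the adjacent transpositions of the last two letters. -/
structure SymTower (E : ℕ → Type u) [∀ n, Monoid (E n)] where
  J {n : ℕ} : E n →* E (n + 1)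
  V (n : ℕ) : E (n + 2)
  V_mul_V (n : ℕ) : V n * V n = 1
  V_J {n : ℕ} (f : E n) : Commute (V n) (J (J f))
  V_braid (n : ℕ) : J (V n) * V (n + 1) * J (V n) = V (n + 1) * J (V n) * V (n + 1)

/-- The permutation of `Fin (n + 1)` that acts as `σ` and fixes the last element. -/
def Fin.permCastSucc {n : ℕ} (σ : Perm (Fin n)) : Perm (Fin (n + 1)) :=
  finSuccEquivLast.symm.permCongr (optionCongr σ)

theorem Fin.permCastSucc_castSucc {n : ℕ} (σ : Perm (Fin n)) (i : Fin n) :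
    Fin.permCastSucc σ i.castSucc = (σ i).castSucc := by
  simp [Fin.permCastSucc]

theorem Fin.permCastSucc_last {n : ℕ} (σ : Perm (Fin n)) :
    Fin.permCastSucc σ (Fin.last n) = Fin.last n := by
  simp [Fin.permCastSucc]

theorem Fin.exists_permCastSucc {n : ℕ} (σ : Perm (Fin (n + 1)))
    (hσ : σ (Fin.last n) = Fin.last n) : ∃ τ, σ = Fin.permCastSucc τ := by
  refine ⟨removeNone (finSuccEquivLast.permCongr σ), ?_⟩
  rw [Fin.permCastSucc, map_equiv_removeNone]
  simp [hσ]
  ext i; simp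

theorem Fin.permCastSucc_swap {n : ℕ} (i j : Fin n) :
    Fin.permCastSucc (swap i j) = swap i.castSucc j.castSucc := by
  ext1 x
  induction x using Fin.lastCases with
  | last =>
    rw [Fin.permCastSucc_last, swap_apply_of_ne_of_ne (Fin.castSucc_lt_last i).ne'
      (Fin.castSucc_lt_last j).ne']
  | cast x => rw [Fin.permCastSucc_castSucc, (Fin.castSucc_injective n).map_swap]

/-- Extension of a homomorphism on the permutations of `Fin n` to those of `Fin (n + 1)`, given the
images of the transpositions that involve the last element. -/
theorem exists_hom_perm_fin_succ {n : ℕ} {M : Type*} [Monoid M] (ρ : Perm (Fin n) →* M)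
    (d : Fin n → M) (hd : ∀ a, d a * d a = 1)
    (hconj : ∀ σ a, SemiconjBy (ρ σ) (d a) (d (σ a)))
    (hmul : ∀ a b, a ≠ b → d a * d b = ρ (swap a b) * d a) :
    ∃ ρ' : Perm (Fin (n + 1)) →* M, (∀ σ, ρ' (Fin.permCastSucc σ) = ρ σ) ∧
      ∀ a : Fin n, ρ' (swap a.castSucc (Fin.last n)) = d a := by
  obtain ⟨ρ', h1, h2⟩ := exists_hom_perm_option ρ d hd hconj hmul
  refine ⟨ρ'.comp finSuccEquivLast.permCongrHom.toMonoidHom, fun σ => ?_, fun a => ?_⟩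
  · rw [← h1]
    change ρ' (finSuccEquivLast.permCongr (finSuccEquivLast.symm.permCongr (optionCongr σ))) = _
    congr 1
    ext1 x; simp
  · rw [← h2]
    change ρ' (finSuccEquivLast.permCongr _) = _
    congr 1
    ext1 x
    rw [Equiv.permCongr_apply, finSuccEquivLast.injective.map_swap, finSuccEquivLast_castSucc,
      finSuccEquivLast_last, swap_comm]
    simp

namespace SymTower

variable {E : ℕ → Type u} [∀ n, Monoid (E n)] (S : SymTower E)

/-- Actions on `n + 1` and `n + 2` letters that are compatible with `J` and `V` extend to `n + 3`
letters. -/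
theorem exists_step {n : ℕ} {ρ : Perm (Fin (n + 1)) →* E (n + 1)}
    {ρ' : Perm (Fin (n + 2)) →* E (n + 2)}
    (h1 : ∀ σ, ρ' (Fin.permCastSucc σ) = S.J (ρ σ))
    (h2 : ρ' (swap (Fin.last n).castSucc (Fin.last (n + 1))) = S.V n) :
    ∃ ρ'' : Perm (Fin (n + 3)) →* E (n + 3), (∀ σ, ρ'' (Fin.permCastSucc σ) = S.J (ρ' σ)) ∧
      ρ'' (swap (Fin.last (n + 1)).castSucc (Fin.last (n + 2))) = S.V (n + 1) := by
  let φ : Perm (Fin (n + 2)) →* E (n + 3) := S.J.comp ρ'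
  let L := Fin.last (n + 1)
  let P := (Fin.last n).castSucc
  have hPL : P ≠ L := (Fin.castSucc_lt_last _).ne
  have hinv : ∀ σ, φ σ⁻¹ * φ σ = 1 := fun σ => by rw [← map_mul, inv_mul_cancel, map_one]
  have hinv' : ∀ σ, φ σ * φ σ⁻¹ = 1 := fun σ => by rw [← map_mul, mul_inv_cancel, map_one]
  have hfix : ∀ σ, σ L = L → Commute (φ σ) (S.V (n + 1)) := by
    intro σ hσ
    obtain ⟨τ, rfl⟩ := Fin.exists_permCastSucc σ hσ
    change Commute (S.J (ρ' _)) _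
    rw [h1]; exact (S.V_J _).symm
  -- the transposition of `a` with the new letter is conjugate to that of the old last letter `L`
  let d : Fin (n + 2) → E (n + 3) := fun a => φ (swap L a) * S.V (n + 1) * φ (swap L a)⁻¹
  have hdσ : ∀ σ, d (σ L) = φ σ * S.V (n + 1) * φ σ⁻¹ := by
    intro σ
    have := (hfix ((swap L (σ L))⁻¹ * σ) (by simp)).eq
    rw [map_mul] at this
    calc φ (swap L (σ L)) * S.V (n + 1) * φ (swap L (σ L))⁻¹
        = φ (swap L (σ L)) * (S.V (n + 1) * (φ (swap L (σ L))⁻¹ * φ σ)) * φ σ⁻¹ := by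
          simp only [mul_assoc, hinv', mul_one]
      _ = (φ (swap L (σ L)) * φ (swap L (σ L))⁻¹) * φ σ * S.V (n + 1) * φ σ⁻¹ := by
          rw [← this]; simp only [mul_assoc]
      _ = _ := by rw [hinv', one_mul]
  have hconj : ∀ σ a, SemiconjBy (φ σ) (d a) (d (σ a)) := by
    intro σ a
    have h := hdσ (σ * swap L a)
    rw [Perm.mul_apply, swap_apply_left] at h
    rw [SemiconjBy, h, mul_inv_rev, map_mul, map_mul]
    simp only [d, mul_assoc, hinv, mul_one]
  have hdL : d L = S.V (n + 1) := by
    have := hdσ 1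
    simpa using this
  have hdP : d P = S.J (S.V n) * S.V (n + 1) * S.J (S.V n) := by
    have := hdσ (swap P L)
    rw [swap_apply_right, swap_inv] at this
    rw [this, ← h2]; rfl
  have hPLmul : d L * d P = φ (swap L P) * d L := by
    rw [hdP, hdL, S.V_braid, ← mul_assoc, ← mul_assoc, S.V_mul_V, one_mul, ← h2, swap_comm]; rfl
  obtain ⟨ρ'', k1, k2⟩ := exists_hom_perm_fin_succ φ d
    (fun a => by
      have := (hconj (swap L a) L).eq
      rw [swap_apply_left] at this
      have e : d a = φ (swap L a) * d L * φ (swap L a)⁻¹ := by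
        rw [this, mul_assoc, hinv', mul_one]
      rw [e, mul_assoc, ← mul_assoc (φ (swap L a)⁻¹), ← mul_assoc (φ (swap L a)⁻¹), hinv, one_mul,
        ← mul_assoc, mul_assoc (φ (swap L a)), hdL, S.V_mul_V, mul_one, hinv'])
    hconj
    (fun a b hab => by
      obtain ⟨σ, hσ⟩ : ∃ σ : Perm (Fin (n + 2)), σ L = a ∧ σ P = b := by
        have hb : swap L a b ≠ L := fun h => hab (by
          have := congrArg (swap L a) h
          rw [swap_apply_self, swap_apply_left] at this
          exact this.symm)
        refine ⟨swap L a * swap P (swap L a b), ?_, ?_⟩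
        · rw [Perm.mul_apply, swap_apply_of_ne_of_ne hPL.symm hb.symm, swap_apply_left]
        · rw [Perm.mul_apply, swap_apply_left, swap_apply_self]
      obtain ⟨rfl, rfl⟩ := hσ
      have e := (hconj σ L).mul_right (hconj σ P)
      rw [hPLmul] at e
      have e' : SemiconjBy (φ σ) (φ (swap L P) * d L) (φ (swap (σ L) (σ P)) * d (σ L)) := by
        refine SemiconjBy.mul_right ?_ (hconj σ L)
        rw [SemiconjBy, ← map_mul, ← map_mul, Equiv.mul_swap_eq_swap_mul]
      have := e.eq.symm.trans e'.eq
      have := congrArg (· * φ σ⁻¹) this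
      simpa only [mul_assoc, hinv', mul_one] using this)
  exact ⟨ρ'', k1, (k2 L).trans hdL⟩

theorem exists_base : ∃ ρ' : Perm (Fin 2) →* E 2,
    (∀ σ : Perm (Fin 1), ρ' (Fin.permCastSucc σ) = S.J ((1 : Perm (Fin 1) →* E 1) σ)) ∧
      ρ' (swap (Fin.last 0).castSucc (Fin.last 1)) = S.V 0 := by
  obtain ⟨ρ', k1, k2⟩ := exists_hom_perm_fin_succ (1 : Perm (Fin 1) →* E 2) (fun _ => S.V 0)
    (fun _ => S.V_mul_V 0) (fun _ _ => Commute.one_left _)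
    (fun a b hab => absurd (Subsingleton.elim a b) hab)
  exact ⟨ρ', fun σ => (k1 σ).trans (map_one _).symm, k2 _⟩

/-- The actions on `n + 1` and `n + 2` letters. -/
noncomputable def actionAux : ∀ n : ℕ,
    {p : (Perm (Fin (n + 1)) →* E (n + 1)) × (Perm (Fin (n + 2)) →* E (n + 2)) //
      (∀ σ, p.2 (Fin.permCastSucc σ) = S.J (p.1 σ)) ∧
      p.2 (swap (Fin.last n).castSucc (Fin.last (n + 1))) = S.V n}
  | 0 => ⟨(1, S.exists_base.choose), S.exists_base.choose_spec⟩
  | n + 1 => ⟨((actionAux n).1.2, (S.exists_step (actionAux n).2.1 (actionAux n).2.2).choose),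
      (S.exists_step (actionAux n).2.1 (actionAux n).2.2).choose_spec⟩

/-- The action of the symmetric groups by adjacent transpositions. -/
noncomputable def action : ∀ n : ℕ, Perm (Fin n) →* E n
  | 0 => 1
  | n + 1 => (S.actionAux n).1.1

theorem action_permCastSucc : ∀ {n : ℕ} (σ : Perm (Fin n)),
    S.action (n + 1) (Fin.permCastSucc σ) = S.J (S.action n σ)
  | 0, σ => by
    have : Subsingleton (Perm (Fin (0 + 1))) := inferInstanceAs (Subsingleton (Perm (Fin 1)))
    rw [Subsingleton.elim σ 1, map_one, map_one, Subsingleton.elim (Fin.permCastSucc 1) 1, map_one]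
  | n + 1, σ => (S.actionAux n).2.1 σ

theorem action_swap (n : ℕ) :
    S.action (n + 2) (swap (Fin.last n).castSucc (Fin.last (n + 1))) = S.V n :=
  (S.actionAux n).2.2

end SymTower

/-! ### Endomorphism monoids of a prop -/

namespace PropData

theorem cast_cast (P : PropData.{u}) {a a' a'' b b' b'' : ℕ} (h1 : a = a') (h2 : a' = a'')
    (k1 : b = b') (k2 : b' = b'') (f : P.Hom a b) :
    P.cast h2 k2 (P.cast h1 k1 f) = P.cast (h1.trans h2) (k1.trans k2) f := by
  subst h1 h2 k1 k2; rfl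

theorem cast_comp (P : PropData.{u}) {a a' b b' c c' : ℕ} (ha : a = a') (hb : b = b') (hc : c = c')
    (g : P.Hom b c) (f : P.Hom a b) :
    P.cast ha hc (P.comp g f) = P.comp (P.cast hb hc g) (P.cast ha hb f) := by
  subst ha hb hc; rfl

theorem cast_id (P : PropData.{u}) {a b : ℕ} (h h' : a = b) : P.cast h h' (P.id a) = P.id b := by
  subst h; rfl

end PropData

namespace StrictProp

variable (Q : StrictProp.{u})

/-- The monoid of endomorphisms of `n`. -/
abbrev End (n : ℕ) : Type u := Q.Hom n n

instance (n : ℕ) : Monoid (Q.End n) where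
  mul g f := Q.comp g f
  one := Q.id n
  mul_assoc h g f := Q.isProp.comp_assoc h g f
  one_mul f := Q.isProp.id_comp f
  mul_one f := Q.isProp.comp_id f

theorem mul_def {n : ℕ} (g f : Q.End n) : g * f = Q.comp g f := rfl

/-- `f ↦ f + id`. -/
def inl {n : ℕ} (k : ℕ) : Q.End n →* Q.End (n + k) where
  toFun f := Q.add f (Q.id k)
  map_one' := Q.isProp.add_id n k
  map_mul' g f := by
    simp only [mul_def]
    rw [← Q.isProp.add_comp, Q.isProp.id_comp]

/-- `f ↦ id + f`. -/
def inr {n : ℕ} (k : ℕ) : Q.End n →* Q.End (k + n) where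
  toFun f := Q.add (Q.id k) f
  map_one' := Q.isProp.add_id k n
  map_mul' g f := by
    simp only [mul_def]
    rw [← Q.isProp.add_comp, Q.isProp.id_comp]

theorem inl_apply {n k : ℕ} (f : Q.End n) : Q.inl k f = Q.add f (Q.id k) := rfl
theorem inr_apply {n k : ℕ} (f : Q.End n) : Q.inr k f = Q.add (Q.id k) f := rfl

theorem inl_mul_inr {m n : ℕ} (f : Q.End m) (g : Q.End n) :
    Q.inl n f * Q.inr m g = Q.add f g := by
  rw [mul_def, inl_apply, inr_apply, ← Q.isProp.add_comp, Q.isProp.id_comp, Q.isProp.comp_id]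

theorem inr_mul_inl {m n : ℕ} (f : Q.End m) (g : Q.End n) :
    Q.inr m g * Q.inl n f = Q.add f g := by
  rw [mul_def, inl_apply, inr_apply, ← Q.isProp.add_comp, Q.isProp.id_comp, Q.isProp.comp_id]

theorem inl_comm_inr {m n : ℕ} (f : Q.End m) (g : Q.End n) :
    Commute (Q.inl n f) (Q.inr m g) := (Q.inl_mul_inr f g).trans (Q.inr_mul_inl f g).symm

/-- Transport of endomorphisms. -/
def castEnd {m n : ℕ} (h : m = n) : Q.End m →* Q.End n where
  toFun f := Q.cast h h f
  map_one' := Q.cast_id h h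
  map_mul' g f := Q.cast_comp h h h g f

theorem castEnd_castEnd {l m n : ℕ} (h : l = m) (h' : m = n) (f : Q.End l) :
    Q.castEnd h' (Q.castEnd h f) = Q.castEnd (h.trans h') f := Q.cast_cast _ _ _ _ _

theorem castEnd_rfl {n : ℕ} (h : n = n) (f : Q.End n) : Q.castEnd h f = f := rfl

theorem castEnd_inl_inl {n a b : ℕ} (h : n + a + b = n + (a + b)) (f : Q.End n) :
    Q.castEnd h (Q.inl b (Q.inl a f)) = Q.inl (a + b) f := by
  have := Q.isProp.add_assoc f (Q.id a) (Q.id b)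
  rwa [Q.isProp.add_id] at this

theorem castEnd_inr_inr {n a b : ℕ} (h : a + b + n = a + (b + n)) (f : Q.End n) :
    Q.castEnd h (Q.inr (a + b) f) = Q.inr a (Q.inr b f) := by
  have := Q.isProp.add_assoc (Q.id a) (Q.id b) f
  rwa [Q.isProp.add_id] at this

theorem castEnd_inl_inr {n a b : ℕ} (h : a + n + b = a + (n + b)) (f : Q.End n) :
    Q.castEnd h (Q.inl b (Q.inr a f)) = Q.inr a (Q.inl b f) :=
  Q.isProp.add_assoc (Q.id a) f (Q.id b)

theorem castEnd_inl {m n k : ℕ} (h : m = n) (h' : m + k = n + k) (f : Q.End m) :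
    Q.castEnd h' (Q.inl k f) = Q.inl k (Q.castEnd h f) := by
  subst h; rfl

theorem castEnd_inr {m n k : ℕ} (h : m = n) (h' : k + m = k + n) (f : Q.End m) :
    Q.castEnd h' (Q.inr k f) = Q.inr k (Q.castEnd h f) := by
  subst h; rfl

theorem castEnd_inl_congr {n k k' : ℕ} (hk : k = k') (h : n + k = n + k') (f : Q.End n) :
    Q.castEnd h (Q.inl k f) = Q.inl k' f := by
  subst hk; rfl

theorem castEnd_inr_congr {n k k' : ℕ} (hk : k = k') (h : k + n = k' + n) (f : Q.End n) :
    Q.castEnd h (Q.inr k f) = Q.inr k' f := by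
  subst hk; rfl

theorem castEnd_inr_zero {n : ℕ} (h : 0 + n = n) (f : Q.End n) : Q.castEnd h (Q.inr 0 f) = f :=
  Q.isProp.zero_add f

theorem inl_zero {n : ℕ} (f : Q.End n) : Q.inl 0 f = f := Q.isProp.add_zero f

/-- The symmetry `1 + 1 → 1 + 1`. -/
def sw : Q.End 2 := Q.swap 1 1

theorem sw_mul_sw : Q.sw * Q.sw = 1 := Q.isProp.swap_swap 1 1

/-- The braid relation for the symmetry `1 + 1 → 1 + 1`, from naturality and the hexagon law. -/
theorem sw_braid : Q.inl 1 Q.sw * Q.inr 1 Q.sw * Q.inl 1 Q.sw =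
    Q.inr 1 Q.sw * Q.inl 1 Q.sw * Q.inr 1 Q.sw := by
  have h1 : (Q.swap 1 2 : Q.End 3) = Q.inr 1 Q.sw * Q.inl 1 Q.sw := Q.isProp.swap_add 1 1 1
  have h2 : (Q.swap 1 2 : Q.End 3) * Q.inr 1 Q.sw = Q.inl 1 Q.sw * Q.swap 1 2 :=
    Q.isProp.swap_natural (Q.id 1) Q.sw
  rw [h1] at h2
  rw [h2, mul_assoc]

/-- In the endomorphism monoids of a prop, the symmetries of adjacent wires satisfy the relations of
adjacent transpositions. -/
def symTower : SymTower Q.End where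
  J := Q.inl 1
  V n := Q.inr n Q.sw
  V_mul_V n := by rw [← map_mul, sw_mul_sw, map_one]
  V_J {n} f := by
    have : Q.inl 1 (Q.inl 1 f) = Q.inl 2 f := Q.castEnd_inl_inl (a := 1) (b := 1) rfl f
    rw [this]; exact (Q.inl_comm_inr f Q.sw).symm
  V_braid n := by
    have h1 : Q.inl 1 (Q.inr n Q.sw) = Q.inr n (Q.inl 1 Q.sw) :=
      Q.castEnd_inl_inr (n := 2) (a := n) (b := 1) rfl Q.sw
    have h2 : Q.inr (n + 1) Q.sw = Q.inr n (Q.inr 1 Q.sw) :=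
      Q.castEnd_inr_inr (n := 2) (a := n) (b := 1) rfl Q.sw
    have := congrArg (Q.inr n) Q.sw_braid
    rw [map_mul, map_mul, map_mul, map_mul, ← h1, ← h2] at this
    exact this

/-- Permutations as morphisms of a prop. -/
noncomputable def permHom (n : ℕ) : Perm (Fin n) →* Q.End n := Q.symTower.action n

theorem permHom_permCastSucc {n : ℕ} (σ : Perm (Fin n)) :
    Q.permHom (n + 1) (Fin.permCastSucc σ) = Q.inl 1 (Q.permHom n σ) :=
  Q.symTower.action_permCastSucc σ

theorem permHom_swap_last (n : ℕ) :
    Q.permHom (n + 2) (swap (Fin.last n).castSucc (Fin.last (n + 1))) = Q.inr n Q.sw :=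
  Q.symTower.action_swap n

end StrictProp

/-- The permutation acting as `σ` on the first `m` and as `τ` on the last `n` elements. -/
def Fin.permSum {m n : ℕ} (σ : Perm (Fin m)) (τ : Perm (Fin n)) : Perm (Fin (m + n)) :=
  finSumFinEquiv.permCongr (Perm.sumCongr σ τ)

theorem Fin.permSum_castAdd {m n : ℕ} (σ : Perm (Fin m)) (τ : Perm (Fin n)) (i : Fin m) :
    Fin.permSum σ τ (Fin.castAdd n i) = Fin.castAdd n (σ i) := by
  simp [Fin.permSum]

theorem Fin.permSum_natAdd {m n : ℕ} (σ : Perm (Fin m)) (τ : Perm (Fin n)) (i : Fin n) :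
    Fin.permSum σ τ (Fin.natAdd m i) = Fin.natAdd m (τ i) := by
  simp [Fin.permSum]

theorem Fin.perm_ext_add {m n : ℕ} {σ τ : Perm (Fin (m + n))}
    (h1 : ∀ i : Fin m, σ (Fin.castAdd n i) = τ (Fin.castAdd n i))
    (h2 : ∀ i : Fin n, σ (Fin.natAdd m i) = τ (Fin.natAdd m i)) : σ = τ := by
  ext1 x
  induction x using Fin.addCases with
  | left i => exact h1 i
  | right i => exact h2 i

theorem Fin.permSum_mul {m n : ℕ} (σ σ' : Perm (Fin m)) (τ τ' : Perm (Fin n)) :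
    Fin.permSum (σ * σ') (τ * τ') = Fin.permSum σ τ * Fin.permSum σ' τ' := by
  apply Fin.perm_ext_add <;> intro i <;>
    simp only [Perm.mul_apply, permSum_castAdd, permSum_natAdd]

theorem Fin.permSum_one {m n : ℕ} : Fin.permSum (1 : Perm (Fin m)) (1 : Perm (Fin n)) = 1 := by
  apply Fin.perm_ext_add <;> intro i <;> simp [permSum_castAdd, permSum_natAdd]

theorem Fin.exists_permSum_one {m n : ℕ} (σ : Perm (Fin (m + n)))
    (hσ : ∀ i, σ (Fin.castAdd n i) = Fin.castAdd n i) : ∃ τ, σ = Fin.permSum 1 τ := by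
  have h : ∀ i : Fin n, ∃ j : Fin n, σ (Fin.natAdd m i) = Fin.natAdd m j := by
    intro i
    induction hx : σ (Fin.natAdd m i) using Fin.addCases with
    | left j =>
      rw [← hσ j] at hx
      have := σ.injective hx
      simp [Fin.ext_iff] at this
      omega
    | right j => exact ⟨j, rfl⟩
  choose q hq using h
  have hinj : Function.Injective q := by
    intro i j hij
    have : σ (Fin.natAdd m i) = σ (Fin.natAdd m j) := by rw [hq, hq, hij]
    simpa using σ.injective this
  refine ⟨Equiv.ofBijective q (Finite.injective_iff_bijective.1 hinj), ?_⟩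
  apply Fin.perm_ext_add
  · intro i; rw [permSum_castAdd, hσ]; rfl
  · intro i; rw [permSum_natAdd, hq]; rfl

namespace StrictProp

variable (Q : StrictProp.{u})

theorem permHom_permSum_one {m : ℕ} (σ : Perm (Fin m)) : ∀ k : ℕ,
    Q.permHom (m + k) (Fin.permSum σ (1 : Perm (Fin k))) = Q.inl k (Q.permHom m σ)
  | 0 => by
    rw [inl_zero]
    congr 1
    ext1 i
    exact Fin.permSum_castAdd σ 1 i
  | k + 1 => by
    have h1 : Q.inl (k + 1) (Q.permHom m σ) = Q.inl 1 (Q.inl k (Q.permHom m σ)) :=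
      (Q.castEnd_inl_inl rfl _).symm
    rw [h1, ← permHom_permSum_one σ k, ← permHom_permCastSucc]
    congr 1
    apply Fin.perm_ext_add
    · intro i
      rw [Fin.permSum_castAdd]
      exact ((Fin.permCastSucc_castSucc _ (Fin.castAdd k i)).trans
        (congrArg Fin.castSucc (Fin.permSum_castAdd σ 1 i))).symm
    · intro i
      rw [Fin.permSum_natAdd]
      induction i using Fin.lastCases with
      | last => exact (Fin.permCastSucc_last _).symm
      | cast i =>
        exact ((Fin.permCastSucc_castSucc _ (Fin.natAdd m i)).trans
          (congrArg Fin.castSucc (Fin.permSum_natAdd σ 1 i))).symm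

/-- Permutations of the last `n` of `k + n` wires are sums of the identity of `k` with permutations
of `n`. The proof checks the adjacent transpositions. -/
theorem permHom_one_permSum (k : ℕ) : ∀ {n : ℕ} (τ : Perm (Fin n)),
    Q.permHom (k + n) (Fin.permSum (1 : Perm (Fin k)) τ) = Q.inr k (Q.permHom n τ)
  | 0, τ => by
    rw [Subsingleton.elim τ 1, Fin.permSum_one, map_one, map_one, map_one]
  | 1, τ => by
    rw [Subsingleton.elim τ 1, Fin.permSum_one, map_one, map_one, map_one]
  | n + 2, τ => by
    have hτ : τ ∈ Submonoid.closure
        (Set.range fun i : Fin (n + 1) => swap i.castSucc i.succ) := by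
      rw [Perm.mclosure_swap_castSucc_succ]; trivial
    induction hτ using Submonoid.closure_induction with
    | one => rw [Fin.permSum_one, map_one, map_one, map_one]
    | mul σ τ _ _ h1 h2 =>
      rw [← one_mul (1 : Perm (Fin k)), Fin.permSum_mul, map_mul, map_mul, map_mul, h1, h2]
    | mem τ h =>
      obtain ⟨i, rfl⟩ := h
      have hsw : ∀ a b : Fin (n + 2), Fin.permSum (1 : Perm (Fin k)) (swap a b) =
          swap (Fin.natAdd k a) (Fin.natAdd k b) := by
        intro a b
        apply Fin.perm_ext_add
        · intro j
          rw [Fin.permSum_castAdd, swap_apply_of_ne_of_ne] <;> simp [Fin.ext_iff] <;> omega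
        · intro j
          rw [Fin.permSum_natAdd, (Fin.natAdd_injective (n + 2) k).map_swap]
      induction i using Fin.lastCases with
      | last =>
        have h1 : Q.inr k (Q.inr n Q.sw) = Q.inr (k + n) Q.sw := (Q.castEnd_inr_inr rfl _).symm
        have h2 := Q.permHom_swap_last (k + n)
        simp only [Fin.succ_last]
        rw [hsw, permHom_swap_last, h1, ← h2]
        rfl
      | cast i =>
        have h1 : swap i.castSucc.castSucc i.castSucc.succ =
            Fin.permCastSucc (swap i.castSucc i.succ) := by
          rw [Fin.permCastSucc_swap, Fin.succ_castSucc]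
        have h2 : ∀ f : Q.End (n + 1), Q.inr k (Q.inl 1 f) = Q.inl 1 (Q.inr k f) := fun f =>
          (Q.castEnd_inl_inr rfl f).symm
        beta_reduce
        rw [h1, permHom_permCastSucc, h2, ← permHom_one_permSum k, ← permHom_permCastSucc]
        congr 1
        apply Fin.perm_ext_add
        · intro j
          rw [Fin.permSum_castAdd]
          exact ((Fin.permCastSucc_castSucc _ (Fin.castAdd (n + 1) j)).trans
            (congrArg Fin.castSucc (Fin.permSum_castAdd 1 _ j))).symm
        · intro j
          rw [Fin.permSum_natAdd]
          induction j using Fin.lastCases with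
          | last =>
            rw [Fin.permCastSucc_last]
            exact (Fin.permCastSucc_last _).symm
          | cast j =>
            rw [Fin.permCastSucc_castSucc]
            exact ((Fin.permCastSucc_castSucc _ (Fin.natAdd k j)).trans
              (congrArg Fin.castSucc (Fin.permSum_natAdd 1 _ j))).symm

/-- Sums of permutations are sums of morphisms. -/
theorem permHom_permSum {m n : ℕ} (σ : Perm (Fin m)) (τ : Perm (Fin n)) :
    Q.permHom (m + n) (Fin.permSum σ τ) = Q.add (Q.permHom m σ) (Q.permHom n τ) := by
  rw [← inl_mul_inr, ← permHom_permSum_one, ← permHom_one_permSum, ← map_mul, ← Fin.permSum_mul,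
    one_mul, mul_one]

end StrictProp

/-! ### Permutations as morphisms of a prop -/

namespace StrictProp

variable (Q : StrictProp.{u})

/-- `f` is the permutation that sends position `i` to position `p i`. -/
def IsPermMor {a b : ℕ} (f : Q.Hom a b) (p : ℕ → ℕ) : Prop :=
  ∃ (h : a = b) (τ : Perm (Fin a)), Q.cast rfl h.symm f = Q.permHom a τ ∧ ∀ i, (τ i : ℕ) = p i

variable {Q}

namespace IsPermMor

theorem congr {a b : ℕ} {f : Q.Hom a b} {p p' : ℕ → ℕ} (h : Q.IsPermMor f p)
    (hp : ∀ i < a, p i = p' i) : Q.IsPermMor f p' := by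
  obtain ⟨h, τ, h1, h2⟩ := h
  exact ⟨h, τ, h1, fun i => (h2 i).trans (hp i i.2)⟩

theorem cast {a a' b b' : ℕ} (ha : a = a') (hb : b = b') {f : Q.Hom a b} {p : ℕ → ℕ}
    (h : Q.IsPermMor f p) : Q.IsPermMor (Q.cast ha hb f) p := by
  subst ha hb; exact h

theorem id (n : ℕ) : Q.IsPermMor (Q.id n) fun i => i :=
  ⟨rfl, 1, (map_one (Q.permHom n)).symm, fun _ => rfl⟩

theorem comp {a b c : ℕ} {g : Q.Hom b c} {f : Q.Hom a b} {q p : ℕ → ℕ} (hg : Q.IsPermMor g q)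
    (hf : Q.IsPermMor f p) : Q.IsPermMor (Q.comp g f) fun i => q (p i) := by
  obtain ⟨rfl, σ, g1, g2⟩ := hg
  obtain ⟨rfl, τ, f1, f2⟩ := hf
  refine ⟨rfl, σ * τ, ?_, fun i => ?_⟩
  · rw [map_mul, ← g1, ← f1]; rfl
  · rw [Perm.mul_apply, g2, f2]

theorem add {k l m n : ℕ} {f : Q.Hom k l} {g : Q.Hom m n} {p q : ℕ → ℕ} (hf : Q.IsPermMor f p)
    (hg : Q.IsPermMor g q) :
    Q.IsPermMor (Q.add f g) fun i => if i < k then p i else k + q (i - k) := by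
  obtain ⟨rfl, σ, f1, f2⟩ := hf
  obtain ⟨rfl, τ, g1, g2⟩ := hg
  refine ⟨rfl, Fin.permSum σ τ, ?_, fun i => ?_⟩
  · rw [permHom_permSum, ← g1, ← f1]; rfl
  · induction i using Fin.addCases with
    | left i => rw [Fin.permSum_castAdd]; simp [f2]
    | right i => rw [Fin.permSum_natAdd]; simp [g2]

/-- A right inverse of a permutation is a permutation. -/
theorem of_comp_eq_id {a b : ℕ} {g : Q.Hom b a} {f : Q.Hom a b} {q p : ℕ → ℕ}
    (hg : Q.IsPermMor g q) (h : Q.comp g f = Q.id a) (hpq : ∀ i < a, p (q i) = i) :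
    Q.IsPermMor f p := by
  obtain ⟨rfl, σ, g1, g2⟩ := hg
  refine ⟨rfl, σ⁻¹, ?_, fun i => ?_⟩
  · change f = _
    have h' : Q.permHom b σ * f = 1 := by rw [← g1]; exact h
    calc f = Q.permHom b σ⁻¹ * Q.permHom b σ * f := by
          rw [← map_mul, inv_mul_cancel, map_one, one_mul]
      _ = _ := by rw [mul_assoc, h', mul_one]
  · obtain ⟨j, rfl⟩ := σ.surjective i
    rw [g2, hpq j j.2]
    simp

end IsPermMor

variable (Q)

/-- The symmetry `k + 0 → 0 + k` is the identity: the hexagon law makes it idempotent, and it is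
invertible. -/
theorem swap_zero_isPermMor (k : ℕ) : Q.IsPermMor (Q.swap k 0) fun i => i := by
  have h0 : 0 + k = k := Nat.zero_add k
  let S : Q.End k := Q.cast rfl h0 (Q.swap k 0)
  let T : Q.End k := Q.cast h0 rfl (Q.swap 0 k)
  have hTS : T * S = 1 := by
    have := congrArg (Q.cast (m := k) (n := k) rfl rfl) (Q.isProp.swap_swap k 0)
    rw [Q.cast_comp rfl h0 rfl] at this
    exact this
  have hSS : S = S * S := by
    have h1 := congrArg (Q.cast rfl h0) (Q.isProp.swap_add k 0 0)
    have h2 : Q.add (Q.swap k 0) (Q.id 0) = Q.swap k 0 := Q.isProp.add_zero (Q.swap k 0)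
    have h3 := Q.isProp.zero_add (Q.swap k 0)
    have h4 : Q.cast (Nat.zero_add (k + 0)) ((Nat.zero_add (0 + k)).trans h0)
        (Q.add (Q.id 0) (Q.swap k 0)) = S := by
      change _ = Q.cast rfl h0 _
      rw [← h3, Q.cast_cast, h3]
    rw [h2, Q.cast_cast, Q.cast_comp rfl h0, Q.cast_cast] at h1
    exact h1.trans (congrArg (· * S) h4)
  have hS : S = 1 := by
    calc S = T * S * S := by rw [hTS, one_mul]
      _ = 1 := by rw [mul_assoc, ← hSS, hTS]
  exact ⟨h0.symm, 1, hS.trans (map_one _).symm, fun _ => rfl⟩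

theorem swap_isPermMor_symm {m n : ℕ} (h : Q.IsPermMor (Q.swap m n) (swapFun m n)) :
    Q.IsPermMor (Q.swap n m) (swapFun n m) :=
  IsPermMor.of_comp_eq_id h (Q.isProp.swap_swap n m) fun i hi => by
    unfold swapFun; split_ifs <;> omega

theorem swap_isPermMor_add {k m n : ℕ} (h1 : Q.IsPermMor (Q.swap k m) (swapFun k m))
    (h2 : Q.IsPermMor (Q.swap k n) (swapFun k n)) :
    Q.IsPermMor (Q.swap k (m + n)) (swapFun k (m + n)) := by
  rw [Q.isProp.swap_add]
  refine (IsPermMor.cast _ _ (IsPermMor.comp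
    (IsPermMor.cast _ _ (IsPermMor.add (IsPermMor.id m) h2))
    (IsPermMor.add h1 (IsPermMor.id n)))).congr fun i hi => ?_
  unfold swapFun
  split_ifs <;> omega

theorem swap_one_one_isPermMor : Q.IsPermMor (Q.swap 1 1) (swapFun 1 1) := by
  refine ⟨rfl, swap (Fin.last 0).castSucc (Fin.last 1), ?_, fun i => ?_⟩
  · have := Q.permHom_swap_last 0
    rw [this]
    exact (Q.castEnd_inr_zero (n := 2) rfl Q.sw).symm
  · fin_cases i <;> rfl

/-- The symmetry `m + n → n + m` is the permutation `swapFun m n`, by induction with the hexagon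
law from the case `m = n = 1`. -/
theorem swap_isPermMor (m n : ℕ) : Q.IsPermMor (Q.swap m n) (swapFun m n) := by
  have h0 : ∀ k, Q.IsPermMor (Q.swap k 0) (swapFun k 0) := fun k =>
    (Q.swap_zero_isPermMor k).congr fun i hi => by unfold swapFun; split_ifs <;> omega
  have h1 : ∀ n, Q.IsPermMor (Q.swap 1 n) (swapFun 1 n) := by
    intro n
    induction n with
    | zero => exact h0 1
    | succ n ih => exact Q.swap_isPermMor_add ih Q.swap_one_one_isPermMor
  induction m with
  | zero => exact Q.swap_isPermMor_symm (h0 n)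
  | succ m ih =>
    exact Q.swap_isPermMor_symm (Q.swap_isPermMor_add (Q.swap_isPermMor_symm ih)
      (Q.swap_isPermMor_symm (h1 n)))

/-! ### The action of a prop on itself -/

/-- `y` is `f : m → n` placed at the positions `e 0, …, e (m - 1)`: the sum of `f` with an identity,
conjugated by a permutation that sends the initial segment of length `m` to these positions. -/
def IsPlaced {M m n : ℕ} (f : Q.Hom m n) (e : ℕ → Fin M) (y : Q.End M) : Prop :=
  ∃ (r : ℕ) (h1 : m + r = M) (h2 : n + r = M) (σ : Perm (Fin M)),
    (∀ i (hi : i < m), σ ⟨i, by omega⟩ = e i) ∧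
    y = Q.permHom M σ * Q.cast h1 h2 (Q.add f (Q.id r)) * Q.permHom M σ⁻¹

theorem permHom_inv_mul {M : ℕ} (σ : Perm (Fin M)) : Q.permHom M σ⁻¹ * Q.permHom M σ = 1 := by
  rw [← map_mul, inv_mul_cancel, map_one]

theorem permHom_mul_inv {M : ℕ} (σ : Perm (Fin M)) : Q.permHom M σ * Q.permHom M σ⁻¹ = 1 := by
  rw [← map_mul, mul_inv_cancel, map_one]

variable {Q}

/-- The placement of a morphism does not depend on the permutation, since two permutations that
agree on the initial segment differ by one that commutes with `f + id`. -/
theorem IsPlaced.unique {M m n : ℕ} {f : Q.Hom m n} {e : ℕ → Fin M} {y y' : Q.End M}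
    (h : Q.IsPlaced f e y) (h' : Q.IsPlaced f e y') : y = y' := by
  obtain ⟨r, h1, h2, σ, hσ, rfl⟩ := h
  obtain ⟨r', h1', h2', σ', hσ', rfl⟩ := h'
  obtain rfl : r = r' := by omega
  obtain rfl : m = n := by omega
  subst h1
  obtain ⟨ω, rfl⟩ : ∃ ω, σ' = σ * ω := ⟨σ⁻¹ * σ', by group⟩
  obtain ⟨τ, rfl⟩ := Fin.exists_permSum_one ω fun i => by
    have := (hσ' i i.2).trans (hσ i i.2).symm
    exact σ.injective this
  have hc : Commute (Q.permHom _ (Fin.permSum 1 τ)) (Q.inl r f) := by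
    rw [permHom_one_permSum]
    exact (Q.inl_comm_inr f _).symm
  change Q.permHom _ σ * Q.inl r f * _ = Q.permHom _ _ * Q.inl r f * _
  rw [mul_inv_rev, map_mul, map_mul, mul_assoc (Q.permHom _ σ) _ (Q.inl r f), hc.eq]
  simp only [mul_assoc]
  rw [← mul_assoc (Q.permHom _ (Fin.permSum 1 τ)), permHom_mul_inv, one_mul]

/-- Positions can be permuted so that they become an initial segment. -/
theorem exists_frame {M m : ℕ} {e : ℕ → Fin M} (he : Set.InjOn e (Set.Iio m)) :
    ∃ (r : ℕ) (h : m + r = M) (σ : Perm (Fin M)), ∀ i (hi : i < m), σ ⟨i, by omega⟩ = e i := by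
  have hle : m ≤ M := by
    have := Fintype.card_le_of_injective (fun i : Fin m => e i)
      fun i j h => Fin.ext (he i.2 j.2 h)
    simpa using this
  obtain ⟨r, rfl⟩ := Nat.exists_eq_add_of_le hle
  rcases Nat.eq_zero_or_pos m with rfl | hm
  · exact ⟨r, rfl, 1, fun i hi => absurd hi (Nat.not_lt_zero i)⟩
  · have : NeZero (m + r) := ⟨by omega⟩
    have hu : Set.InjOn (Fin.ofNat (m + r)) (Set.Iio m) := by
      intro i hi j hj hij
      simp only [Set.mem_Iio] at hi hj
      have := Fin.ext_iff.1 hij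
      simpa [Fin.ofNat, Nat.mod_eq_of_lt (show i < m + r by omega),
        Nat.mod_eq_of_lt (show j < m + r by omega)] using this
    obtain ⟨σ, hσ⟩ := exists_perm_map hu he
    refine ⟨r, rfl, σ, fun i hi => ?_⟩
    rw [← hσ i hi]
    congr 1
    exact Fin.ext (Nat.mod_eq_of_lt (by omega)).symm

/-- A morphism is also placed by any sum with identities on both sides. -/
theorem IsPlaced.of_middle {M m k r : ℕ} (h : k + m + r = M) (g : Q.End m) {e : ℕ → Fin M}
    (σ : Perm (Fin M)) (hσ : ∀ i (hi : i < m), σ ⟨k + i, by omega⟩ = e i) :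
    Q.IsPlaced g e
      (Q.permHom M σ * Q.castEnd h (Q.inl r (Q.inr k g)) * Q.permHom M σ⁻¹) := by
  have h' : m + k + r = M := by omega
  subst h'
  have h0 : k + m = m + k := Nat.add_comm k m
  obtain ⟨hβ, β, β1, β2⟩ := Q.swap_isPermMor m k
  have key : Q.castEnd h0 (Q.inr k g) * Q.permHom _ β = Q.permHom _ β * Q.inl k g := by
    have := congrArg (Q.cast rfl h0) (Q.isProp.swap_natural g (Q.id k))
    rw [Q.cast_comp rfl rfl h0, Q.cast_comp rfl h0 h0] at this
    rw [← β1]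
    exact this.symm
  have key' : Q.castEnd h0 (Q.inr k g) = Q.permHom _ β * Q.inl k g * Q.permHom _ β⁻¹ := by
    rw [← key, mul_assoc, permHom_mul_inv, mul_one]
  rw [Q.castEnd_inl h0, key', map_mul, map_mul, ← permHom_permSum_one, ← permHom_permSum_one]
  refine ⟨k + r, (Nat.add_assoc m k r).symm, (Nat.add_assoc m k r).symm,
    σ * Fin.permSum β 1, fun i hi => ?_, ?_⟩
  · rw [Perm.mul_apply, ← hσ i hi]
    congr 1
    have : (⟨i, by omega⟩ : Fin (m + k + r)) = Fin.castAdd r (Fin.castAdd k ⟨i, hi⟩) := rfl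
    rw [this, Fin.permSum_castAdd]
    refine Fin.ext ?_
    have := β2 (Fin.castAdd k ⟨i, hi⟩)
    simp only [swapFun, Fin.val_castAdd, if_pos hi] at this
    simpa using this
  · have e1 : Q.cast (Nat.add_assoc m k r).symm (Nat.add_assoc m k r).symm
        (Q.add g (Q.id (k + r))) = Q.inl r (Q.inl k g) := by
      have := Q.castEnd_inl_inl (Nat.add_assoc m k r) g
      change Q.castEnd _ (Q.inl (k + r) g) = _
      rw [← this, castEnd_castEnd]; rfl
    have e2 : (Fin.permSum β (1 : Perm (Fin r)))⁻¹ = Fin.permSum β⁻¹ 1 := by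
      rw [inv_eq_iff_mul_eq_one, ← Fin.permSum_mul, mul_inv_cancel, one_mul, Fin.permSum_one]
    rw [e1, mul_inv_rev, map_mul, map_mul, e2]
    simp only [mul_assoc]

variable (Q)

open Classical in
/-- `f : m → n` placed at the positions `e 0, …, e (m - 1)`; the junk value `1` is taken if these
positions are not distinct. -/
noncomputable def selfVal {M m n : ℕ} (f : Q.Hom m n) (e : ℕ → Fin M) : Q.End M :=
  if h : ∃ y, Q.IsPlaced f e y then h.choose else 1

variable {Q}

theorem IsPlaced.selfVal_eq {M m n : ℕ} {f : Q.Hom m n} {e : ℕ → Fin M} {y : Q.End M}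
    (h : Q.IsPlaced f e y) : Q.selfVal f e = y := by
  have hex : ∃ y, Q.IsPlaced f e y := ⟨y, h⟩
  rw [selfVal, dif_pos hex]
  exact hex.choose_spec.unique h

theorem IsPlaced.of_left {M m r : ℕ} (h : m + r = M) (g : Q.End m) {e : ℕ → Fin M}
    (σ : Perm (Fin M)) (hσ : ∀ i (hi : i < m), σ ⟨i, by omega⟩ = e i) :
    Q.IsPlaced g e (Q.permHom M σ * Q.castEnd h (Q.inl r g) * Q.permHom M σ⁻¹) :=
  ⟨r, h, h, σ, hσ, rfl⟩

theorem selfVal_cast {M a a' b b' : ℕ} (ha : a = a') (hb : b = b') (f : Q.Hom a b)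
    (e : ℕ → Fin M) : Q.selfVal (Q.cast ha hb f) e = Q.selfVal f e := by
  subst ha hb; rfl

theorem selfVal_id {M n : ℕ} {e : ℕ → Fin M} (he : Set.InjOn e (Set.Iio n)) :
    Q.selfVal (Q.id n) e = 1 := by
  obtain ⟨r, h, σ, hσ⟩ := exists_frame he
  refine (IsPlaced.of_left (Q := Q) h (1 : Q.End n) σ hσ).selfVal_eq.trans ?_
  rw [map_one, map_one, mul_one, permHom_mul_inv]

theorem selfVal_mul {M n : ℕ} (g f : Q.End n) {e : ℕ → Fin M} (he : Set.InjOn e (Set.Iio n)) :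
    Q.selfVal (Q.comp g f) e = Q.selfVal g e * Q.selfVal f e := by
  obtain ⟨r, h, σ, hσ⟩ := exists_frame he
  refine (IsPlaced.of_left h (g * f : Q.End n) σ hσ).selfVal_eq.trans ?_
  rw [(IsPlaced.of_left h g σ hσ).selfVal_eq, (IsPlaced.of_left h f σ hσ).selfVal_eq, map_mul,
    map_mul]
  simp only [mul_assoc]
  rw [← mul_assoc (Q.permHom M σ⁻¹), permHom_inv_mul, one_mul]

theorem selfVal_inl {M m n : ℕ} (f : Q.End m) {e : ℕ → Fin M}
    (he : Set.InjOn e (Set.Iio (m + n))) :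
    Q.selfVal (Q.add f (Q.id n)) e = Q.selfVal f e := by
  obtain ⟨r, h, σ, hσ⟩ := exists_frame he
  refine (IsPlaced.of_left h (Q.inl n f) σ hσ).selfVal_eq.trans ?_
  rw [(IsPlaced.of_left (r := n + r) (by omega) f σ fun i hi => hσ i (by omega)).selfVal_eq]
  have := Q.castEnd_inl_inl (Nat.add_assoc m n r) f
  rw [← this, castEnd_castEnd]

theorem selfVal_inr {M m n : ℕ} (g : Q.End n) {e : ℕ → Fin M}
    (he : Set.InjOn e (Set.Iio (m + n))) :
    Q.selfVal (Q.add (Q.id m) g) e = Q.selfVal g fun i => e (m + i) := by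
  obtain ⟨r, h, σ, hσ⟩ := exists_frame he
  refine (IsPlaced.of_left h (Q.inr m g) σ hσ).selfVal_eq.trans ?_
  rw [(IsPlaced.of_middle h g σ fun i hi => hσ (m + i) (by omega)).selfVal_eq]

theorem selfVal_add {M m n : ℕ} (f : Q.End m) (g : Q.End n) {e : ℕ → Fin M}
    (he : Set.InjOn e (Set.Iio (m + n))) :
    Q.selfVal (Q.add f g) e = Q.selfVal f e * Q.selfVal g fun i => e (m + i) := by
  rw [← selfVal_inl f he, ← selfVal_inr g he, ← selfVal_mul _ _ he]
  congr 1
  exact (Q.inl_mul_inr f g).symm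

theorem selfVal_add' {M m n : ℕ} (f : Q.End m) (g : Q.End n) {e : ℕ → Fin M}
    (he : Set.InjOn e (Set.Iio (m + n))) :
    Q.selfVal (Q.add f g) e = (Q.selfVal g fun i => e (m + i)) * Q.selfVal f e := by
  rw [← selfVal_inl f he, ← selfVal_inr g he, ← selfVal_mul _ _ he]
  congr 1
  exact (Q.inr_mul_inl f g).symm

theorem selfVal_congr {M m n : ℕ} (f : Q.Hom m n) {e e' : ℕ → Fin M} (h : ∀ i < m, e i = e' i) :
    Q.selfVal f e = Q.selfVal f e' := by
  have : Q.IsPlaced f e = Q.IsPlaced f e' := by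
    ext y
    constructor
    · rintro ⟨r, h1, h2, σ, hσ, hy⟩
      exact ⟨r, h1, h2, σ, fun i hi => (hσ i hi).trans (h i hi), hy⟩
    · rintro ⟨r, h1, h2, σ, hσ, hy⟩
      exact ⟨r, h1, h2, σ, fun i hi => (hσ i hi).trans (h i hi).symm, hy⟩
  unfold selfVal
  rw [this]

/-- A permutation morphism acts at positions by the permutation along them. -/
theorem IsPermMor.selfVal_eq {M m n : ℕ} {f : Q.Hom m n} {p : ℕ → ℕ} (hf : Q.IsPermMor f p)
    {e : ℕ → Fin M} (he : Set.InjOn e (Set.Iio m)) {σ : Perm (Fin M)} (hσ : Along e m p σ) :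
    Q.selfVal f e = Q.permHom M σ := by
  obtain ⟨h0, β, β1, β2⟩ := hf
  rw [← selfVal_cast rfl h0.symm, β1]
  obtain ⟨r, h, τ, hτ⟩ := exists_frame he
  rw [(IsPlaced.of_left h (Q.permHom m β) τ hτ).selfVal_eq]
  subst h
  rw [castEnd_rfl, ← permHom_permSum_one, ← map_mul, ← map_mul]
  congr 1
  refine Along.unique (e := e) (N := m) (p := p) ⟨fun i hi => ?_, fun y hy => ?_⟩ hσ
  · have hβ := β2 ⟨i, hi⟩
    have hlt : p i < m := by rw [← hβ]; exact (β ⟨i, hi⟩).2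
    rw [← hτ i hi, ← hτ _ hlt, Perm.mul_apply, Perm.mul_apply]
    congr 1
    have e1 : τ⁻¹ (τ ⟨i, by omega⟩) = Fin.castAdd r ⟨i, hi⟩ := τ.symm_apply_apply _
    rw [e1, Fin.permSum_castAdd]
    exact Fin.ext hβ
  · obtain ⟨z, rfl⟩ := τ.surjective y
    have e1 : τ⁻¹ (τ z) = z := τ.symm_apply_apply _
    rw [Perm.mul_apply, Perm.mul_apply, e1]
    congr 1
    induction z using Fin.addCases with
    | left i => exact absurd (hτ i i.2).symm (hy i i.2)
    | right i => rw [Fin.permSum_natAdd]; rfl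

theorem selfVal_conj {M n : ℕ} (f : Q.End n) {e : ℕ → Fin M} (he : Set.InjOn e (Set.Iio n))
    (σ : Perm (Fin M)) :
    SemiconjBy (Q.permHom M σ) (Q.selfVal f e) (Q.selfVal f fun i => σ (e i)) := by
  obtain ⟨r, h, τ, hτ⟩ := exists_frame he
  rw [(IsPlaced.of_left h f τ hτ).selfVal_eq,
    (IsPlaced.of_left h f (σ * τ) fun i hi => by rw [Perm.mul_apply, hτ i hi]).selfVal_eq]
  rw [SemiconjBy, mul_inv_rev, map_mul, map_mul]
  simp only [mul_assoc, permHom_inv_mul, mul_one]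

/-- Morphisms at disjoint positions commute, because their sum can be composed in either order. -/
theorem selfVal_comm {M k m : ℕ} (f : Q.End k) (g : Q.End m) {e e' : ℕ → Fin M}
    (he : Set.InjOn e (Set.Iio k)) (he' : Set.InjOn e' (Set.Iio m))
    (h : ∀ i < k, ∀ j < m, e i ≠ e' j) : Commute (Q.selfVal f e) (Q.selfVal g e') := by
  let e'' : ℕ → Fin M := fun i => if i < k then e i else e' (i - k)
  have he'' : Set.InjOn e'' (Set.Iio (k + m)) := by
    intro i hi j hj hij
    simp only [Set.mem_Iio] at hi hj
    simp only [e''] at hij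
    split_ifs at hij with h1 h2 h2
    · exact he h1 h2 hij
    · exact absurd hij (h i h1 _ (by omega))
    · exact absurd hij.symm (h j h2 _ (by omega))
    · have := he' (show i - k < m by omega) (show j - k < m by omega) hij
      omega
  have h1 : Q.selfVal f e = Q.selfVal f e'' := selfVal_congr f fun i hi => (if_pos hi).symm
  have h2 : Q.selfVal g e' = Q.selfVal g fun i => e'' (k + i) := selfVal_congr g fun i hi => by
    simp [e'']
  rw [h1, h2]
  exact (selfVal_add f g he'').symm.trans (selfVal_add' f g he'')

variable (Q)

/-- A prop all of whose morphisms are endomorphisms is realised in its own endomorphism monoids. -/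
noncomputable def selfRealisation (hQ : ∀ {m n : ℕ}, Q.Hom m n → m = n) (M : ℕ) :
    Realisation Q.toPropData (Fin M) (Q.End M) where
  perm := Q.permHom M
  val f e := Q.selfVal f e
  endo := hQ
  val_id he := selfVal_id he
  val_comp g f _ he := by
    obtain rfl := hQ g
    obtain rfl := hQ f
    exact selfVal_mul g f he
  val_add f g _ he := by
    obtain rfl := hQ g
    obtain rfl := hQ f
    exact selfVal_add f g he
  val_swap he _ hσ := (Q.swap_isPermMor _ _).selfVal_eq he hσ
  val_conj f _ he σ := by
    obtain rfl := hQ f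
    exact selfVal_conj f he σ
  val_congr f _ _ h := selfVal_congr f h
  val_comm f g _ _ he he' h := by
    obtain rfl := hQ g
    obtain rfl := hQ f
    exact selfVal_comm f g he he' h

/-- A morphism is recovered from its value at the positions in their order. -/
theorem selfVal_ofNat {M : ℕ} [NeZero M] (f : Q.End M) : Q.selfVal f (Fin.ofNat M) = f := by
  have := (IsPlaced.of_left (Q := Q) (e := Fin.ofNat M) (Nat.add_zero M) f 1 fun i hi =>
    Fin.ext (Nat.mod_eq_of_lt hi).symm).selfVal_eq
  rw [this, inv_one, map_one, one_mul, mul_one, inl_zero]; rfl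

end StrictProp

/-! ### Maps of props -/

/-- An identity-on-objects map that preserves the operations of a prop. -/
structure PropData.Map (P : PropData.{u}) (Q : PropData.{v}) where
  map : ∀ {m n : ℕ}, P.Hom m n → Q.Hom m n
  map_id : ∀ n : ℕ, map (P.id n) = Q.id n
  map_comp : ∀ {l m n : ℕ} (g : P.Hom m n) (f : P.Hom l m),
    map (P.comp g f) = Q.comp (map g) (map f)
  map_add : ∀ {k l m n : ℕ} (f : P.Hom k l) (g : P.Hom m n),
    map (P.add f g) = Q.add (map f) (map g)
  map_swap : ∀ m n : ℕ, map (P.swap m n) = Q.swap m n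

namespace PropData.Map

variable {P : PropData.{u}} {Q : PropData.{v}} (φ : P.Map Q)

theorem map_cast {m m' n n' : ℕ} (hm : m = m') (hn : n = n') (f : P.Hom m n) :
    φ.map (P.cast hm hn f) = Q.cast hm hn (φ.map f) := by
  subst hm hn; rfl

theorem map_copies {k l : ℕ} (f : P.Hom k l) :
    ∀ N : ℕ, φ.map (P.copies f N) = Q.copies (φ.map f) N
  | 0 => by rw [copies, copies, map_cast, map_id]
  | N + 1 => by rw [copies, copies, map_cast, map_add, map_copies f N]

theorem map_leftDist (n : ℕ) : ∀ m : ℕ, φ.map (P.leftDist n m) = Q.leftDist n m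
  | 0 => by rw [leftDist, leftDist, map_cast, map_id]
  | m + 1 => by
    rw [leftDist, leftDist, map_comp, map_cast, map_cast, map_add, map_add, map_add, map_id,
      map_id, map_id, map_swap, map_leftDist n m]

theorem map_mulSwap (m : ℕ) : ∀ n : ℕ, φ.map (P.mulSwap m n) = Q.mulSwap m n
  | 0 => by rw [mulSwap, mulSwap, map_cast, map_id]
  | n + 1 => by
    rw [mulSwap, mulSwap, map_cast, map_comp, map_add, map_id, map_leftDist, map_mulSwap m n]

theorem map_kron {k l m n : ℕ} (f : P.Hom k l) (h : P.Hom m n) :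
    φ.map (P.kron f h) = Q.kron (φ.map f) (φ.map h) := by
  simp only [kron, map_comp, map_mulSwap, map_copies]

/-- A map of props preserves tensor products. -/
def powTwo : P.powTwo.Map Q.powTwo where
  map f := φ.map f
  map_id _ := φ.map_id _
  map_comp g f := φ.map_comp g f
  map_add f g := (φ.map_cast _ _ _).trans (congrArg _ (φ.map_kron f g))
  map_swap _ _ := (φ.map_cast _ _ _).trans (congrArg _ (φ.map_mulSwap _ _))

theorem map_eval {G : ℕ → ℕ → Type*} (i : ∀ m n : ℕ, G m n → P.Hom m n) {m n : ℕ}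
    (t : PropTerm G m n) :
    φ.map (t.eval P i) = t.eval Q fun m n g => φ.map (i m n g) := by
  induction t with
  | gen g => rfl
  | id n => exact φ.map_id n
  | comp g f hg hf => rw [PropTerm.eval, PropTerm.eval, map_comp, hg, hf]
  | add f g hf hg => rw [PropTerm.eval, PropTerm.eval, map_add, hf, hg]
  | swap m n => exact φ.map_swap m n

end PropData.Map

/-- Two expressions identified by `R` and the laws of a prop have the same value in every prop
where the relations `R` hold. -/
theorem PropTerm.Cong.eval_eq {G : ℕ → ℕ → Type u}
    {R : ∀ m n : ℕ, PropTerm G m n → PropTerm G m n → Prop} {Q : PropData.{v}} (hQ : Q.IsProp)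
    (i : ∀ m n : ℕ, G m n → Q.Hom m n)
    (hR : ∀ (m n : ℕ) (s t : PropTerm G m n), R m n s t → s.eval Q i = t.eval Q i) {m n : ℕ}
    {s t : PropTerm G m n} (h : PropTerm.Cong R s t) : s.eval Q i = t.eval Q i := by
  let φ : (PropTerm.data G).Map Q :=
    { map := PropTerm.eval Q i
      map_id := fun _ => rfl
      map_comp := fun _ _ => rfl
      map_add := fun _ _ => rfl
      map_swap := fun _ _ => rfl }
  have hc : ∀ {m m' n n' : ℕ} (hm : m = m') (hn : n = n') (f : PropTerm G m n),
      PropTerm.eval Q i ((PropTerm.data G).cast hm hn f) = Q.cast hm hn (f.eval Q i) :=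
    fun hm hn f => φ.map_cast hm hn f
  induction h with
  | rel h => exact hR _ _ _ _ h
  | refl s => rfl
  | symm _ ih => exact ih.symm
  | trans _ _ h1 h2 => exact h1.trans h2
  | comp_congr _ _ h1 h2 => exact congrArg₂ Q.comp h1 h2
  | add_congr _ _ h1 h2 => exact congrArg₂ Q.add h1 h2
  | id_comp f => exact hQ.id_comp _
  | comp_id f => exact hQ.comp_id _
  | comp_assoc h g f => exact hQ.comp_assoc _ _ _
  | add_id m n => exact hQ.add_id m n
  | add_comp g f g' f' => exact hQ.add_comp _ _ _ _
  | add_assoc f g h => exact (hc _ _ _).trans (hQ.add_assoc _ _ _)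
  | zero_add f => exact (hc _ _ _).trans (hQ.zero_add _)
  | add_zero f => exact (hc _ _ _).trans (hQ.add_zero _)
  | swap_natural f g => exact hQ.swap_natural _ _
  | swap_swap m n => exact hQ.swap_swap m n
  | swap_add k m n =>
    rw [hc]
    simp only [PropTerm.eval, hc]
    exact hQ.swap_add k m n

/-- The quotient map from expressions to the presented prop. -/
def presentedMap (G : ℕ → ℕ → Type u)
    (R : ∀ m n : ℕ, PropTerm G m n → PropTerm G m n → Prop) :
    (PropTerm.data G).Map (presentedProp G R).toPropData where
  map f := Quotient.mk _ f
  map_id _ := rfl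
  map_comp _ _ := rfl
  map_add _ _ := rfl
  map_swap _ _ := rfl

theorem PropTerm.endo {G : ℕ → ℕ → Type u} (hG : ∀ {m n : ℕ}, G m n → m = n) {m n : ℕ}
    (t : PropTerm G m n) : m = n := by
  induction t with
  | gen g => exact hG g
  | id n => rfl
  | comp g f hg hf => exact hf.trans hg
  | add f g hf hg => rw [hf, hg]
  | swap m n => exact Nat.add_comm m n

theorem presentedProp_endo {G : ℕ → ℕ → Type u}
    (R : ∀ m n : ℕ, PropTerm G m n → PropTerm G m n → Prop) (hG : ∀ {m n : ℕ}, G m n → m = n)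
    {m n : ℕ} (f : (presentedProp G R).Hom m n) : m = n := by
  obtain ⟨t⟩ := f
  exact t.endo hG

theorem RigGen.endo {G : ℕ → ℕ → Type u} (hG : ∀ {m n : ℕ}, G m n → m = n) {m n : ℕ} :
    RigGen G m n → m = n
  | .tilde g => congrArg (2 ^ ·) (hG g)

/-- To prove a property of the morphisms of a presented prop, it suffices to check the generators
and the closure under the operations. -/
theorem presentedProp_induction {G : ℕ → ℕ → Type u}
    {R : ∀ m n : ℕ, PropTerm G m n → PropTerm G m n → Prop}
    {p : ∀ {m n : ℕ}, (presentedProp G R).Hom m n → Prop}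
    (gen : ∀ {m n : ℕ} (g : G m n), p ((presentedMap G R).map (.gen g)))
    (id : ∀ n, p ((presentedProp G R).id n))
    (comp : ∀ {l m n : ℕ} (g : (presentedProp G R).Hom m n) (f : (presentedProp G R).Hom l m),
      p g → p f → p ((presentedProp G R).comp g f))
    (add : ∀ {k l m n : ℕ} (f : (presentedProp G R).Hom k l) (g : (presentedProp G R).Hom m n),
      p f → p g → p ((presentedProp G R).add f g))
    (swap : ∀ m n, p ((presentedProp G R).swap m n)) {m n : ℕ}
    (f : (presentedProp G R).Hom m n) : p f := by
  suffices h : ∀ {m n : ℕ} (t : PropTerm G m n), p ((presentedMap G R).map t) from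
    Quotient.ind (fun t => h t) f
  intro m n t
  induction t with
  | gen g => exact gen g
  | id n => exact id n
  | comp g f hg hf => exact comp _ _ hg hf
  | add f g hf hg => exact add _ _ hf hg
  | swap m n => exact swap m n

/-! ### Rows and columns of a grid -/

namespace Realisation

variable {Q : PropData.{u}} {X : Type} {M : Type v} [Monoid M] (R : Realisation Q X M)

theorem rows_congr {m n : ℕ} (h : Q.Hom m n) {k : ℕ} {e e' : ℕ → X}
    (hee : ∀ i < k * m, e i = e' i) : R.rows h k e = R.rows h k e' :=
  seqProd_congr fun _ hi => R.val_congr _ fun _ hb => hee _ (grid_lt hi hb)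

theorem rows_eq_cols {k m n : ℕ} (h : Q.Hom m n) {e e' : ℕ → X}
    (hee : ∀ a < k, ∀ b < m, e (a * m + b) = e' (b * k + a)) : R.rows h k e = R.cols h k e' :=
  seqProd_congr fun a ha => R.val_congr _ fun b hb => hee a ha b hb

theorem rows_one {m n : ℕ} (h : Q.Hom m n) (e : ℕ → X) : R.rows h 1 e = R.val h e := by
  refine (seqProd_one _).trans (R.val_congr _ fun b _ => ?_)
  rw [Nat.zero_mul, Nat.zero_add]

theorem cols_one {m n : ℕ} (h : Q.Hom m n) (e : ℕ → X) : R.cols h 1 e = R.val h e := by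
  refine (seqProd_one _).trans (R.val_congr _ fun b _ => ?_)
  rw [Nat.mul_one, Nat.add_zero]

theorem rows_add {m n : ℕ} (h : Q.Hom m n) (k l : ℕ) (e : ℕ → X) :
    R.rows h (k + l) e = R.rows h k e * R.rows h l fun i => e (k * m + i) := by
  refine (seqProd_add _ k l).trans
    (congrArg _ (seqProd_congr fun _ _ => R.val_congr _ fun _ _ => ?_))
  exact congrArg e (by ring)

theorem rows_id {k m : ℕ} {e : ℕ → X} (he : Set.InjOn e (Set.Iio (k * m))) :
    R.rows (Q.id m) k e = 1 :=
  seqProd_eq_one fun _ hi => R.val_id (injOn_row he hi)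

theorem cols_id {k m : ℕ} {e : ℕ → X} (he : Set.InjOn e (Set.Iio (k * m))) :
    R.cols (Q.id k) m e = 1 :=
  seqProd_eq_one fun _ hi => R.val_id (injOn_col he hi)

theorem rows_comp {k m n o : ℕ} (g : Q.Hom n o) (f : Q.Hom m n) {e : ℕ → X}
    (he : Set.InjOn e (Set.Iio (k * m))) :
    R.rows (Q.comp g f) k e = R.rows g k e * R.rows f k e := by
  obtain rfl := R.endo f
  refine (seqProd_congr fun i hi => R.val_comp g f (injOn_row he hi)).trans
    (seqProd_mul_distrib fun i hi j hj => ?_)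
  have hj' := hj.trans hi
  refine R.val_comm _ _ (injOn_row he hj') (injOn_row he hi) fun a ha b hb => ?_
  exact ne_of_injOn he (grid_lt hj' ha) (grid_lt hi hb) fun h => hj.ne (grid_inj ha hb h).1

theorem cols_comp {k l m o : ℕ} (g : Q.Hom l o) (f : Q.Hom k l) {e : ℕ → X}
    (he : Set.InjOn e (Set.Iio (k * m))) :
    R.cols (Q.comp g f) m e = R.cols g m e * R.cols f m e := by
  obtain rfl := R.endo f
  refine (seqProd_congr fun i hi => R.val_comp g f (injOn_col he hi)).trans
    (seqProd_mul_distrib fun i hi j hj => ?_)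
  have hj' := hj.trans hi
  refine R.val_comm _ _ (injOn_col he hj') (injOn_col he hi) fun a ha b hb => ?_
  exact ne_of_injOn he (grid_lt ha hj') (grid_lt hb hi) fun h => hj.ne (grid_inj hj' hi h).2

theorem cols_add {k l m n o : ℕ} (f : Q.Hom k l) (g : Q.Hom n o) {e : ℕ → X}
    (he : Set.InjOn e (Set.Iio ((k + n) * m))) :
    R.cols (Q.add f g) m e = R.cols f m e * R.cols g m fun i => e (k * m + i) := by
  obtain rfl := R.endo f
  obtain rfl := R.endo g
  have h1 : ∀ j, (fun i => (fun a => e (a * m + j)) (k + i)) = fun i => e (k * m + (i * m + j)) :=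
    fun j => funext fun i => congrArg e (by ring)
  refine (seqProd_congr fun j hj => (R.val_add f g (injOn_col he hj)).trans
    (congrArg _ (congrArg (R.val g) (h1 j)))).trans (seqProd_mul_distrib fun i hi j hj => ?_)
  have hj' := hj.trans hi
  have he1 := injOn_shift (injOn_col he hj') le_rfl
  rw [← h1]
  refine R.val_comm _ _ he1 (injOn_left (injOn_col he hi)) fun a ha b hb => ?_
  exact ne_of_injOn he (grid_lt (by omega) hj') (grid_lt (by omega) hi) fun h =>
    hj.ne (grid_inj hj' hi h).2

theorem rows_conj {k m n : ℕ} (h : Q.Hom m n) {e : ℕ → X} (he : Set.InjOn e (Set.Iio (k * m)))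
    (σ : Perm X) : SemiconjBy (R.perm σ) (R.rows h k e) (R.rows h k fun i => σ (e i)) :=
  seqProd_semiconj fun _ hi => R.val_conj h (injOn_row he hi) σ

theorem cols_conj {k m n : ℕ} (h : Q.Hom m n) {e : ℕ → X} (he : Set.InjOn e (Set.Iio (m * k)))
    (σ : Perm X) : SemiconjBy (R.perm σ) (R.cols h k e) (R.cols h k fun i => σ (e i)) :=
  seqProd_semiconj fun _ hi => R.val_conj h (injOn_col he hi) σ

/-- Copies of morphisms on the columns and on the rows of disjoint grids commute. -/
theorem rows_comm_cols {k l m n o : ℕ} (f : Q.Hom k l) (h : Q.Hom m n) {r : ℕ} {e e' : ℕ → X}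
    (he : Set.InjOn e (Set.Iio (k * o))) (he' : Set.InjOn e' (Set.Iio (r * m)))
    (hee : ∀ i < k * o, ∀ j < r * m, e i ≠ e' j) : Commute (R.cols f o e) (R.rows h r e') :=
  seqProd_commute fun _ hj => (seqProd_commute fun _ hi =>
    (R.val_comm f h (injOn_col he hj) (injOn_row he' hi) fun _ ha _ hb =>
      hee _ (grid_lt ha hj) _ (grid_lt hi hb)).symm).symm

theorem rows_comm_rows {k l m n : ℕ} (f : Q.Hom k l) (h : Q.Hom m n) {r s : ℕ} {e e' : ℕ → X}
    (he : Set.InjOn e (Set.Iio (s * k))) (he' : Set.InjOn e' (Set.Iio (r * m)))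
    (hee : ∀ i < s * k, ∀ j < r * m, e i ≠ e' j) : Commute (R.rows f s e) (R.rows h r e') :=
  seqProd_commute fun _ hj => (seqProd_commute fun _ hi =>
    (R.val_comm f h (injOn_row he hj) (injOn_row he' hi) fun _ ha _ hb =>
      hee _ (grid_lt hj ha) _ (grid_lt hi hb)).symm).symm

/-- Copies of `f` on the columns of a grid commute with copies of `h` on its rows. -/
def Interchange {k l m n : ℕ} (f : Q.Hom k l) (h : Q.Hom m n) : Prop :=
  ∀ e : ℕ → X, Set.InjOn e (Set.Iio (k * m)) → Commute (R.cols f m e) (R.rows h k e)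

variable {R}

theorem injOn_transpose {k m : ℕ} {e : ℕ → X} (he : Set.InjOn e (Set.Iio (k * m))) :
    Set.InjOn (fun i => e ((i % k) * m + i / k)) (Set.Iio (m * k)) := by
  refine injOn_comp he (fun i => (i % k) * m + i / k) (forall_grid fun a ha b hb => ?_) ?_
  · rw [mod_grid hb, div_grid hb]
    exact grid_lt hb ha
  · refine forall_grid fun a ha b hb => forall_grid fun a' ha' b' hb' h => ?_
    rw [mod_grid hb, div_grid hb, mod_grid hb', div_grid hb'] at h
    obtain ⟨rfl, rfl⟩ := grid_inj ha ha' h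
    rfl

/-- Interchange is symmetric, as seen on the transposed grid. -/
theorem Interchange.symm {k l m n : ℕ} {f : Q.Hom k l} {h : Q.Hom m n} (H : R.Interchange f h) :
    R.Interchange h f := by
  intro e he
  have he' := injOn_transpose he
  have h1 : R.cols h k e = R.rows h k fun i => e ((i % m) * k + i / m) :=
    (R.rows_eq_cols h fun a ha b hb => by rw [mod_grid hb, div_grid hb]).symm
  have h2 : R.rows f m e = R.cols f m fun i => e ((i % m) * k + i / m) :=
    R.rows_eq_cols f fun a ha b hb => by rw [mod_grid ha, div_grid ha]
  rw [h1, h2]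
  exact (H _ he').symm

theorem Interchange.id (k : ℕ) {m n : ℕ} (h : Q.Hom m n) : R.Interchange (Q.id k) h := by
  intro e he
  rw [R.cols_id he]
  exact Commute.one_left _

theorem Interchange.comp {k l o m n : ℕ} {g : Q.Hom l o} {f : Q.Hom k l} {h : Q.Hom m n}
    (hg : R.Interchange g h) (hf : R.Interchange f h) : R.Interchange (Q.comp g f) h := by
  obtain rfl := R.endo f
  intro e he
  rw [R.cols_comp g f he]
  exact (hg e he).mul_left (hf e he)

theorem Interchange.add {k l k' l' m n : ℕ} {f : Q.Hom k l} {g : Q.Hom k' l'} {h : Q.Hom m n}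
    (hf : R.Interchange f h) (hg : R.Interchange g h) : R.Interchange (Q.add f g) h := by
  intro e he
  have hN : (k + k') * m = k * m + k' * m := Nat.add_mul k k' m
  rw [hN] at he
  have he1 := injOn_left he
  have he2 := injOn_shift he le_rfl
  rw [R.cols_add f g (by rwa [hN]), R.rows_add]
  refine ((hf e he1).mul_right ?_).mul_left (Commute.mul_right ?_ (hg _ he2))
  · exact R.rows_comm_cols f h he1 he2 fun i hi j hj =>
      ne_of_injOn he (by omega) (by omega) (by omega)
  · exact R.rows_comm_cols g h he2 he1 fun i hi j hj =>
      ne_of_injOn he (by omega) (by omega) (by omega)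

end Realisation

/-! ### The tensor product on the powers of `2` -/

namespace StrictProp

variable {Q : StrictProp.{u}}

namespace IsPermMor

theorem lt {a b : ℕ} {f : Q.Hom a b} {p : ℕ → ℕ} (h : Q.IsPermMor f p) {i : ℕ} (hi : i < a) :
    p i < a := by
  obtain ⟨h, τ, -, h2⟩ := h
  rw [← h2 ⟨i, hi⟩]
  exact (τ ⟨i, hi⟩).2

theorem eq {a b : ℕ} {f g : Q.Hom a b} {p : ℕ → ℕ} (hf : Q.IsPermMor f p)
    (hg : Q.IsPermMor g p) : f = g := by
  obtain ⟨rfl, σ, f1, f2⟩ := hf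
  obtain ⟨_, τ, g1, g2⟩ := hg
  have : σ = τ := Equiv.ext fun i => Fin.ext ((f2 i).trans (g2 i).symm)
  subst this
  exact f1.trans g1.symm

theorem copies {k l : ℕ} {f : Q.Hom k l} {p : ℕ → ℕ} (hf : Q.IsPermMor f p) :
    ∀ N : ℕ, Q.IsPermMor (Q.copies f N) fun i => i / k * k + p (i % k)
  | 0 => (IsPermMor.cast _ _ (IsPermMor.id 0)).congr fun i hi => by simp at hi
  | N + 1 => by
    refine (IsPermMor.cast _ _ (IsPermMor.add (copies hf N) hf)).congr ?_
    refine Realisation.forall_grid fun a ha b hb => ?_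
    rw [Realisation.div_grid hb, Realisation.mod_grid hb]
    rcases Nat.lt_succ_iff_lt_or_eq.1 ha with ha | rfl
    · rw [if_pos (Realisation.grid_lt ha hb)]
    · rw [if_neg (by omega), Nat.add_sub_cancel_left]

end IsPermMor

/-- A morphism is determined by its action at distinct positions. -/
theorem hom_ext (hQ : ∀ {m n : ℕ}, Q.Hom m n → m = n) {a b : ℕ} (ha : 0 < a) {f g : Q.Hom a b}
    (H : ∀ e : ℕ → Fin a, Set.InjOn e (Set.Iio a) →
      (Q.selfRealisation hQ a).val f e = (Q.selfRealisation hQ a).val g e) : f = g := by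
  obtain rfl := hQ f
  have : NeZero a := ⟨ha.ne'⟩
  have := H (Fin.ofNat a) fun i hi j hj hij => by
    have := Fin.ext_iff.1 hij
    simpa [Fin.ofNat, Nat.mod_eq_of_lt hi, Nat.mod_eq_of_lt hj] using this
  exact (Q.selfVal_ofNat f).symm.trans (this.trans (Q.selfVal_ofNat g))

/-- The symmetry of the tensor product is the permutation `a n + b ↦ b m + a`. -/
theorem mulSwap_isPermMor (hQ : ∀ {m n : ℕ}, Q.Hom m n → m = n) {m n : ℕ} (hm : 0 < m)
    (hn : 0 < n) : Q.IsPermMor (Q.mulSwap m n) fun i => i % n * m + i / n := by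
  have hM : NeZero (m * n) := ⟨by positivity⟩
  have he : Set.InjOn (Fin.ofNat (m * n)) (Set.Iio (m * n)) := fun i hi j hj hij => by
    have := Fin.ext_iff.1 hij
    simpa [Fin.ofNat, Nat.mod_eq_of_lt hi, Nat.mod_eq_of_lt hj] using this
  obtain ⟨σ, h0, h1, -⟩ := (Q.selfRealisation hQ (m * n)).val_mulSwap m n he
  refine ⟨Nat.mul_comm m n, σ, ?_, fun i => ?_⟩
  · rw [← Q.selfVal_ofNat (Q.cast rfl (Nat.mul_comm m n).symm (Q.mulSwap m n)), selfVal_cast]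
    exact h0
  · suffices h : ∀ i < m * n, (σ (Fin.ofNat (m * n) i) : ℕ) = i % n * m + i / n by
      have h2 := h i i.2
      have h3 : Fin.ofNat (m * n) (i : ℕ) = i := Fin.ext (Nat.mod_eq_of_lt i.2)
      rwa [h3] at h2
    refine Realisation.forall_grid fun a ha b hb => ?_
    rw [h1 a ha b hb, Realisation.div_grid hb, Realisation.mod_grid hb]
    have := Realisation.grid_lt hb ha
    exact Nat.mod_eq_of_lt (by rwa [Nat.mul_comm m n])

theorem IsPermMor.kron (hQ : ∀ {m n : ℕ}, Q.Hom m n → m = n) {k l m n : ℕ} {f : Q.Hom k l}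
    {h : Q.Hom m n} {p q : ℕ → ℕ} (hf : Q.IsPermMor f p) (hh : Q.IsPermMor h q) (hk : 0 < k)
    (hm : 0 < m) : Q.IsPermMor (Q.kron f h) fun i => p (i / m) * m + q (i % m) := by
  obtain rfl := hQ f
  obtain rfl := hQ h
  refine (IsPermMor.comp (mulSwap_isPermMor hQ hm hk) (IsPermMor.comp (hf.copies m)
    (IsPermMor.comp (mulSwap_isPermMor hQ hk hm) (hh.copies k)))).congr ?_
  refine Realisation.forall_grid fun a ha b hb => ?_
  simp only [Realisation.div_grid, Realisation.mod_grid, ha, hb, hh.lt hb, hf.lt ha]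

theorem mulSwap_mulSwap (hQ : ∀ {m n : ℕ}, Q.Hom m n → m = n) {m n : ℕ} (hm : 0 < m)
    (hn : 0 < n) : Q.comp (Q.mulSwap n m) (Q.mulSwap m n) = Q.id (m * n) := by
  refine (((mulSwap_isPermMor hQ hn hm).comp (mulSwap_isPermMor hQ hm hn)).congr ?_).eq
    (IsPermMor.id _)
  refine Realisation.forall_grid fun a ha b hb => ?_
  simp only [Realisation.div_grid, Realisation.mod_grid, ha, hb]

theorem mulSwap_mul (hQ : ∀ {m n : ℕ}, Q.Hom m n → m = n) {k m n : ℕ} (hk : 0 < k) (hm : 0 < m)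
    (hn : 0 < n) :
    Q.mulSwap k (m * n) = Q.cast (Nat.mul_assoc k m n) (Nat.mul_assoc m n k).symm
      (Q.comp (Q.cast (Nat.mul_assoc m k n).symm rfl (Q.kron (Q.id m) (Q.mulSwap k n)))
        (Q.kron (Q.mulSwap k m) (Q.id n))) := by
  have hkn : 0 < k * n := by positivity
  have hkm : 0 < k * m := by positivity
  refine (mulSwap_isPermMor hQ hk (by positivity)).eq
    ((IsPermMor.cast _ _ (IsPermMor.comp (IsPermMor.cast _ _ (IsPermMor.kron hQ (IsPermMor.id m)
      (mulSwap_isPermMor hQ hk hn) hm hkn)) (IsPermMor.kron hQ (mulSwap_isPermMor hQ hk hm)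
      (IsPermMor.id n) hkm hn))).congr ?_)
  refine Realisation.forall_grid fun a ha => Realisation.forall_grid fun b hb c hc => ?_
  have e1 : a * (m * n) + (b * n + c) = (a * m + b) * n + c := by ring
  have e2 : (b * k + a) * n + c = b * (k * n) + (a * n + c) := by ring
  have h1 := Realisation.grid_lt ha hc
  rw [Realisation.div_grid (Realisation.grid_lt hb hc),
    Realisation.mod_grid (Realisation.grid_lt hb hc), e1]
  simp only [Realisation.div_grid, Realisation.mod_grid, hb, hc]
  rw [e2]
  simp only [Realisation.div_grid, Realisation.mod_grid, hc, h1]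
  ring

end StrictProp

namespace Realisation

variable {Q : PropData.{u}} {X : Type} {M : Type v} [Monoid M] (R : Realisation Q X M)

/-- Copies of `g ⊗ h` on the rows of a grid, as copies of `g` on the columns of its blocks and
copies of `h`. -/
theorem rows_kron {k l m n o : ℕ} (g : Q.Hom l o) (h : Q.Hom m n) {e : ℕ → X}
    (he : Set.InjOn e (Set.Iio (k * (l * m)))) :
    R.rows (Q.kron g h) k e =
      seqProd (fun a => R.cols g m fun i => e (a * (l * m) + i)) k * R.rows h (k * l) e := by
  have h1 : R.rows h (k * l) e =
      seqProd (fun a => R.rows h l fun i => e (a * (l * m) + i)) k := by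
    refine (seqProd_mul _ l k).trans (seqProd_congr fun a _ => seqProd_congr fun b _ =>
      R.val_congr _ fun c _ => congrArg e ?_)
    ring
  rw [h1]
  refine (seqProd_congr fun a ha => R.val_kron g h (injOn_row he ha)).trans
    (seqProd_mul_distrib fun i hi j hj => ?_)
  have hj' := hj.trans hi
  exact (R.rows_comm_cols g h (injOn_row he hi) (injOn_row he hj') fun a ha b hb =>
    ne_of_injOn he (grid_lt hi ha) (grid_lt hj' hb) fun h => hj.ne (grid_inj ha hb h).1.symm).symm

/-- Copies of `f ⊗ g` on the columns of a grid, as copies of `f` and copies of `g` on the columns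
of its blocks. -/
theorem cols_kron {k l m n o : ℕ} (f : Q.Hom k n) (g : Q.Hom l o) {e : ℕ → X}
    (he : Set.InjOn e (Set.Iio (k * l * m))) :
    R.cols (Q.kron f g) m e =
      R.cols f (l * m) e * seqProd (fun a => R.cols g m fun i => e (a * (l * m) + i)) k := by
  have hcol : ∀ {c}, c < m → Set.InjOn (fun i => e (i * m + c)) (Set.Iio (k * l)) :=
    fun hc => injOn_col he hc
  have h1 : R.cols f (l * m) e = seqProd (fun c => R.cols f l fun i => e (i * m + c)) m := by
    refine (seqProd_mul _ m l).trans ?_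
    rw [seqProd_comm]
    · refine seqProd_congr fun c _ => seqProd_congr fun b _ => R.val_congr _ fun a _ =>
        congrArg e ?_
      ring
    · intro b hb c hc b' hb' c' hc' hbb
      have h := Nat.mul_assoc k l m
      refine R.val_comm _ _ (injOn_col (m := l * m) (by rwa [← h]) (grid_lt hb hc))
        (injOn_col (m := l * m) (by rwa [← h]) (grid_lt hb' hc')) fun a ha a' ha' => ?_
      refine ne_of_injOn (N := k * (l * m)) (by rwa [← h]) (grid_lt ha (grid_lt hb hc))
        (grid_lt ha' (grid_lt hb' hc')) fun h => hbb ?_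
      exact (grid_inj hc hc' (grid_inj (grid_lt hb hc) (grid_lt hb' hc') h).2).1
  have h2 : seqProd (fun a => R.cols g m fun i => e (a * (l * m) + i)) k =
      seqProd (fun c => R.rows g k fun i => e (i * m + c)) m := by
    refine (seqProd_comm (fun a c => R.val g fun b => e (a * (l * m) + (b * m + c))) m k ?_).trans
      (seqProd_congr fun c _ => seqProd_congr fun a _ => R.val_congr _ fun b _ => congrArg e ?_)
    · intro a ha c hc a' ha' c' hc' haa
      have h := Nat.mul_assoc k l m
      have he' : Set.InjOn e (Set.Iio (k * (l * m))) := by rwa [← h]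
      refine R.val_comm _ _ (injOn_col (injOn_row he' ha) hc) (injOn_col (injOn_row he' ha') hc')
        fun b hb b' hb' => ?_
      exact ne_of_injOn he' (grid_lt ha (grid_lt hb hc)) (grid_lt ha' (grid_lt hb' hc')) fun h =>
        haa (grid_inj (grid_lt hb hc) (grid_lt hb' hc') h).1
    · ring
  rw [h1, h2]
  refine (seqProd_congr fun c hc => R.val_kron f g (hcol hc)).trans
    (seqProd_mul_distrib fun i hi j hj => ?_)
  have hj' := hj.trans hi
  exact (R.rows_comm_cols f g (hcol hi) (hcol hj') fun a ha b hb =>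
    ne_of_injOn he (grid_lt ha hi) (grid_lt hb hj') fun h => hj.ne (grid_inj hi hj' h).2.symm).symm

/-- The tensor product is associative: on a three-dimensional grid of positions, both sides are the
copies of `f`, of `g` and of `h` on the lines in the three directions. No interchange of `f`, `g`
and `h` is needed for this. -/
theorem val_kron_assoc {k l m k' l' m' : ℕ} (f : Q.Hom k k') (g : Q.Hom l l') (h : Q.Hom m m')
    {e : ℕ → X} (he : Set.InjOn e (Set.Iio (k * l * m))) :
    R.val (Q.kron (Q.kron f g) h) e = R.val (Q.kron f (Q.kron g h)) e := by
  have he' : Set.InjOn e (Set.Iio (k * (l * m))) := by rwa [← Nat.mul_assoc]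
  rw [R.val_kron _ _ he, R.val_kron _ _ he', R.cols_kron f g he, R.rows_kron g h he', mul_assoc]

variable {R}

/-- The tensor product is functorial on morphisms that interchange. -/
theorem Interchange.val_comp_kron {k l m k' l' m' : ℕ} {g : Q.Hom l m} {f : Q.Hom k l}
    {g' : Q.Hom l' m'} {f' : Q.Hom k' l'} (H : R.Interchange f g') {e : ℕ → X}
    (he : Set.InjOn e (Set.Iio (k * k'))) :
    R.val (Q.kron (Q.comp g f) (Q.comp g' f')) e =
      R.val (Q.comp (Q.kron g g') (Q.kron f f')) e := by
  obtain rfl := R.endo f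
  obtain rfl := R.endo f'
  rw [R.val_comp _ _ he, R.val_kron _ _ he, R.val_kron _ _ he, R.val_kron _ _ he,
    R.cols_comp _ _ he, R.rows_comp _ _ he]
  simp only [mul_assoc]
  congr 1
  rw [← mul_assoc, ← mul_assoc, (H e he).eq]

/-- The symmetry of the tensor product is natural for morphisms that interchange. -/
theorem Interchange.val_mulSwap_comp {k l m n : ℕ} {f : Q.Hom k l} {h : Q.Hom m n}
    (H : R.Interchange f h) {e : ℕ → X} (he : Set.InjOn e (Set.Iio (k * m))) :
    R.val (Q.comp (Q.mulSwap l n) (Q.kron f h)) e =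
      R.val (Q.comp (Q.kron h f) (Q.mulSwap k m)) e := by
  obtain rfl := R.endo f
  obtain rfl := R.endo h
  have he' : Set.InjOn e (Set.Iio (m * k)) := by rwa [Nat.mul_comm]
  obtain ⟨σ, h0, h1, -⟩ := R.val_mulSwap k m he
  rw [R.val_comp _ _ he, R.val_comp _ _ he, R.val_kron _ _ he, R.val_kron _ _ he', h0]
  have hf : SemiconjBy (R.perm σ) (R.cols f m e) (R.rows f m e) := by
    rw [R.rows_eq_cols (e' := fun i => σ (e i)) f fun a ha b hb => (h1 b hb a ha).symm]
    exact R.cols_conj f he σ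
  have hh : SemiconjBy (R.perm σ) (R.rows h k e) (R.cols h k e) := by
    rw [← R.rows_eq_cols (e := fun i => σ (e i)) h fun a ha b hb => h1 a ha b hb]
    exact R.rows_conj h he σ
  rw [(H.symm e he').eq]
  exact (hf.mul_right hh).eq

end Realisation

namespace StrictProp

variable {Q : StrictProp.{u}}

theorem powTwo_cast (Q : PropData.{u}) {m m' n n' : ℕ} (hm : m = m') (hn : n = n')
    (f : Q.Hom (2 ^ m) (2 ^ n)) :
    Q.powTwo.cast hm hn f = Q.cast (congrArg (2 ^ ·) hm) (congrArg (2 ^ ·) hn) f := by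
  subst hm hn; rfl

theorem kron_cast (Q : PropData.{u}) {k k' l l' m m' n n' : ℕ} (hk : k = k') (hl : l = l')
    (hm : m = m') (hn : n = n') (f : Q.Hom k l) (h : Q.Hom m n) :
    Q.kron (Q.cast hk hl f) (Q.cast hm hn h) =
      Q.cast (congrArg₂ (· * ·) hk hm) (congrArg₂ (· * ·) hl hn) (Q.kron f h) := by
  subst hk hl hm hn; rfl

/-- If copies of morphisms on the columns of a grid commute with copies of morphisms on its rows,
then the tensor product makes the full subcategory on the powers of `2` a prop. -/
theorem powTwo_isProp (hQ : ∀ {m n : ℕ}, Q.Hom m n → m = n)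
    (H : ∀ {M k l m n : ℕ} (f : Q.Hom k l) (h : Q.Hom m n),
      (Q.selfRealisation hQ M).Interchange f h) : Q.powTwo.IsProp where
  id_comp f := Q.isProp.id_comp f
  comp_id f := Q.isProp.comp_id f
  comp_assoc h g f := Q.isProp.comp_assoc h g f
  add_id m n := by
    have : Q.kron (Q.id (2 ^ m)) (Q.id (2 ^ n)) = Q.id (2 ^ m * 2 ^ n) :=
      ((IsPermMor.id _).kron hQ (IsPermMor.id _) (by positivity) (by positivity)).congr
        (fun i _ => Nat.div_add_mod' i _) |>.eq (IsPermMor.id _)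
    exact (congrArg (Q.cast _ _) this).trans (Q.cast_id _ _)
  add_comp {k l m k' l' m'} (g : Q.Hom _ _) (f : Q.Hom _ _) (g' : Q.Hom _ _) (f' : Q.Hom _ _) := by
    have : Q.kron (Q.comp g f) (Q.comp g' f') = Q.comp (Q.kron g g') (Q.kron f f') :=
      hom_ext hQ (by positivity) fun e he => (H f g').val_comp_kron he
    exact (congrArg (Q.cast _ _) this).trans (Q.cast_comp _ _ _ _ _)
  add_assoc {k l m k' l' m'} (f : Q.Hom _ _) (g : Q.Hom _ _) (h : Q.Hom _ _) := by
    refine (powTwo_cast _ _ _ _).trans ?_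
    change Q.cast _ _ (Q.cast _ _ (Q.kron (Q.cast (pow_add 2 k l).symm (pow_add 2 k' l').symm
      (Q.kron f g)) (Q.cast rfl rfl h))) = Q.cast (pow_add 2 k (l + m)).symm
        (pow_add 2 k' (l' + m')).symm (Q.kron (Q.cast rfl rfl f)
          (Q.cast (pow_add 2 l m).symm (pow_add 2 l' m').symm (Q.kron g h)))
    rw [kron_cast, kron_cast, Q.cast_cast, Q.cast_cast, Q.cast_cast]
    have : Q.cast (Nat.mul_assoc _ _ _) (Nat.mul_assoc _ _ _) (Q.kron (Q.kron f g) h) =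
        Q.kron f (Q.kron g h) :=
      hom_ext hQ (by positivity) fun e he => by
        rw [Realisation.val_cast]
        exact (Q.selfRealisation hQ _).val_kron_assoc f g h (by rwa [Nat.mul_assoc])
    rw [← this, Q.cast_cast]
  zero_add {m n} (f : Q.Hom _ _) := by
    refine (powTwo_cast _ _ _ _).trans ?_
    refine (Q.cast_cast _ _ _ _ (Q.kron (Q.id (2 ^ 0)) f)).trans ?_
    refine hom_ext hQ (by positivity) fun e he => ?_
    have he' : Set.InjOn e (Set.Iio (2 ^ 0 * 2 ^ m)) := by rwa [pow_zero, one_mul]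
    rw [Realisation.val_cast]
    refine ((Q.selfRealisation hQ _).val_kron _ f he').trans ?_
    rw [Realisation.cols_id _ he', one_mul]
    exact Realisation.rows_one _ f e
  add_zero {m n} (f : Q.Hom _ _) := by
    refine (powTwo_cast _ _ _ _).trans ?_
    refine (Q.cast_cast _ _ _ _ (Q.kron f (Q.id (2 ^ 0)))).trans ?_
    refine hom_ext hQ (by positivity) fun e he => ?_
    have he' : Set.InjOn e (Set.Iio (2 ^ m * 2 ^ 0)) := by rwa [pow_zero, mul_one]
    rw [Realisation.val_cast]
    refine ((Q.selfRealisation hQ _).val_kron f _ he').trans ?_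
    rw [Realisation.rows_id _ he', mul_one]
    exact Realisation.cols_one _ f e
  swap_natural {k l m n} (f : Q.Hom _ _) (g : Q.Hom _ _) := by
    have : Q.comp (Q.mulSwap (2 ^ l) (2 ^ n)) (Q.kron f g) =
        Q.comp (Q.kron g f) (Q.mulSwap (2 ^ k) (2 ^ m)) :=
      hom_ext hQ (by positivity) fun e he => (H f g).val_mulSwap_comp he
    exact ((Q.cast_comp _ _ _ _ _).symm.trans (congrArg (Q.cast _ _) this)).trans
      (Q.cast_comp _ _ _ _ _)
  swap_swap m n := by
    have := mulSwap_mulSwap hQ (m := 2 ^ m) (n := 2 ^ n) (by positivity) (by positivity)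
    exact (Q.cast_comp _ _ _ _ _).symm.trans ((congrArg (Q.cast _ _) this).trans (Q.cast_id _ _))
  swap_add k m n := by
    have h2 : Q.powTwo.add (Q.powTwo.id m) (Q.powTwo.swap k n) = Q.cast
        (by rw [pow_add, pow_add]) (by rw [pow_add, pow_add])
        (Q.kron (Q.id (2 ^ m)) (Q.mulSwap (2 ^ k) (2 ^ n))) :=
      (congrArg (Q.cast _ _) (kron_cast Q.toPropData rfl rfl _ _ _ _)).trans (Q.cast_cast _ _ _ _ _)
    have h3 : Q.powTwo.add (Q.powTwo.swap k m) (Q.powTwo.id n) = Q.cast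
        (by rw [pow_add, pow_add]) (by rw [pow_add, pow_add])
        (Q.kron (Q.mulSwap (2 ^ k) (2 ^ m)) (Q.id (2 ^ n))) :=
      (congrArg (Q.cast _ _) (kron_cast Q.toPropData _ _ rfl rfl _ _)).trans (Q.cast_cast _ _ _ _ _)
    have key := mulSwap_mul hQ (k := 2 ^ k) (m := 2 ^ m) (n := 2 ^ n) (by positivity)
      (by positivity) (by positivity)
    have key' : Q.mulSwap (2 ^ k) (2 ^ (m + n)) = Q.cast (by rw [pow_add]) (by rw [pow_add])
        (Q.mulSwap (2 ^ k) (2 ^ m * 2 ^ n)) := by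
      have : ∀ a b, (h : a = b) → Q.mulSwap (2 ^ k) b = Q.cast (by rw [h]) (by rw [h])
          (Q.mulSwap (2 ^ k) a) := by
        rintro a b rfl; rfl
      exact this _ _ (pow_add 2 m n).symm
    rw [h2, h3]
    refine Eq.trans ?_ (powTwo_cast _ _ _ _).symm
    change Q.cast _ _ _ = Q.cast _ _ (Q.comp (Q.powTwo.cast _ _ _) _)
    rw [powTwo_cast]
    rw [key', key, Q.cast_cast, Q.cast_cast, Q.cast_cast,
      Q.cast_comp (b' := 2 ^ (m + k + n)) _ (by rw [pow_add, pow_add]) _, Q.cast_cast,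
      Q.cast_comp (b' := 2 ^ (m + k + n)) _ rfl _, Q.cast_cast, Q.cast_cast]

theorem IsPermMor.inj {a b : ℕ} {f : Q.Hom a b} {p : ℕ → ℕ} (h : Q.IsPermMor f p) {i j : ℕ}
    (hi : i < a) (hj : j < a) (hij : p i = p j) : i = j := by
  obtain ⟨h, τ, -, h2⟩ := h
  have := h2 ⟨i, hi⟩
  have h3 : τ ⟨i, hi⟩ = τ ⟨j, hj⟩ := Fin.ext (by rw [h2, h2]; exact hij)
  exact Fin.ext_iff.1 (τ.injective h3)

/-- Copies of a symmetry on the columns of a grid permute its rows, so they commute with equal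
copies of a morphism on the rows. -/
theorem interchange_swap (hQ : ∀ {m n : ℕ}, Q.Hom m n → m = n) {M : ℕ} (a b : ℕ) {m n : ℕ}
    (h : Q.Hom m n) : (Q.selfRealisation hQ M).Interchange (Q.swap a b) h := by
  intro e he
  set S := Q.selfRealisation hQ M with hS
  rcases Nat.eq_zero_or_pos m with rfl | hm
  · exact Commute.one_left _
  rcases Nat.eq_zero_or_pos (a + b) with hab | hab
  · have : S.rows h (a + b) e = 1 := seqProd_eq_one fun i hi => by omega
    rw [this]
    exact Commute.one_right _
  have hp := (Q.swap_isPermMor a b).kron hQ (IsPermMor.id m) hab hm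
  obtain ⟨σ, hσ⟩ := exists_along he _ (fun i hi => hp.lt hi) fun i hi j hj h => hp.inj hi hj h
  have h1 : S.cols (Q.swap a b) m e = S.perm σ := by
    have := S.val_kron (Q.swap a b) (Q.id m) he
    rw [S.rows_id he, mul_one] at this
    exact this.symm.trans (hp.selfVal_eq he hσ)
  have hab' : a + b = b + a := Nat.add_comm a b
  have he' : Set.InjOn e (Set.Iio (b * m + a * m)) := by rwa [← Nat.add_mul, ← hab']
  have hN : (a + b) * m = a * m + b * m := Nat.add_mul a b m
  have h2 : S.rows h (a + b) (fun i => σ (e i)) = S.rows h (a + b) e := by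
    rw [S.rows_add]
    have e1 : S.rows h a (fun i => σ (e i)) = S.rows h a fun i => e (b * m + i) :=
      S.rows_congr h fun i hi => by
        have hi' : i / m < a := Nat.div_lt_of_lt_mul (by rwa [Nat.mul_comm])
        rw [hσ.1 i (by omega)]
        beta_reduce
        rw [swapFun, if_pos hi', Nat.add_mul, Nat.add_assoc,
          Nat.div_add_mod']
    have e2 : S.rows h b (fun i => σ (e (a * m + i))) = S.rows h b e :=
      S.rows_congr h fun i hi => by
        have : (a * m + i) / m = a + i / m := by
          rw [Nat.mul_comm, Nat.mul_add_div hm]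
        rw [hσ.1 _ (by omega)]
        beta_reduce
        rw [swapFun, this, if_neg (Nat.not_lt.2 (Nat.le_add_right _ _)), Nat.add_sub_cancel_left,
          Nat.mul_comm a m, Nat.mul_add_mod, Nat.div_add_mod']
    rw [e1, e2, hab', S.rows_add]
    exact S.rows_comm_rows h h (Realisation.injOn_shift he' le_rfl) (Realisation.injOn_left he')
      fun i hi j hj => Realisation.ne_of_injOn he' (by omega) (by omega) (by omega)
  rw [h1]
  have := S.rows_conj h he σ
  rwa [h2] at this

/-! ### The rigged crop -/

section riggedCrop

variable {G : ℕ → ℕ → Type u} {R : ∀ m n : ℕ, PropTerm G m n → PropTerm G m n → Prop}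
  {X : PropTerm G 1 1}

theorem riggedCrop_endo (hG : ∀ {m n : ℕ}, G m n → m = n) {m n : ℕ}
    (f : (riggedCrop G R X).Hom m n) : m = n :=
  presentedProp_endo _ (RigGen.endo hG) f

theorem mk_tilde {m n : ℕ} (t : PropTerm G m n) :
    (presentedMap (RigGen G) (RigRel R X)).map (m := 2 ^ m) (n := 2 ^ n) t.tilde =
      t.eval (riggedCrop G R X).powTwo fun _ _ g => riggedGen R X g :=
  (presentedMap (RigGen G) (RigRel R X)).powTwo.map_eval _ t

/-- The interchange relations of the rigged crop between generators propagate to all morphisms. -/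
theorem riggedCrop_interchange (hG : ∀ {m n : ℕ}, G m n → m = n) {M k l m n : ℕ}
    (f : (riggedCrop G R X).Hom k l) (h : (riggedCrop G R X).Hom m n) :
    ((riggedCrop G R X).selfRealisation (riggedCrop_endo hG) M).Interchange f h := by
  set S := (riggedCrop G R X).selfRealisation (riggedCrop_endo hG) M with hS
  have hgen : ∀ {k l m n : ℕ} (f : RigGen G k l) (h : RigGen G m n),
      S.Interchange ((presentedMap (RigGen G) (RigRel R X)).map (.gen f))
        ((presentedMap (RigGen G) (RigRel R X)).map (.gen h)) := by
    rintro _ _ _ _ ⟨f⟩ ⟨h⟩ e he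
    rename_i k l m n
    obtain rfl := hG f
    obtain rfl := hG h
    have key : (riggedCrop G R X).comp
        ((riggedCrop G R X).kron (riggedGen R X f) ((riggedCrop G R X).id (2 ^ m)))
        ((riggedCrop G R X).kron ((riggedCrop G R X).id (2 ^ k)) (riggedGen R X h)) =
      (riggedCrop G R X).comp
        ((riggedCrop G R X).kron ((riggedCrop G R X).id (2 ^ k)) (riggedGen R X h))
        ((riggedCrop G R X).kron (riggedGen R X f) ((riggedCrop G R X).id (2 ^ m))) := by
      have h1 := Quotient.sound (s := PropTerm.setoid (RigRel R X) _ _)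
        (PropTerm.Cong.rel (R := RigRel R X) (RigRel.interchange f h))
      have h2 := congrArg₂ (riggedCrop G R X).comp
        (mk_tilde (R := R) (X := X) (PropTerm.add (.gen f) (.id m)))
        (mk_tilde (R := R) (X := X) (PropTerm.add (.id k) (.gen h)))
      have h3 := congrArg₂ (riggedCrop G R X).comp
        (mk_tilde (R := R) (X := X) (PropTerm.add (.id k) (.gen h)))
        (mk_tilde (R := R) (X := X) (PropTerm.add (.gen f) (.id m)))
      have h4 := (h2.symm.trans h1).trans h3
      have h5 := (((riggedCrop G R X).cast_comp _ _ _ _ _).trans h4).trans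
        ((riggedCrop G R X).cast_comp _ _ _ _ _).symm
      have h6 := congrArg ((riggedCrop G R X).cast (pow_add 2 k m) (pow_add 2 k m)) h5
      exact (((riggedCrop G R X).cast_cast _ _ _ _ _).symm.trans h6).trans
        ((riggedCrop G R X).cast_cast _ _ _ _ _)
    have := congrArg (fun f => S.val f e) key
    simp only [S.val_comp _ _ he, S.val_kron _ _ he, S.rows_id he, S.cols_id he, mul_one,
      one_mul] at this
    exact this
  refine presentedProp_induction (p := fun f => S.Interchange f h) (fun f => ?_)
    (fun n => .id n h) (fun g f hg hf => hg.comp hf) (fun f g hf hg => hf.add hg)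
    (fun a b => interchange_swap _ a b h) f
  refine Realisation.Interchange.symm ?_
  refine presentedProp_induction (p := fun h => S.Interchange h _) (fun h => hgen h f)
    (fun n => .id n _) (fun g f hg hf => hg.comp hf) (fun f g hf hg => hf.add hg)
    (fun a b => interchange_swap _ a b _) h

/-- The powers of `2` in the rigged crop, with the tensor product, are a prop. -/
theorem riggedCrop_powTwo_isProp (hG : ∀ {m n : ℕ}, G m n → m = n) :
    (riggedCrop G R X).powTwo.IsProp :=
  powTwo_isProp (riggedCrop_endo hG) (riggedCrop_interchange hG)

end riggedCrop

end StrictProp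

/-! ### Block sums with an identity -/

theorem Realisation.val_powTwo_add {Q : PropData.{u}} {Y : Type} {M : Type v} [Monoid M]
    (S : Realisation Q Y M) {k l m n : ℕ} (f : Q.Hom (2 ^ k) (2 ^ l)) (h : Q.Hom (2 ^ m) (2 ^ n))
    {e : ℕ → Y} (he : Set.InjOn e (Set.Iio (2 ^ (k + m)))) :
    S.val (m := 2 ^ (k + m)) (n := 2 ^ (l + n)) (Q.powTwo.add f h) e =
      S.cols f (2 ^ m) e * S.rows h (2 ^ k) e := by
  rw [pow_add] at he
  exact (S.val_cast _ _ _ _).trans (S.val_kron f h he)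

namespace StrictProp

variable {Q : StrictProp.{u}}

/-- The block sums `id ⊕ f`, for `b = true`, and `f ⊕ id`, for `b = false`, which interpret the
control operators. -/
def ctl (Q : PropData.{u}) (b : Bool) {n : ℕ} (f : Q.Hom (2 ^ n) (2 ^ n)) :
    Q.Hom (2 ^ (1 + n)) (2 ^ (1 + n)) :=
  Q.cast (two_pow_add_self n) (two_pow_add_self n)
    (cond b (Q.add (Q.id (2 ^ n)) f) (Q.add f (Q.id (2 ^ n))))

theorem ctl_comp (b : Bool) {n : ℕ} (g f : Q.Hom (2 ^ n) (2 ^ n)) :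
    ctl Q.toPropData b (Q.comp g f) = Q.comp (ctl Q.toPropData b g) (ctl Q.toPropData b f) := by
  cases b
  · refine Eq.trans (congrArg (Q.cast _ _) ?_) (Q.cast_comp _ _ _ _ _)
    change Q.add (Q.comp g f) (Q.id _) = Q.comp (Q.add g (Q.id _)) (Q.add f (Q.id _))
    rw [← Q.isProp.add_comp, Q.isProp.id_comp]
  · refine Eq.trans (congrArg (Q.cast _ _) ?_) (Q.cast_comp _ _ _ _ _)
    change Q.add (Q.id _) (Q.comp g f) = Q.comp (Q.add (Q.id _) g) (Q.add (Q.id _) f)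
    rw [← Q.isProp.add_comp, Q.isProp.id_comp]

theorem ctl_id (b : Bool) (n : ℕ) : ctl Q.toPropData b (Q.id (2 ^ n)) = Q.id (2 ^ (1 + n)) := by
  cases b
  all_goals
    exact (congrArg (Q.cast _ _) (Q.isProp.add_id _ _)).trans (Q.cast_id _ _)

theorem ctl_false_comp_ctl_true {n : ℕ} (f g : Q.Hom (2 ^ n) (2 ^ n)) :
    Q.comp (ctl Q.toPropData false f) (ctl Q.toPropData true g) =
      Q.cast (two_pow_add_self n) (two_pow_add_self n) (Q.add f g) := by
  refine (Q.cast_comp _ _ _ _ _).symm.trans (congrArg (Q.cast _ _) ?_)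
  change Q.comp (Q.add f (Q.id _)) (Q.add (Q.id _) g) = _
  rw [← Q.isProp.add_comp, Q.isProp.id_comp, Q.isProp.comp_id]

theorem ctl_true_comp_ctl_false {n : ℕ} (f g : Q.Hom (2 ^ n) (2 ^ n)) :
    Q.comp (ctl Q.toPropData true g) (ctl Q.toPropData false f) =
      Q.cast (two_pow_add_self n) (two_pow_add_self n) (Q.add f g) := by
  refine (Q.cast_comp _ _ _ _ _).symm.trans (congrArg (Q.cast _ _) ?_)
  change Q.comp (Q.add (Q.id _) g) (Q.add f (Q.id _)) = _
  rw [← Q.isProp.add_comp, Q.isProp.id_comp, Q.isProp.comp_id]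

end StrictProp

namespace Realisation

variable {Q : PropData.{u}} {Y : Type} {M : Type v} [Monoid M] (S : Realisation Q Y M)

theorem val_ctl_true {n : ℕ} (f : Q.Hom (2 ^ n) (2 ^ n)) {e : ℕ → Y}
    (he : Set.InjOn e (Set.Iio (2 ^ (1 + n)))) :
    S.val (StrictProp.ctl Q true f) e = S.val f fun i => e (2 ^ n + i) := by
  rw [← two_pow_add_self] at he
  refine (S.val_cast _ _ _ _).trans ((S.val_add _ _ he).trans ?_)
  rw [S.val_id (injOn_left he), one_mul]

theorem val_ctl_false {n : ℕ} (f : Q.Hom (2 ^ n) (2 ^ n)) {e : ℕ → Y}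
    (he : Set.InjOn e (Set.Iio (2 ^ (1 + n)))) :
    S.val (StrictProp.ctl Q false f) e = S.val f e := by
  rw [← two_pow_add_self] at he
  refine (S.val_cast _ _ _ _).trans ((S.val_add _ _ he).trans ?_)
  rw [S.val_id (injOn_shift he le_rfl), mul_one]

theorem cols_ctl_true {n m : ℕ} (f : Q.Hom (2 ^ n) (2 ^ n)) {e : ℕ → Y}
    (he : Set.InjOn e (Set.Iio (2 ^ (1 + n) * m))) :
    S.cols (StrictProp.ctl Q true f) m e = S.cols f m fun i => e (2 ^ n * m + i) := by
  refine seqProd_congr fun j hj => (S.val_ctl_true f (injOn_col he hj)).trans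
    (S.val_congr _ fun i _ => congrArg e ?_)
  ring

end Realisation

namespace StrictProp

variable {Q : StrictProp.{u}}

theorem ctl_strength (hQ : ∀ {m n : ℕ}, Q.Hom m n → m = n) {n : ℕ} (m : ℕ)
    (f : Q.Hom (2 ^ n) (2 ^ n)) :
    ctl Q.toPropData true (n := n + m) (Q.powTwo.add f (Q.id (2 ^ m))) =
      Q.cast (congrArg (2 ^ ·) (Nat.add_assoc 1 n m)) (congrArg (2 ^ ·) (Nat.add_assoc 1 n m))
        (Q.powTwo.add (ctl Q.toPropData true f) (Q.id (2 ^ m))) := by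
  refine hom_ext hQ (by positivity) fun e he => ?_
  have he1 : Set.InjOn e (Set.Iio (2 ^ (1 + n + m))) := by rwa [Nat.add_assoc]
  have he2 : Set.InjOn e (Set.Iio (2 ^ (1 + n) * 2 ^ m)) := by rwa [← pow_add]
  have he3 : Set.InjOn (fun i => e (2 ^ (n + m) + i)) (Set.Iio (2 ^ (n + m))) :=
    Realisation.injOn_shift he (two_pow_add_self _).le
  have he4 : Set.InjOn (fun i => e (2 ^ (n + m) + i)) (Set.Iio (2 ^ n * 2 ^ m)) := by
    rwa [← pow_add]
  refine (Realisation.val_ctl_true _ _ he).trans (Eq.trans ?_ (Realisation.val_cast _ _ _ _ _).symm)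
  refine (Realisation.val_powTwo_add _ f (Q.id (2 ^ m)) he3).trans
    (Eq.trans ?_ (Realisation.val_powTwo_add _ (ctl Q.toPropData true f) (Q.id (2 ^ m)) he1).symm)
  rw [Realisation.rows_id _ he4, Realisation.rows_id _ he2, mul_one, mul_one,
    Realisation.cols_ctl_true _ _ he2, ← pow_add]

theorem ctl_complementarity (hQ : ∀ {m n : ℕ}, Q.Hom m n → m = n) {n : ℕ}
    (f : Q.Hom (2 ^ n) (2 ^ n)) :
    Q.comp (ctl Q.toPropData false f) (ctl Q.toPropData true f) =
      Q.powTwo.add (Q.id (2 ^ 1)) f := by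
  refine hom_ext hQ (by positivity) fun e he => ?_
  have he2 : Set.InjOn e (Set.Iio (2 ^ 1 * 2 ^ n)) := by rwa [← pow_add]
  refine Eq.trans ?_ (Realisation.val_powTwo_add _ (Q.id (2 ^ 1)) f he).symm
  rw [Realisation.val_comp _ _ _ he, Realisation.val_ctl_true _ _ he,
    Realisation.val_ctl_false _ _ he, Realisation.cols_id _ he2, one_mul]
  change _ = Realisation.rows _ f (1 + 1) e
  rw [Realisation.rows_add, Realisation.rows_one, Realisation.rows_one, Nat.one_mul]

/-- The tensor product of the symmetry `γ_{1,1}` with the identity of `2 ^ n` is the symmetry of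
the two halves of `2 ^ (1 + n)`. -/
theorem not_add_id (hQ : ∀ {m n : ℕ}, Q.Hom m n → m = n) (n : ℕ) :
    Q.powTwo.add (Q.cast (pow_one 2).symm (pow_one 2).symm (Q.swap 1 1)) (Q.id (2 ^ n)) =
      Q.cast (two_pow_add_self n) (two_pow_add_self n) (Q.swap (2 ^ n) (2 ^ n)) := by
  have h1 : Q.IsPermMor (Q.cast (pow_one 2).symm (pow_one 2).symm (Q.swap 1 1)) (swapFun 1 1) :=
    IsPermMor.cast _ _ (Q.swap_isPermMor 1 1)
  refine ((IsPermMor.cast _ _ (h1.kron hQ (IsPermMor.id (2 ^ n)) (by positivity)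
    (by positivity))).congr ?_).eq (IsPermMor.cast _ _ (Q.swap_isPermMor _ _))
  rw [show 2 ^ (1 + n) = 2 * 2 ^ n by ring]
  refine Realisation.forall_grid fun a ha b hb => ?_
  rw [Realisation.div_grid hb, Realisation.mod_grid hb]
  interval_cases a
  · simp [swapFun, hb]
  · simp [swapFun]

theorem ctl_colour (hQ : ∀ {m n : ℕ}, Q.Hom m n → m = n) {n : ℕ} (f : Q.Hom (2 ^ n) (2 ^ n))
    {x : Q.Hom (2 ^ 1) (2 ^ 1)}
    (hx : x = Q.cast (pow_one 2).symm (pow_one 2).symm (Q.swap 1 1)) :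
    Q.powTwo.comp (Q.powTwo.add x (Q.id (2 ^ n)))
      (Q.powTwo.comp (m := 1 + n) (n := 1 + n) (ctl Q.toPropData false f)
        (Q.powTwo.add x (Q.id (2 ^ n)))) = ctl Q.toPropData true f := by
  rw [hx, not_add_id hQ]
  change Q.comp (Q.cast _ _ _) (Q.comp (Q.cast _ _ (Q.add f (Q.id _))) (Q.cast _ _ _)) =
    Q.cast _ _ (Q.add (Q.id _) f)
  rw [← Q.cast_comp, ← Q.cast_comp, ← Q.isProp.comp_assoc, Q.isProp.swap_natural,
    Q.isProp.comp_assoc, Q.isProp.swap_swap, Q.isProp.comp_id]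

theorem IsPermMor.ctl_true {n : ℕ} {f : Q.Hom (2 ^ n) (2 ^ n)} {p : ℕ → ℕ}
    (hf : Q.IsPermMor f p) :
    Q.IsPermMor (ctl Q.toPropData true f) fun i => if i < 2 ^ n then i else 2 ^ n + p (i - 2 ^ n) :=
  IsPermMor.cast _ _ ((IsPermMor.id _).add hf)

theorem powTwo_swap_isPermMor (hQ : ∀ {m n : ℕ}, Q.Hom m n → m = n) (m n : ℕ) :
    Q.IsPermMor (a := 2 ^ (m + n)) (b := 2 ^ (n + m)) (Q.powTwo.swap m n)
      fun i => i % 2 ^ n * 2 ^ m + i / 2 ^ n :=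
  IsPermMor.cast _ _ (mulSwap_isPermMor hQ (by positivity) (by positivity))

theorem ctl_swap_eq (hQ : ∀ {m n : ℕ}, Q.Hom m n → m = n) {x : Q.Hom (2 ^ 1) (2 ^ 1)}
    (hx : x = Q.cast (pow_one 2).symm (pow_one 2).symm (Q.swap 1 1)) :
    Q.powTwo.comp (m := 1 + 1) (n := 1 + 1) (ctl Q.toPropData true x)
      (Q.powTwo.comp (Q.powTwo.swap 1 1) (Q.powTwo.comp (ctl Q.toPropData true x)
        (Q.powTwo.comp (Q.powTwo.swap 1 1) (ctl Q.toPropData true x)))) = Q.powTwo.swap 1 1 := by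
  have h1 : Q.IsPermMor x (swapFun 1 1) := by
    rw [hx]
    exact IsPermMor.cast _ _ (Q.swap_isPermMor 1 1)
  have h2 := h1.ctl_true (n := 1)
  have h3 := powTwo_swap_isPermMor hQ 1 1
  refine ((h2.comp (h3.comp (h2.comp (h3.comp h2)))).congr fun i hi => ?_).eq h3
  change i < 4 at hi
  interval_cases i <;> rfl

theorem ctl_swap_coherence (hQ : ∀ {m n : ℕ}, Q.Hom m n → m = n) {n : ℕ}
    (f : Q.Hom (2 ^ n) (2 ^ n)) :
    Q.comp
        (Q.cast (congrArg (2 ^ ·) (Nat.add_assoc 1 1 n)) (congrArg (2 ^ ·) (Nat.add_assoc 1 1 n))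
          (Q.powTwo.add (Q.powTwo.swap 1 1) (Q.id (2 ^ n))))
        (ctl Q.toPropData true (ctl Q.toPropData true f)) =
      Q.comp (ctl Q.toPropData true (ctl Q.toPropData true f))
        (Q.cast (congrArg (2 ^ ·) (Nat.add_assoc 1 1 n)) (congrArg (2 ^ ·) (Nat.add_assoc 1 1 n))
          (Q.powTwo.add (Q.powTwo.swap 1 1) (Q.id (2 ^ n)))) := by
  refine hom_ext hQ (by positivity) fun e he => ?_
  have hs : Q.IsPermMor (Q.cast (congrArg (2 ^ ·) (Nat.add_assoc 1 1 n))
      (congrArg (2 ^ ·) (Nat.add_assoc 1 1 n))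
      (Q.powTwo.add (Q.powTwo.swap 1 1) (Q.id (2 ^ n)))) _ :=
    IsPermMor.cast _ _ (IsPermMor.cast _ _ ((powTwo_swap_isPermMor hQ 1 1).kron hQ
      (IsPermMor.id (2 ^ n)) (by positivity) (by positivity)))
  obtain ⟨σ, hσ⟩ := exists_along he _ (fun i hi => hs.lt hi) fun i hi j hj h => hs.inj hi hj h
  have hv : ∀ e : ℕ → Fin (2 ^ (1 + (1 + n))), Set.InjOn e (Set.Iio (2 ^ (1 + (1 + n)))) →
      (Q.selfRealisation hQ _).val (ctl Q.toPropData true (ctl Q.toPropData true f)) e =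
        (Q.selfRealisation hQ _).val f fun i => e (3 * 2 ^ n + i) := by
    intro e he
    rw [Realisation.val_ctl_true _ _ he,
      Realisation.val_ctl_true _ _ (Realisation.injOn_shift he (two_pow_add_self _).le)]
    refine Realisation.val_congr _ _ fun i _ => congrArg e ?_
    ring
  have hN : 2 ^ (1 + (1 + n)) = 3 * 2 ^ n + 2 ^ n := by ring
  rw [Realisation.val_comp _ _ _ he, Realisation.val_comp _ _ _ he, hv e he]
  have hp : (Q.selfRealisation hQ _).val (Q.cast (congrArg (2 ^ ·) (Nat.add_assoc 1 1 n))
      (congrArg (2 ^ ·) (Nat.add_assoc 1 1 n))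
      (Q.powTwo.add (Q.powTwo.swap 1 1) (Q.id (2 ^ n)))) e =
        (Q.selfRealisation hQ _).perm σ := hs.selfVal_eq he hσ
  rw [hp]
  have := (Q.selfRealisation hQ _).val_conj f
    (Realisation.injOn_shift he (a := 3 * 2 ^ n) hN.ge) σ
  rw [Realisation.val_congr _ f (e := fun i => σ (e (3 * 2 ^ n + i)))
    (e' := fun i => e (3 * 2 ^ n + i)) fun i hi => ?_] at this
  · exact this.eq
  · rw [hσ.1 _ (by omega)]
    beta_reduce
    rw [Realisation.div_grid hi, Realisation.mod_grid hi]
    rfl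

end StrictProp

/-! ### The map from the controlled prop to the rigged crop -/

namespace PropPresentation

variable {P : ControllableProp.{u}} (D : PropPresentation.{u, v} P.toStrictProp)
  (X : PropTerm D.Gen 1 1)

theorem gen_endo {m n : ℕ} (g : D.Gen m n) : m = n := P.endo (D.interp m n g)

/-- The rigged crop of a presented controllable prop. -/
abbrev rig : StrictProp.{v} := riggedCrop D.Gen D.Rel X

theorem rig_endo {m n : ℕ} (f : (D.rig X).Hom m n) : m = n :=
  StrictProp.riggedCrop_endo D.gen_endo f

theorem rig_powTwo_isProp : (D.rig X).powTwo.IsProp :=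
  StrictProp.riggedCrop_powTwo_isProp D.gen_endo

/-- The value in the rigged crop of an expression over the generators. -/
abbrev rigEval {m n : ℕ} (t : PropTerm D.Gen m n) : (D.rig X).powTwo.Hom m n :=
  t.eval (D.rig X).powTwo fun _ _ g => riggedGen D.Rel X g

/-- Expressions with the same value in the base prop have the same value in the rigged crop. -/
theorem rigEval_eq {m n : ℕ} {s t : PropTerm D.Gen m n}
    (h : s.eval P.toPropData D.interp = t.eval P.toPropData D.interp) :
    D.rigEval X s = D.rigEval X t := by
  refine ((D.eval_eq_iff s t).1 h).eval_eq (D.rig_powTwo_isProp X) _ fun m n s t h => ?_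
  rw [← StrictProp.mk_tilde, ← StrictProp.mk_tilde]
  exact Quotient.sound (PropTerm.Cong.rel (RigRel.base h))

theorem rigEval_not : D.rigEval X X =
    (D.rig X).cast (pow_one 2).symm (pow_one 2).symm ((D.rig X).swap 1 1) := by
  unfold rigEval
  rw [← StrictProp.mk_tilde]
  exact (Quotient.sound (PropTerm.Cong.rel RigRel.not)).trans
    ((presentedMap _ _).map_cast (pow_one 2).symm (pow_one 2).symm (PropTerm.swap 1 1))

/-- The map `f ↦ f̃` from the base prop to the rigged crop. -/
noncomputable def baseMap : P.toPropData.Map (D.rig X).powTwo where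
  map f := D.rigEval X (D.surjective f).choose
  map_id n := D.rigEval_eq X (t := .id n) (D.surjective _).choose_spec
  map_comp g f :=
    D.rigEval_eq X (t := .comp (D.surjective g).choose (D.surjective f).choose) <|
      (D.surjective _).choose_spec.trans <|
        congrArg₂ P.comp (D.surjective g).choose_spec.symm (D.surjective f).choose_spec.symm
  map_add f g :=
    D.rigEval_eq X (t := .add (D.surjective f).choose (D.surjective g).choose) <|
      (D.surjective _).choose_spec.trans <|
        congrArg₂ P.add (D.surjective f).choose_spec.symm (D.surjective g).choose_spec.symm
  map_swap m n := D.rigEval_eq X (t := .swap m n) (D.surjective _).choose_spec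

theorem baseMap_eval {m n : ℕ} (t : PropTerm D.Gen m n) :
    (D.baseMap X).map (t.eval P.toPropData D.interp) = D.rigEval X t :=
  D.rigEval_eq X (t := t) (D.surjective _).choose_spec

/-- The value in the rigged crop of an expression of the controlled prop: control operators become
block sums with an identity. -/
noncomputable def ctrlEval : ∀ {m n : ℕ}, CtrlTerm P.toPropData m n → (D.rig X).powTwo.Hom m n
  | _, _, .of f => (D.baseMap X).map f
  | _, _, .id n => (D.rig X).powTwo.id n
  | _, _, .comp g f => (D.rig X).powTwo.comp (ctrlEval g) (ctrlEval f)
  | _, _, .add f g => (D.rig X).powTwo.add (ctrlEval f) (ctrlEval g)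
  | _, _, .swap m n => (D.rig X).powTwo.swap m n
  | _, _, .ctrl b f => StrictProp.ctl (D.rig X).toPropData b (ctrlEval f)

theorem ctrlEval_cast {m m' n n' : ℕ} (hm : m = m') (hn : n = n')
    (f : CtrlTerm P.toPropData m n) :
    D.ctrlEval X ((CtrlTerm.data P.toPropData).cast hm hn f) =
      (D.rig X).powTwo.cast hm hn (D.ctrlEval X f) := by
  subst hm hn; rfl

/-- The laws of a prop and the control equations hold for the values in the rigged crop. -/
theorem ctrlEval_eq (hX : X.eval P.toPropData D.interp = P.x) {m n : ℕ}
    {s t : CtrlTerm P.toPropData m n} (h : CtrlTerm.Cong P s t) :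
    D.ctrlEval X s = D.ctrlEval X t := by
  have hQ := D.rig_powTwo_isProp X
  have hx : (D.baseMap X).map P.x =
      (D.rig X).cast (pow_one 2).symm (pow_one 2).symm ((D.rig X).swap 1 1) := by
    rw [← hX, baseMap_eval, rigEval_not]
  induction h with
  | refl s => rfl
  | symm _ ih => exact ih.symm
  | trans _ _ h1 h2 => exact h1.trans h2
  | comp_congr _ _ h1 h2 => exact congrArg₂ (D.rig X).powTwo.comp h1 h2
  | add_congr _ _ h1 h2 => exact congrArg₂ (D.rig X).powTwo.add h1 h2
  | ctrl_congr b _ ih => exact congrArg (StrictProp.ctl (D.rig X).toPropData b) ih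
  | id_comp f => exact hQ.id_comp _
  | comp_id f => exact hQ.comp_id _
  | comp_assoc h g f => exact hQ.comp_assoc _ _ _
  | add_id m n => exact hQ.add_id m n
  | add_comp g f g' f' => exact hQ.add_comp _ _ _ _
  | add_assoc f g h => exact (D.ctrlEval_cast X _ _ _).trans (hQ.add_assoc _ _ _)
  | zero_add f => exact (D.ctrlEval_cast X _ _ _).trans (hQ.zero_add _)
  | add_zero f => exact (D.ctrlEval_cast X _ _ _).trans (hQ.add_zero _)
  | swap_natural f g => exact hQ.swap_natural _ _
  | swap_swap m n => exact hQ.swap_swap m n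
  | swap_add k m n =>
    rw [ctrlEval_cast]
    simp only [ctrlEval, ctrlEval_cast]
    exact hQ.swap_add k m n
  | of_id n => exact (D.baseMap X).map_id n
  | of_comp g f => exact (D.baseMap X).map_comp g f
  | of_add f g => exact (D.baseMap X).map_add f g
  | of_swap m n => exact (D.baseMap X).map_swap m n
  | composition g f => exact StrictProp.ctl_comp true _ _
  | identity n => exact StrictProp.ctl_id true n
  | strength m f =>
    refine (StrictProp.ctl_strength (D.rig_endo X) m (D.ctrlEval X f)).trans ?_
    exact ((D.ctrlEval_cast X _ _ (.add (.ctrl true f) (.id m))).trans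
      (StrictProp.powTwo_cast _ _ _ _)).symm
  | colour f => exact StrictProp.ctl_colour (D.rig_endo X) (D.ctrlEval X f) hx
  | complementarity f => exact StrictProp.ctl_complementarity (D.rig_endo X) (D.ctrlEval X f)
  | commutativity f₁ f₂ =>
    have hg := StrictProp.ctl_true_comp_ctl_false (Q := D.rig X) (D.ctrlEval X f₁) (D.ctrlEval X f₂)
    exact (StrictProp.ctl_false_comp_ctl_true _ _).trans hg.symm
  | swap_eq => exact StrictProp.ctl_swap_eq (D.rig_endo X) hx
  | @swap_coherence n f =>
    have h1 : D.ctrlEval X ((CtrlTerm.data P.toPropData).cast (Nat.add_assoc 1 1 n)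
        (Nat.add_assoc 1 1 n) (.add (.swap 1 1) (.id n))) =
        (D.rig X).cast (congrArg (2 ^ ·) (Nat.add_assoc 1 1 n))
          (congrArg (2 ^ ·) (Nat.add_assoc 1 1 n))
          ((D.rig X).powTwo.add ((D.rig X).powTwo.swap 1 1) ((D.rig X).id (2 ^ n))) :=
      (D.ctrlEval_cast X _ _ _).trans (StrictProp.powTwo_cast _ _ _ _)
    refine (congrArg (fun z => (D.rig X).powTwo.comp z _) h1).trans (Eq.trans ?_
      (congrArg (fun z => (D.rig X).powTwo.comp _ z) h1).symm)
    exact StrictProp.ctl_swap_coherence (D.rig_endo X) (D.ctrlEval X f)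

/-- The map from the controlled prop to the powers of `2` in the rigged crop. -/
noncomputable def ctrlMap (hX : X.eval P.toPropData D.interp = P.x) :
    P.controlled.Map (D.rig X).powTwo where
  map := Quotient.lift (D.ctrlEval X) fun _ _ h => D.ctrlEval_eq X hX h
  map_id _ := rfl
  map_comp := by rintro l m n ⟨g⟩ ⟨f⟩; rfl
  map_add := by rintro k l m n ⟨f⟩ ⟨g⟩; rfl
  map_swap _ _ := rfl

variable (hX : X.eval P.toPropData D.interp = P.x)

theorem ctrlMap_toControlled {m n : ℕ} (t : PropTerm D.Gen m n) :
    (D.ctrlMap X hX).map (P.toControlled (t.eval P.toPropData D.interp)) = D.rigEval X t :=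
  D.baseMap_eval X t

theorem ctrlMap_C (b : Bool) {n : ℕ} (f : P.controlled.Hom n n) :
    (D.ctrlMap X hX).map (P.C b f) =
      StrictProp.ctl (D.rig X).toPropData b ((D.ctrlMap X hX).map f) := by
  obtain ⟨f⟩ := f
  rfl

end PropPresentation

/-! ### The controlled prop as a tower of monoids -/

namespace ControllableProp

variable (P : ControllableProp.{u})

theorem C_true_mul {n : ℕ} (g f : P.controlled.End n) :
    P.C true (g * f) = (P.C true g * P.C true f : P.controlled.End (1 + n)) := by
  obtain ⟨g⟩ := g
  obtain ⟨f⟩ := f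
  exact Quotient.sound (.composition g f)

theorem C_true_one (n : ℕ) : P.C true (1 : P.controlled.End n) = (1 : P.controlled.End (1 + n)) :=
  Quotient.sound (.identity n)

theorem C_true_inl {n : ℕ} (m : ℕ) (f : P.controlled.End n) :
    P.C true (P.controlled.inl m f) =
      P.controlled.castEnd (Nat.add_assoc 1 n m) (P.controlled.inl m (P.C true f)) := by
  obtain ⟨f⟩ := f
  exact (Quotient.sound (CtrlTerm.Cong.strength m f)).trans (controlledData_cast_mk P _ _ _).symm

/-- The involution on the first of `1 + n` wires. -/
abbrev notFirst (n : ℕ) : P.controlled.End (1 + n) := P.controlled.inl n P.controlled.x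

theorem notFirst_mul_self (n : ℕ) : P.notFirst n * P.notFirst n = 1 := by
  rw [← map_mul]
  exact (congrArg (P.controlled.inl n) P.controlled.x_involutive).trans (map_one _)

theorem C_colour {n : ℕ} (f : P.controlled.End n) :
    P.notFirst n * (P.C false f * P.notFirst n) = P.C true f := by
  obtain ⟨f⟩ := f
  exact Quotient.sound (.colour f)

theorem C_false_eq {n : ℕ} (f : P.controlled.End n) :
    P.C false f = P.notFirst n * P.C true f * P.notFirst n := by
  rw [← C_colour]
  calc P.C false f = (1 : P.controlled.End (1 + n)) * P.C false f * 1 := by rw [one_mul, mul_one]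
    _ = _ := by rw [← notFirst_mul_self]; simp only [mul_assoc]

theorem C_false_mul_C_true {n : ℕ} (f : P.controlled.End n) :
    (P.C false f * P.C true f : P.controlled.End (1 + n)) = P.controlled.inr 1 f := by
  obtain ⟨f⟩ := f
  exact Quotient.sound (.complementarity f)

theorem C_comm {n : ℕ} (f g : P.controlled.End n) :
    Commute (P.C false f : P.controlled.End (1 + n)) (P.C true g) := by
  obtain ⟨f⟩ := f
  obtain ⟨g⟩ := g
  exact Quotient.sound (.commutativity f g)

theorem C_swap_eq : (P.C true P.controlled.x * (P.controlled.sw * (P.C true P.controlled.x *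
    (P.controlled.sw * P.C true P.controlled.x))) : P.controlled.End 2) = P.controlled.sw :=
  Quotient.sound .swap_eq

theorem C_swap_coherence {n : ℕ} (f : P.controlled.End n) :
    Commute (P.controlled.castEnd (Nat.add_assoc 1 1 n) (P.controlled.inl n P.controlled.sw))
      (P.C true (P.C true f)) := by
  obtain ⟨f⟩ := f
  have h : P.controlled.castEnd (Nat.add_assoc 1 1 n) (P.controlled.inl n P.controlled.sw) =
      Quotient.mk _ ((CtrlTerm.data P.toPropData).cast (Nat.add_assoc 1 1 n) (Nat.add_assoc 1 1 n)
        (.add (.swap 1 1) (.id n))) := controlledData_cast_mk P _ _ _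
  rw [h]
  exact Quotient.sound (.swap_coherence f)

/-- The control operators as homomorphisms. -/
def CHom (b : Bool) (n : ℕ) : P.controlled.End n →* P.controlled.End (1 + n) where
  toFun := P.C b
  map_one' := by
    cases b
    · rw [C_false_eq, C_true_one, mul_one, notFirst_mul_self]
    · exact P.C_true_one n
  map_mul' g f := by
    cases b
    · rw [C_false_eq, C_false_eq, C_false_eq, C_true_mul]
      calc P.notFirst n * (P.C true g * P.C true f : P.controlled.End (1 + n)) * P.notFirst n
          = P.notFirst n * P.C true g * 1 * P.C true f * P.notFirst n := by
            simp only [mul_assoc, one_mul]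
        _ = _ := by rw [← notFirst_mul_self]; simp only [mul_assoc]
    · exact P.C_true_mul g f

theorem C_castEnd (b : Bool) {m n : ℕ} (h : m = n) (h' : 1 + m = 1 + n) (f : P.controlled.End m) :
    P.C b (P.controlled.castEnd h f) = P.controlled.castEnd h' (P.C b f) := by
  subst h; rfl

/-- Control by a new first wire, with values in the endomorphisms of `n + 1`. -/
def towerC (b : Bool) {n : ℕ} : P.controlled.End n →* P.controlled.End (n + 1) :=
  (P.controlled.castEnd (Nat.add_comm 1 n)).comp (P.CHom b n)

theorem towerC_apply (b : Bool) {n : ℕ} (f : P.controlled.End n) :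
    P.towerC b f = P.controlled.castEnd (Nat.add_comm 1 n) (P.C b f) := rfl

/-- The involution on the first wire. -/
def towerX (n : ℕ) : P.controlled.End (n + 1) :=
  P.controlled.castEnd (Nat.add_comm 1 n) (P.notFirst n)

/-- The symmetry of the first two wires. -/
def towerT (n : ℕ) : P.controlled.End (n + 2) :=
  P.controlled.castEnd (Nat.add_comm 2 n) (P.controlled.inl n P.controlled.sw)

theorem towerC_false_mul_true {n : ℕ} (f : P.controlled.End n) :
    P.towerC false f * P.towerC true f =
      P.controlled.castEnd (Nat.add_comm 1 n) (P.controlled.inr 1 f) := by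
  rw [towerC_apply, towerC_apply, ← map_mul, C_false_mul_C_true]

theorem towerX_mul_self (n : ℕ) : P.towerX n * P.towerX n = 1 := by
  rw [towerX, ← map_mul, notFirst_mul_self, map_one]

theorem towerX_C {n : ℕ} (f : P.controlled.End n) :
    P.towerX n * P.towerC true f * P.towerX n = P.towerC false f := by
  rw [towerX, towerC_apply, towerC_apply, ← map_mul, ← map_mul, C_false_eq]

theorem towerT_mul_self (n : ℕ) : P.towerT n * P.towerT n = 1 := by
  rw [towerT, ← map_mul, ← map_mul, P.controlled.sw_mul_sw, map_one, map_one]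

theorem towerX_succ (n : ℕ) : P.towerX (n + 1) = P.controlled.castEnd (Nat.add_comm 2 n)
    (P.controlled.inl n (P.controlled.inl 1 P.controlled.x)) := by
  have h1 := P.controlled.castEnd_inl_inl (Nat.add_assoc 1 1 n) P.controlled.x
  have h2 := P.controlled.castEnd_inl_congr (Nat.add_comm 1 n)
    (show 1 + (1 + n) = 1 + (n + 1) by omega) P.controlled.x
  rw [towerX, notFirst, ← h2, ← h1, P.controlled.castEnd_castEnd, P.controlled.castEnd_castEnd]

theorem towerT_succ (n : ℕ) : P.towerT (n + 1) = P.controlled.castEnd (Nat.add_comm 3 n)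
    (P.controlled.inl n (P.controlled.inl 1 P.controlled.sw)) := by
  have h1 := P.controlled.castEnd_inl_inl (Nat.add_assoc 2 1 n) P.controlled.sw
  have h2 := P.controlled.castEnd_inl_congr (Nat.add_comm 1 n)
    (show 2 + (1 + n) = 2 + (n + 1) by omega) P.controlled.sw
  rw [towerT, ← h2, ← h1, P.controlled.castEnd_castEnd, P.controlled.castEnd_castEnd]

theorem castEnd_inr_one_castEnd_inl {m n a b : ℕ} (h : m + n = a) (h' : 1 + a = b)
    (h'' : 1 + m + n = b) (f : P.controlled.End m) :
    P.controlled.castEnd h' (P.controlled.inr 1 (P.controlled.castEnd h (P.controlled.inl n f))) =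
      P.controlled.castEnd h'' (P.controlled.inl n (P.controlled.inr 1 f)) := by
  subst h h'
  exact (P.controlled.castEnd_inl_inr h'' f).symm

/-- The exchange of the first two wires takes the involution on the second wire to the one on the
first. -/
theorem towerT_X (n : ℕ) :
    P.towerT n * (P.towerC false (P.towerX n) * P.towerC true (P.towerX n)) * P.towerT n =
      P.towerX (n + 1) := by
  have h : (P.controlled.sw * P.controlled.inr 1 P.controlled.x : P.controlled.End 2) =
      P.controlled.inl 1 P.controlled.x * P.controlled.sw :=
    P.controlled.isProp.swap_natural (P.controlled.id 1) P.controlled.x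
  rw [towerC_false_mul_true, towerX,
    P.castEnd_inr_one_castEnd_inl (m := 1) _ _ (Nat.add_comm 2 n), towerT, ← map_mul, ← map_mul,
    ← map_mul, ← map_mul, h, mul_assoc, P.controlled.sw_mul_sw, mul_one, ← towerX_succ]

theorem towerC_comm {n : ℕ} (f g : P.controlled.End n) :
    Commute (P.towerC false f) (P.towerC true g) :=
  (P.C_comm f g).map (P.controlled.castEnd (Nat.add_comm 1 n))

theorem towerT_C_true {n : ℕ} (f : P.controlled.End n) :
    P.towerT n * P.towerC true (P.towerC true f) * P.towerT n =
      P.towerC true (P.towerC true f) := by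
  have h1 : P.towerC true (P.towerC true f) =
      P.controlled.castEnd (by omega) (P.C true (P.C true f)) := by
    rw [towerC_apply, towerC_apply, P.C_castEnd true _ (by omega), P.controlled.castEnd_castEnd]
  have h2 : P.towerT n = P.controlled.castEnd (show 1 + (1 + n) = n + 2 by omega)
      (P.controlled.castEnd (Nat.add_assoc 1 1 n) (P.controlled.inl n P.controlled.sw)) := by
    rw [P.controlled.castEnd_castEnd]; rfl
  have h3 := (P.C_swap_coherence f).map (P.controlled.castEnd (show 1 + (1 + n) = n + 2 by omega))
  rw [← h1, ← h2] at h3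
  rw [h3.eq, mul_assoc, towerT_mul_self, mul_one]

/-- The involution on the second wire conjugates controlled operations by the involution on their
first wire. -/
theorem towerX_second_conj {n : ℕ} (b : Bool) (g : P.controlled.End (n + 1)) :
    (P.towerC false (P.towerX n) * P.towerC true (P.towerX n)) * P.towerC b g *
      (P.towerC false (P.towerX n) * P.towerC true (P.towerX n)) =
      P.towerC b (P.towerX n * g * P.towerX n) := by
  have hx : ∀ b, P.towerC b (P.towerX n) * P.towerC b (P.towerX n) = 1 := fun b => by
    rw [← map_mul, towerX_mul_self, map_one]
  cases b
  · rw [map_mul, map_mul, (P.towerC_comm (P.towerX n) (P.towerX n)).eq]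
    calc P.towerC true (P.towerX n) * P.towerC false (P.towerX n) * P.towerC false g *
          (P.towerC true (P.towerX n) * P.towerC false (P.towerX n))
        = P.towerC true (P.towerX n) * (P.towerC false (P.towerX n) * P.towerC false g *
          P.towerC true (P.towerX n)) * P.towerC false (P.towerX n) := by simp only [mul_assoc]
      _ = _ := by
        rw [← map_mul (P.towerC false), (P.towerC_comm (P.towerX n * g) (P.towerX n)).eq,
          ← mul_assoc, hx, one_mul, map_mul]
  · rw [map_mul, map_mul]
    calc P.towerC false (P.towerX n) * P.towerC true (P.towerX n) * P.towerC true g *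
          (P.towerC false (P.towerX n) * P.towerC true (P.towerX n))
        = P.towerC false (P.towerX n) * (P.towerC true (P.towerX n) * P.towerC true g) *
          P.towerC false (P.towerX n) * P.towerC true (P.towerX n) := by simp only [mul_assoc]
      _ = _ := by
        rw [← map_mul (P.towerC true), (P.towerC_comm (P.towerX n) (P.towerX n * g)).eq,
          mul_assoc (P.towerC true _), hx, mul_one, map_mul]

/-- The exchange of the first two wires exchanges controls on them. For two positive controls this
is the coherence equation; the other cases follow by conjugating with the involutions on the two
wires. -/
theorem towerT_C {n : ℕ} (b c : Bool) (f : P.controlled.End n) :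
    P.towerT n * P.towerC b (P.towerC c f) * P.towerT n = P.towerC c (P.towerC b f) := by
  let φ := conjInvolution (P.towerT n) (P.towerT_mul_self n)
  have hφφ : ∀ y, φ (φ y) = y := fun y => ControlTower.conjInvolution_conj _ _ y
  have h2 : φ (P.towerC false (P.towerX n) * P.towerC true (P.towerX n)) = P.towerX (n + 1) :=
    P.towerT_X n
  have h3 : φ (P.towerX (n + 1)) =
      P.towerC false (P.towerX n) * P.towerC true (P.towerX n) := by rw [← h2, hφφ]
  have htt : ∀ f : P.controlled.End n, φ (P.towerC true (P.towerC true f)) =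
      P.towerC true (P.towerC true f) := P.towerT_C_true
  have htf : ∀ f : P.controlled.End n, φ (P.towerC true (P.towerC false f)) =
      P.towerC false (P.towerC true f) := by
    intro f
    rw [← P.towerX_C f, ← towerX_second_conj, map_mul, map_mul, h2, htt, towerX_C]
  have hft : ∀ f : P.controlled.End n, φ (P.towerC false (P.towerC true f)) =
      P.towerC true (P.towerC false f) := fun f => by rw [← htf, hφφ]
  change φ _ = _
  cases b <;> cases c
  · rw [← P.towerX_C (P.towerC false f), map_mul, map_mul, h3, htf, towerX_second_conj, towerX_C]
    rw [towerX_C]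
  · exact hft f
  · exact htf f
  · exact htt f

theorem towerT_braid (n : ℕ) :
    (P.towerC false (P.towerT n) * P.towerC true (P.towerT n)) * P.towerT (n + 1) *
      (P.towerC false (P.towerT n) * P.towerC true (P.towerT n)) =
    P.towerT (n + 1) * (P.towerC false (P.towerT n) * P.towerC true (P.towerT n)) *
      P.towerT (n + 1) := by
  rw [towerC_false_mul_true, towerT_succ]
  rw [towerT, P.castEnd_inr_one_castEnd_inl (m := 2) _ _ (Nat.add_comm 3 n)]
  rw [← map_mul, ← map_mul, ← map_mul, ← map_mul, ← map_mul, ← map_mul, ← map_mul, ← map_mul,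
    P.controlled.sw_braid]

/-- The controlled involution with further wires added is the sum of the controlled involution with
their identity. -/
theorem towerC_X (n : ℕ) : P.towerC true (P.towerX n) = P.controlled.castEnd (Nat.add_comm 2 n)
    (P.controlled.inl n (P.C true P.controlled.x)) := by
  rw [towerC_apply, towerX, P.C_castEnd true _ (by omega), notFirst, C_true_inl,
    P.controlled.castEnd_castEnd, P.controlled.castEnd_castEnd]

/-- The exchange of the first two wires is a product of three controlled involutions. -/
theorem towerT_eq (n : ℕ) : P.towerC true (P.towerX n) * (P.towerT n * P.towerC true (P.towerX n) *
    P.towerT n) * P.towerC true (P.towerX n) = P.towerT n := by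
  rw [towerC_X, towerT, ← map_mul, ← map_mul, ← map_mul, ← map_mul, ← map_mul, ← map_mul,
    ← map_mul, ← map_mul]
  congr 2
  refine Eq.trans ?_ P.C_swap_eq
  simp only [mul_assoc]

/-- The endomorphism monoids of the controlled prop, with their control operators. -/
def tower : ControlTower P.controlled.End where
  C := P.towerC
  X := P.towerX
  T := P.towerT
  C_comm := P.towerC_comm
  X_mul_X := P.towerX_mul_self
  X_C := P.towerX_C
  T_mul_T := P.towerT_mul_self
  T_C := P.towerT_C
  T_X := P.towerT_X
  T_braid := P.towerT_braid
  T_eq := P.towerT_eq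

end ControllableProp

/-! ### Permutations of wires -/

namespace Bits

/-- The bits of a word, as a function of their position. -/
def get : ∀ n : ℕ, Bits n ≃ (Fin n → Bool)
  | 0 => ⟨fun _ => Fin.elim0, fun _ => (), fun _ => rfl, fun _ => Subsingleton.elim _ _⟩
  | n + 1 => ((Equiv.refl Bool).prodCongr (get n)).trans (Fin.consEquiv fun _ => Bool)

theorem get_succ {n : ℕ} (a : Bits (n + 1)) (i : Fin n) : get (n + 1) a i.succ = get n a.2 i := rfl

/-- The permutation of words that moves the bit at position `i` to position `τ i`. -/
def wire (n : ℕ) : Perm (Fin n) →* Perm (Bits n) where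
  toFun τ := (get n).symm.permCongr (τ.arrowCongr (Equiv.refl Bool))
  map_one' := by
    ext1 a
    exact (get n).symm_apply_apply a
  map_mul' σ τ := by
    ext1 a
    simp [Equiv.permCongr_apply, Equiv.arrowCongr, Function.comp_def]
    rfl

theorem get_wire {n : ℕ} (τ : Perm (Fin n)) (a : Bits n) (i : Fin n) :
    get n (wire n τ a) (τ i) = get n a i := by
  simp [wire, Equiv.permCongr_apply, Equiv.arrowCongr]

theorem wire_apply_eq {n : ℕ} {τ : Perm (Fin n)} {a b : Bits n}
    (h : ∀ i, get n b (τ i) = get n a i) : wire n τ a = b := by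
  refine (get n).injective (funext fun i => ?_)
  obtain ⟨j, rfl⟩ := τ.surjective i
  rw [get_wire, h]

theorem wire_eq {n : ℕ} {τ : Perm (Fin n)} {σ : Perm (Bits n)}
    (h : ∀ a i, get n (σ a) (τ i) = get n a i) : wire n τ = σ :=
  Equiv.ext fun a => wire_apply_eq (h a)

/-- A permutation of the positions other than the first moves all bits but the first. -/
theorem wire_decomposeFin {n : ℕ} (τ : Perm (Fin n)) :
    wire (n + 1) (Perm.decomposeFin.symm (0, τ)) = lift (wire n τ) := by
  refine wire_eq fun a i => ?_
  rw [lift_apply]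
  induction i using Fin.cases with
  | zero => rw [Perm.decomposeFin_symm_apply_zero]; rfl
  | succ i =>
    rw [Perm.decomposeFin_symm_apply_succ, swap_self]
    exact get_wire τ a.2 i

theorem wire_swap (n : ℕ) : wire (n + 2) (swap 0 1) = exch n := by
  refine wire_eq fun a i => ?_
  induction i using Fin.cases with
  | zero => rw [swap_apply_left]; rfl
  | succ i =>
    induction i using Fin.cases with
    | zero =>
      rw [show (Fin.succ (0 : Fin (n + 1))) = 1 from rfl, swap_apply_right]; rfl
    | succ i => rw [swap_apply_of_ne_of_ne (by simp [Fin.ext_iff]) (by simp [Fin.ext_iff])]; rfl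

end Bits

theorem StrictProp.castEnd_permHom (Q : StrictProp.{u}) {m n : ℕ} (h : m = n) (σ : Perm (Fin m)) :
    Q.castEnd h (Q.permHom m σ) = Q.permHom n ((finCongr h).permCongr σ) := by
  subst h
  rw [castEnd_rfl]
  congr 1

/-- A permutation of all wires but the first is the sum of an identity and a permutation. -/
theorem StrictProp.permHom_decomposeFin (Q : StrictProp.{u}) {n : ℕ} (τ : Perm (Fin n)) :
    Q.permHom (n + 1) (Perm.decomposeFin.symm (0, τ)) =
      Q.castEnd (Nat.add_comm 1 n) (Q.inr 1 (Q.permHom n τ)) := by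
  rw [← permHom_one_permSum, castEnd_permHom]
  congr 1
  ext1 i
  rw [permCongr_apply]
  induction i using Fin.cases with
  | zero =>
    have : (finCongr (Nat.add_comm 1 n)).symm 0 = Fin.castAdd n 0 := rfl
    rw [this, Fin.permSum_castAdd]
    simp [Fin.ext_iff]
  | succ i =>
    have : (finCongr (Nat.add_comm 1 n)).symm i.succ = Fin.natAdd 1 i := by
      ext; simp [Nat.add_comm]
    rw [this, Fin.permSum_natAdd]
    ext; simp [Nat.add_comm]

theorem StrictProp.permHom_swap_zero_one (Q : StrictProp.{u}) (n : ℕ) :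
    Q.permHom (n + 2) (swap 0 1) = Q.castEnd (Nat.add_comm 2 n) (Q.inl n Q.sw) := by
  have h : Q.permHom 2 (swap 0 1) = Q.sw :=
    (Q.permHom_swap_last 0).trans (Q.castEnd_inr_zero (n := 2) rfl Q.sw)
  rw [← h, ← permHom_permSum_one, castEnd_permHom]
  congr 1
  ext1 i
  rw [permCongr_apply]
  obtain ⟨j, rfl⟩ := (finCongr (Nat.add_comm 2 n)).surjective i
  rw [symm_apply_apply]
  induction j using Fin.addCases with
  | left j =>
    rw [Fin.permSum_castAdd]
    fin_cases j
    · exact swap_apply_left _ _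
    · exact swap_apply_right _ _
  | right j =>
    rw [Fin.permSum_natAdd, swap_apply_of_ne_of_ne]
    · rfl
    · simp [Fin.ext_iff]
    · simp [Fin.ext_iff]

namespace ControllableProp

variable (P : ControllableProp.{u})

/-- A permutation of wires is the permutation of words that it induces. It suffices to check the
adjacent transpositions: the first of them is `rho_exch`, and the others leave the first
wire alone. -/
theorem rho_wire : ∀ (n : ℕ) (τ : Perm (Fin n)),
    P.tower.rho n (Bits.wire n τ) = P.controlled.permHom n τ
  | 0, τ => by rw [Subsingleton.elim τ 1, map_one, map_one, map_one]
  | 1, τ => by rw [Subsingleton.elim τ 1, map_one, map_one, map_one]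
  | n + 2, τ => by
    have hτ : τ ∈ Submonoid.closure
        (Set.range fun i : Fin (n + 1) => swap i.castSucc i.succ) := by
      rw [Perm.mclosure_swap_castSucc_succ]; trivial
    induction hτ using Submonoid.closure_induction with
    | one => rw [map_one, map_one, map_one]
    | mul σ τ _ _ h1 h2 => rw [map_mul, map_mul, map_mul, h1, h2]
    | mem τ h =>
      obtain ⟨i, rfl⟩ := h
      beta_reduce
      induction i using Fin.cases with
      | zero =>
        have : swap (Fin.castSucc (0 : Fin (n + 1))) (Fin.succ 0) = swap 0 1 := rfl
        rw [this, Bits.wire_swap, ControlTower.rho_exch, StrictProp.permHom_swap_zero_one]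
        rfl
      | succ i =>
        have : swap i.succ.castSucc i.succ.succ =
            Perm.decomposeFin.symm (0, swap i.castSucc i.succ) := by
          ext1 j
          induction j using Fin.cases with
          | zero => simp [swap_apply_of_ne_of_ne, Fin.ext_iff]
          | succ j =>
            rw [← Fin.succ_castSucc, Perm.decomposeFin_symm_apply_succ,
              (Fin.succ_injective _).swap_apply]
            simp
        rw [this, Bits.wire_decomposeFin, ControlTower.rho_lift, rho_wire,
          StrictProp.permHom_decomposeFin]
        exact P.towerC_false_mul_true _

end ControllableProp

/-! ### Words and their numbers -/

/-- The binary word of length `n` of the number `i`, with the most significant bit first. -/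
def Bits.ofNat : ∀ n : ℕ, ℕ → Bits n
  | 0, _ => ()
  | n + 1, i => (i.testBit n, ofNat n i)

namespace Bits

theorem ofNat_succ (n i : ℕ) : ofNat (n + 1) i = (i.testBit n, ofNat n i) := rfl

theorem get_ofNat : ∀ {n : ℕ} (i : ℕ) (j : Fin n), get n (ofNat n i) j = i.testBit (n - 1 - j)
  | 0, _, j => j.elim0
  | n + 1, i, j => by
    induction j using Fin.cases with
    | zero => rfl
    | succ j =>
      rw [get_succ, ofNat_succ, get_ofNat]
      congr 1
      simp
      omega

theorem ofNat_congr {n i j : ℕ} (h : ∀ k < n, i.testBit k = j.testBit k) : ofNat n i = ofNat n j :=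
  (get n).injective (funext fun k => by
    rw [get_ofNat, get_ofNat]
    exact h _ (by omega))

theorem ofNat_injOn (n : ℕ) : Set.InjOn (ofNat n) (Set.Iio (2 ^ n)) := by
  intro i hi j hj h
  refine Nat.eq_of_testBit_eq fun k => ?_
  by_cases hk : k < n
  · have := congrFun (congrArg (get n) h) ⟨n - 1 - k, by omega⟩
    rw [get_ofNat, get_ofNat] at this
    simpa [show n - 1 - (n - 1 - k) = k by omega] using this
  · have h2 : 2 ^ n ≤ 2 ^ k := Nat.pow_le_pow_right (by norm_num) (by omega)
    rw [Nat.testBit_lt_two_pow (lt_of_lt_of_le hi h2),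
      Nat.testBit_lt_two_pow (lt_of_lt_of_le hj h2)]

theorem card (n : ℕ) : Nat.card (Bits n) = 2 ^ n := by
  rw [Nat.card_congr (get n)]
  simp

theorem exists_ofNat {n : ℕ} (a : Bits n) : ∃ i < 2 ^ n, ofNat n i = a := by
  have h : Function.Injective fun i : Fin (2 ^ n) => ofNat n i := fun i j hij =>
    Fin.ext (ofNat_injOn n i.2 j.2 hij)
  have := (Nat.bijective_iff_injective_and_card _).2 ⟨h, by rw [card]; simp⟩
  obtain ⟨i, hi⟩ := this.2 a
  exact ⟨i, i.2, hi⟩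

theorem testBit_grid_low {a b n k : ℕ} (hk : k < n) : (a * 2 ^ n + b).testBit k = b.testBit k := by
  rw [Nat.mul_comm]
  by_cases hb : b < 2 ^ n
  · rw [Nat.testBit_two_pow_mul_add a hb, if_pos hk]
  · rw [Nat.testBit_eq_decide_div_mod_eq, Nat.testBit_eq_decide_div_mod_eq]
    congr 2
    obtain ⟨c, rfl⟩ := Nat.exists_eq_add_of_lt hk
    have : 2 ^ (k + c + 1) * a + b = 2 ^ k * (2 * (2 ^ c * a)) + b := by ring
    rw [this, Nat.mul_add_div (by positivity), Nat.mul_add_mod]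

theorem testBit_grid_high {a b n : ℕ} (hb : b < 2 ^ n) (k : ℕ) :
    (a * 2 ^ n + b).testBit (n + k) = a.testBit k := by
  rw [Nat.mul_comm, Nat.testBit_two_pow_mul_add a hb, if_neg (by omega), Nat.add_sub_cancel_left]

theorem ofNat_grid_low (n a b : ℕ) : ofNat n (a * 2 ^ n + b) = ofNat n b :=
  ofNat_congr fun _ hk => testBit_grid_low hk

theorem ofNat_two_pow_add {n i : ℕ} (hi : i < 2 ^ n) :
    ofNat (n + 1) (2 ^ n + i) = (true, ofNat n i) := by
  have := ofNat_grid_low n 1 i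
  rw [one_mul] at this
  rw [ofNat_succ, Nat.testBit_two_pow_add_eq, Nat.testBit_lt_two_pow hi, this]
  rfl

theorem ofNat_of_lt {n i : ℕ} (hi : i < 2 ^ n) : ofNat (n + 1) i = (false, ofNat n i) := by
  rw [ofNat_succ, Nat.testBit_lt_two_pow hi]

/-- Interchanging the factors of a product of powers of `2` exchanges blocks of bits. -/
theorem wire_ofNat_grid {m n : ℕ} {τ : Perm (Fin (m + n))} (hτ : ∀ i, (τ i : ℕ) = swapFun m n i)
    {a b : ℕ} (ha : a < 2 ^ m) (hb : b < 2 ^ n) :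
    wire (m + n) τ (ofNat (m + n) (a * 2 ^ n + b)) = ofNat (m + n) (b * 2 ^ m + a) := by
  refine wire_apply_eq (n := m + n) fun i => ?_
  rw [get_ofNat, get_ofNat, hτ, swapFun]
  split_ifs with hi
  · rw [testBit_grid_low (by omega), show m + n - 1 - i = n + (m - 1 - i) by omega,
      testBit_grid_high hb]
    congr 1
    omega
  · have := i.2
    rw [testBit_grid_low (n := n) (by omega),
      show m + n - 1 - (i - m) = m + (m + n - 1 - i) by omega, testBit_grid_high ha]

end Bits

/-! ### Realisations of formal expressions -/

/-- Values of generators at positions of `X`, from which a realisation of all expressions over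
them is built. -/
structure GenRealisation (G : ℕ → ℕ → Type u) (X : Type) (M : Type v) [Monoid M] where
  perm : Perm X →* M
  val {m n : ℕ} (g : G m n) (e : ℕ → X) : M
  endo {m n : ℕ} (g : G m n) : m = n
  val_conj {m n : ℕ} (g : G m n) {e : ℕ → X} (he : Set.InjOn e (Set.Iio m)) (σ : Perm X) :
    SemiconjBy (perm σ) (val g e) (val g fun i => σ (e i))
  val_congr {m n : ℕ} (g : G m n) {e e' : ℕ → X} (h : ∀ i < m, e i = e' i) : val g e = val g e'
  val_comm {k l m n : ℕ} (f : G k l) (g : G m n) {e e' : ℕ → X} (he : Set.InjOn e (Set.Iio k))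
    (he' : Set.InjOn e' (Set.Iio m)) (h : ∀ i < k, ∀ j < m, e i ≠ e' j) :
    Commute (val f e) (val g e')

namespace GenRealisation

variable {G : ℕ → ℕ → Type u} {X : Type} {M : Type v} [Monoid M] (S : GenRealisation G X M)

open Classical in
/-- The value of the permutation with property `A`. The junk value `1` is taken if there is none; if
there are several, one of them is chosen. -/
noncomputable def permVal (A : Perm X → Prop) : M := if h : ∃ σ, A σ then S.perm h.choose else 1

/-- The value of an expression at the positions `e`. A symmetry permutes the positions along `e`. -/
noncomputable def termVal : ∀ {m n : ℕ}, PropTerm G m n → (ℕ → X) → M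
  | _, _, .gen g, e => S.val g e
  | _, _, .id _, _ => 1
  | _, _, .comp g f, e => termVal g e * termVal f e
  | _, _, .add (k := k) f g, e => termVal f e * termVal g fun i => e (k + i)
  | _, _, .swap m n, e => S.permVal (Along e (m + n) (swapFun m n))

theorem termVal_swap {m n : ℕ} {e : ℕ → X} {σ : Perm X} (hσ : Along e (m + n) (swapFun m n) σ) :
    S.termVal (.swap m n) e = S.perm σ := by
  have h : ∃ σ, Along e (m + n) (swapFun m n) σ := ⟨σ, hσ⟩
  rw [termVal, permVal, dif_pos h, h.choose_spec.unique hσ]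

theorem term_endo (S : GenRealisation G X M) {m n : ℕ} (t : PropTerm G m n) : m = n := t.endo S.endo

theorem termVal_conj {m n : ℕ} (t : PropTerm G m n) : ∀ {e : ℕ → X}, Set.InjOn e (Set.Iio m) →
    ∀ σ : Perm X, SemiconjBy (S.perm σ) (S.termVal t e) (S.termVal t fun i => σ (e i)) := by
  induction t with
  | gen g => exact fun he σ => S.val_conj g he σ
  | id n => exact fun _ _ => SemiconjBy.one_right _
  | comp g f hg hf =>
    obtain rfl := S.term_endo f
    exact fun he σ => (hg he σ).mul_right (hf he σ)
  | add f g hf hg =>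
    exact fun he σ => (hf (Realisation.injOn_left he) σ).mul_right
      (hg (Realisation.injOn_shift he le_rfl) σ)
  | swap m n =>
    intro e he σ
    obtain ⟨τ, hτ⟩ := exists_along_swapFun he
    have h : Along (fun i => σ (e i)) (m + n) (swapFun m n) (σ * τ * σ⁻¹) := by
      refine ⟨fun i hi => ?_, fun y hy => ?_⟩
      · simp [hτ.1 i hi]
      · rw [Perm.mul_apply, Perm.mul_apply, hτ.2 _ fun i hi h => hy i hi (by simp [h])]
        simp
    rw [S.termVal_swap hτ, S.termVal_swap h, SemiconjBy, ← map_mul, ← map_mul]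
    congr 1
    group

theorem termVal_congr {m n : ℕ} (t : PropTerm G m n) : ∀ {e e' : ℕ → X},
    (∀ i < m, e i = e' i) → S.termVal t e = S.termVal t e' := by
  induction t with
  | gen g => exact fun h => S.val_congr g h
  | id n => exact fun _ => rfl
  | comp g f hg hf =>
    obtain rfl := S.term_endo f
    exact fun h => congrArg₂ (· * ·) (hg h) (hf h)
  | add f g hf hg =>
    exact fun h => congrArg₂ (· * ·) (hf fun i hi => h i (by omega))
      (hg fun i hi => h _ (by omega))
  | swap m n =>
    intro e e' h
    have : Along e (m + n) (swapFun m n) = Along e' (m + n) (swapFun m n) := by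
      ext σ
      have hp : ∀ i < m + n, swapFun m n i < m + n := fun i hi => by
        unfold swapFun; split_ifs <;> omega
      refine and_congr (forall₂_congr fun i hi => ?_) (forall_congr' fun y => imp_congr_left
        (forall₂_congr fun i hi => ?_))
      · rw [h i hi, h _ (hp i hi)]
      · rw [h i hi]
    simp only [termVal, this]

theorem termVal_comm_swap {a b m n : ℕ} (t : PropTerm G m n) {e e' : ℕ → X}
    (he : Set.InjOn e (Set.Iio (a + b))) (he' : Set.InjOn e' (Set.Iio m))
    (h : ∀ i < a + b, ∀ j < m, e i ≠ e' j) :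
    Commute (S.termVal (.swap a b) e) (S.termVal t e') := by
  obtain ⟨σ, hσ⟩ := exists_along_swapFun he
  have h1 := S.termVal_conj t he' σ
  rwa [S.termVal_congr t fun j hj => hσ.2 (e' j) fun i hi => h i hi j hj, ← S.termVal_swap hσ] at h1

theorem termVal_comm_gen {k l m n : ℕ} (g : G k l) (t : PropTerm G m n) : ∀ {e e' : ℕ → X},
    Set.InjOn e (Set.Iio k) → Set.InjOn e' (Set.Iio m) → (∀ i < k, ∀ j < m, e i ≠ e' j) →
    Commute (S.val g e) (S.termVal t e') := by
  induction t with
  | gen f => exact fun he he' h => S.val_comm g f he he' h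
  | id n => exact fun _ _ _ => Commute.one_right _
  | comp f' f hf' hf =>
    obtain rfl := S.term_endo f
    exact fun he he' h => (hf' he he' h).mul_right (hf he he' h)
  | add f f' hf hf' =>
    exact fun he he' h => (hf he (Realisation.injOn_left he') fun i hi j hj =>
      h i hi j (by omega)).mul_right (hf' he (Realisation.injOn_shift he' le_rfl)
        fun i hi j hj => h i hi _ (by omega))
  | swap a b =>
    exact fun he he' h => (S.termVal_comm_swap (.gen g) he' he fun i hi j hj =>
      (h j hj i hi).symm).symm

theorem termVal_comm {k l m n : ℕ} (s : PropTerm G k l) (t : PropTerm G m n) :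
    ∀ {e e' : ℕ → X}, Set.InjOn e (Set.Iio k) → Set.InjOn e' (Set.Iio m) →
    (∀ i < k, ∀ j < m, e i ≠ e' j) → Commute (S.termVal s e) (S.termVal t e') := by
  induction s with
  | gen g => exact fun he he' h => S.termVal_comm_gen g t he he' h
  | id n => exact fun _ _ _ => Commute.one_left _
  | comp f' f hf' hf =>
    obtain rfl := S.term_endo f
    exact fun he he' h => (hf' he he' h).mul_left (hf he he' h)
  | add f f' hf hf' =>
    exact fun he he' h => (hf (Realisation.injOn_left he) he' fun i hi j hj =>
      h i (by omega) j hj).mul_left (hf' (Realisation.injOn_shift he le_rfl) he'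
        fun i hi j hj => h _ (by omega) j hj)
  | swap a b => exact fun he he' h => S.termVal_comm_swap t he he' h

/-- A realisation of the generators extends to all expressions. -/
noncomputable def toRealisation : Realisation (PropTerm.data G) X M where
  perm := S.perm
  val t e := S.termVal t e
  endo := S.term_endo
  val_id _ := rfl
  val_comp _ _ _ _ := rfl
  val_add _ _ _ _ := rfl
  val_swap _ _ hσ := S.termVal_swap hσ
  val_conj t _ he σ := S.termVal_conj t he σ
  val_congr t _ _ h := S.termVal_congr t h
  val_comm s t _ _ he he' h := S.termVal_comm s t he he' h

end GenRealisation

/-- A realisation of expressions respects the laws of a prop. -/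
theorem Realisation.val_eq_of_cong {G : ℕ → ℕ → Type u} {X : Type} {M : Type v} [Monoid M]
    (S : Realisation (PropTerm.data G) X M)
    {R : ∀ m n : ℕ, PropTerm G m n → PropTerm G m n → Prop}
    (hR : ∀ (m n : ℕ) (s t : PropTerm G m n), R m n s t → ∀ e : ℕ → X,
      Set.InjOn e (Set.Iio m) → S.val s e = S.val t e) {m n : ℕ} {s t : PropTerm G m n}
    (h : PropTerm.Cong R s t) : ∀ {e : ℕ → X}, Set.InjOn e (Set.Iio m) →
      S.val s e = S.val t e := by
  have hid : ∀ {n : ℕ} {e : ℕ → X}, Set.InjOn e (Set.Iio n) → S.val (PropTerm.id n) e = 1 :=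
    fun he => S.val_id he
  have hcomp : ∀ {l m n : ℕ} (g : PropTerm G m n) (f : PropTerm G l m) {e : ℕ → X},
      Set.InjOn e (Set.Iio l) → S.val (PropTerm.comp g f) e = S.val g e * S.val f e :=
    fun g f _ he => S.val_comp g f he
  have hadd : ∀ {k l m n : ℕ} (f : PropTerm G k l) (g : PropTerm G m n) {e : ℕ → X},
      Set.InjOn e (Set.Iio (k + m)) →
      S.val (PropTerm.add f g) e = S.val f e * S.val g (fun i => e (k + i)) :=
    fun f g _ he => S.val_add f g he
  have hswap : ∀ {m n : ℕ} {e : ℕ → X}, Set.InjOn e (Set.Iio (m + n)) → ∀ {σ : Perm X},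
      Along e (m + n) (swapFun m n) σ → S.val (PropTerm.swap m n) e = S.perm σ :=
    fun he _ hσ => S.val_swap he hσ
  have hendo : ∀ {m n : ℕ}, PropTerm G m n → m = n := fun f => S.endo f
  induction h with
  | rel h => exact fun he => hR _ _ _ _ h _ he
  | refl s => exact fun _ => rfl
  | symm _ ih => exact fun he => (ih he).symm
  | trans _ _ h1 h2 => exact fun he => (h1 he).trans (h2 he)
  | @comp_congr l m n s s' t t' _ _ h1 h2 =>
    intro e he
    obtain rfl := hendo t
    rw [hcomp _ _ he, hcomp _ _ he, h1 he, h2 he]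
  | add_congr _ _ h1 h2 =>
    intro e he
    rw [hadd _ _ he, hadd _ _ he, h1 (injOn_left he), h2 (injOn_shift he le_rfl)]
  | id_comp f =>
    intro e he
    obtain rfl := hendo f
    rw [hcomp _ _ he, hid he, one_mul]
  | comp_id f =>
    intro e he
    rw [hcomp _ _ he, hid he, mul_one]
  | comp_assoc h g f =>
    intro e he
    obtain rfl := hendo f
    rw [hcomp _ _ he, hcomp _ _ he, hcomp _ _ he, hcomp _ _ he, mul_assoc]
  | add_id m n =>
    intro e he
    rw [hadd _ _ he, hid he, hid (injOn_left he), hid (injOn_shift he le_rfl), one_mul]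
  | add_comp g f g' f' =>
    intro e he
    obtain rfl := hendo f
    obtain rfl := hendo f'
    have h1 := injOn_left he
    have h2 := injOn_shift he le_rfl
    rw [hcomp _ _ he, hadd _ _ he, hadd _ _ he, hadd _ _ he, hcomp _ _ h1, hcomp _ _ h2]
    have hc := S.val_comm f g' h1 h2 fun i hi j hj =>
      ne_of_injOn he (by omega) (by omega) (by omega)
    rw [mul_assoc, ← mul_assoc (S.val f e), hc.eq]
    simp only [mul_assoc]
  | @add_assoc k l m k' l' m' f g h =>
    intro e he
    have he' : Set.InjOn e (Set.Iio (k + l + m)) := by rwa [Nat.add_assoc]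
    rw [S.val_cast, hadd _ _ he', hadd _ _ (injOn_left he'), hadd _ _ he,
      hadd _ _ (injOn_shift he le_rfl), mul_assoc]
    congr 2
    exact S.val_congr h fun i _ => congrArg e (Nat.add_assoc k l i)
  | @zero_add m n f =>
    intro e he
    have he' : Set.InjOn e (Set.Iio (0 + m)) := by rwa [Nat.zero_add]
    rw [S.val_cast, hadd _ _ he', hid (injOn_left he'), one_mul]
    exact S.val_congr f fun i _ => congrArg e (Nat.zero_add i)
  | add_zero f =>
    intro e he
    rw [S.val_cast, hadd _ _ he, hid (injOn_shift he le_rfl), mul_one]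
  | @swap_natural k l m n f g =>
    intro e he
    obtain rfl := hendo f
    obtain rfl := hendo g
    have he' : Set.InjOn e (Set.Iio (m + k)) := by rwa [Nat.add_comm]
    obtain ⟨σ, hσ⟩ := exists_along_swapFun he
    rw [hcomp _ _ he, hcomp _ _ he, hadd _ _ he, hadd _ _ he', hswap he hσ]
    have h1 := S.val_conj f (injOn_left he) σ
    have h2 := S.val_conj g (injOn_shift he le_rfl) σ
    rw [S.val_congr f (e := fun i => σ (e i)) (e' := fun i => e (m + i)) fun i hi => by
      rw [hσ.1 i (by omega), swapFun, if_pos hi]] at h1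
    rw [S.val_congr g (e := fun i => σ (e (k + i))) (e' := e) fun i hi => by
      rw [hσ.1 _ (by omega), swapFun, if_neg (by omega), Nat.add_sub_cancel_left]] at h2
    have hc := S.val_comm f g (injOn_shift he' le_rfl) (injOn_left he') fun i hi j hj =>
      ne_of_injOn he' (by omega) (by omega) (by omega)
    rw [(h1.mul_right h2).eq, hc.eq]
  | swap_swap m n =>
    intro e he
    have he' : Set.InjOn e (Set.Iio (n + m)) := by rwa [Nat.add_comm]
    obtain ⟨σ, hσ⟩ := exists_along_swapFun he
    obtain ⟨τ, hτ⟩ := exists_along_swapFun he'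
    rw [hcomp _ _ he, hswap he hσ, hswap he' hτ, hid he, ← map_mul]
    have : τ * σ = 1 := by
      refine Along.unique (e := e) (N := m + n) (p := fun i => i) ⟨fun i hi => ?_, fun y hy => ?_⟩
        ⟨fun _ _ => rfl, fun _ _ => rfl⟩
      · have hi' : swapFun m n i < n + m := by unfold swapFun; split_ifs <;> omega
        rw [Perm.mul_apply, hσ.1 i hi, hτ.1 _ hi']
        refine congrArg e (show swapFun n m (swapFun m n i) = i from ?_)
        unfold swapFun; split_ifs <;> omega
      · rw [Perm.mul_apply, hσ.2 y hy, hτ.2 y fun i hi => hy i (by omega)]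
    rw [this, map_one]
  | swap_add k m n =>
    intro e he
    have he1 : Set.InjOn e (Set.Iio (k + m + n)) := by rwa [Nat.add_assoc]
    have he2 : Set.InjOn e (Set.Iio (m + (k + n))) := by rwa [← Nat.add_assoc, Nat.add_comm m k]
    have he3 := injOn_left he1
    have he4 := injOn_shift he2 le_rfl
    obtain ⟨σ, hσ⟩ := exists_along_swapFun he
    obtain ⟨τ, hτ⟩ := exists_along_swapFun he3
    obtain ⟨ω, hω⟩ := exists_along_swapFun he4
    rw [S.val_cast, hcomp _ _ he1, S.val_cast, hadd _ _ he2, hadd _ _ he1, hid (injOn_left he2),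
      hid (injOn_shift he1 le_rfl), hswap he hσ, hswap he3 hτ, hswap he4 hω, one_mul, mul_one,
      ← map_mul]
    congr 1
    refine hσ.unique ⟨fun i hi => ?_, fun y hy => ?_⟩
    · rw [Perm.mul_apply]
      by_cases h1 : i < k + m
      · rw [hτ.1 i h1]
        by_cases h2 : i < k
        · have := hω.1 i (by omega)
          simp only [swapFun, if_pos h2] at this ⊢
          rw [this, Nat.add_assoc]
        · simp only [swapFun, if_neg h2]
          exact hω.2 _ fun j hj => ne_of_injOn he2 (by omega) (by omega) (by omega)
      · rw [hτ.2 (e i) fun j hj => ne_of_injOn he1 (by omega) (by omega) (by omega)]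
        have := hω.1 (i - m) (by omega)
        simp only [swapFun, if_neg (show ¬ i - m < k by omega), if_neg (show ¬ i < k by omega)]
          at this ⊢
        rw [show m + (i - m) = i by omega, show m + (i - m - k) = i - k by omega] at this
        exact this
    · rw [Perm.mul_apply, hτ.2 y fun i hi => hy i (by omega), hω.2 y fun i hi => hy _ (by omega)]

/-! ### Operations of a tower at given words -/

/-- Transport of words along an equality of lengths. -/
def Bits.cast {m n : ℕ} (h : m = n) (a : Bits m) : Bits n := h ▸ a

namespace ControlTower

open Bits

variable {E : ℕ → Type u} [∀ n, Monoid (E n)] (K : ControlTower E)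

/-- `y` is the operation `f` on `k` wires, placed at the words `e 0, …, e (2 ^ k - 1)` of length
`N`: `f` with `N - k` positive controls, which acts on the words beginning with `N - k` ones,
conjugated by a permutation that sends these words to the given ones. -/
def IsPlaced {k N : ℕ} (f : E k) (e : ℕ → Bits N) (y : E N) : Prop :=
  ∃ (j : ℕ) (h : k + j = N) (σ : Perm (Bits (k + j))),
    (∀ i < 2 ^ k, Bits.cast h (σ (ones j (ofNat k i))) = e i) ∧
    y = h ▸ (K.rho (k + j) σ * K.Cpow j f * K.rho (k + j) σ⁻¹)

theorem rho_inv_mul {n : ℕ} (σ : Perm (Bits n)) : K.rho n σ⁻¹ * K.rho n σ = 1 := by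
  rw [← map_mul, inv_mul_cancel, map_one]

theorem rho_mul_inv {n : ℕ} (σ : Perm (Bits n)) : K.rho n σ * K.rho n σ⁻¹ = 1 := by
  rw [← map_mul, mul_inv_cancel, map_one]

variable {K}

/-- The placement of an operation does not depend on the permutation, by `rho_comm_Cpow`. -/
theorem IsPlaced.unique {k N : ℕ} {f : E k} {e : ℕ → Bits N} {y y' : E N}
    (hy : K.IsPlaced f e y) (hy' : K.IsPlaced f e y') : y = y' := by
  obtain ⟨j, h, σ, hσ, rfl⟩ := hy
  subst h
  obtain ⟨j', h, σ', hσ', rfl⟩ := hy'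
  obtain rfl : j' = j := by omega
  change K.rho _ σ * K.Cpow j' f * K.rho _ σ⁻¹ = K.rho _ σ' * K.Cpow j' f * K.rho _ σ'⁻¹
  obtain ⟨ω, rfl⟩ : ∃ ω, σ' = σ * ω := ⟨σ⁻¹ * σ', by group⟩
  have hω : ∀ a, ω (ones j' a) = ones j' a := fun a => by
    obtain ⟨i, hi, rfl⟩ := exists_ofNat a
    have : σ (ω (ones j' (ofNat k i))) = σ (ones j' (ofNat k i)) :=
      (hσ' i hi).trans (hσ i hi).symm
    exact σ.injective this
  rw [mul_inv_rev, map_mul, map_mul, mul_assoc (K.rho _ σ) _ (K.Cpow j' f),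
    (K.rho_comm_Cpow f ω hω).eq]
  simp only [mul_assoc]
  rw [← mul_assoc (K.rho _ ω), rho_mul_inv, one_mul]

theorem exists_frame {k N : ℕ} {e : ℕ → Bits N} (he : Set.InjOn e (Set.Iio (2 ^ k))) :
    ∃ (j : ℕ) (h : k + j = N) (σ : Perm (Bits (k + j))),
      ∀ i < 2 ^ k, Bits.cast h (σ (ones j (ofNat k i))) = e i := by
  have hle : 2 ^ k ≤ 2 ^ N := by
    have := Nat.card_le_card_of_injective (fun i : Fin (2 ^ k) => e i)
      fun i j h => Fin.ext (he i.2 j.2 h)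
    rwa [Nat.card_fin, Bits.card] at this
  obtain ⟨j, rfl⟩ := Nat.exists_eq_add_of_le ((Nat.pow_le_pow_iff_right (by norm_num)).1 hle)
  obtain ⟨σ, hσ⟩ := exists_perm_map (u := fun i => ones j (ofNat k i))
    (fun i hi i' hi' h => ofNat_injOn k hi hi' (ones_injective j h)) he
  exact ⟨j, rfl, σ, hσ⟩

variable (K)

open Classical in
/-- The operation `f` on `k` wires, placed at the words `e 0, …, e (2 ^ k - 1)`; the junk value `1`
is taken if these words are not distinct. -/
noncomputable def place {k N : ℕ} (f : E k) (e : ℕ → Bits N) : E N :=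
  if h : ∃ y, K.IsPlaced f e y then h.choose else 1

variable {K}

theorem IsPlaced.place_eq {k N : ℕ} {f : E k} {e : ℕ → Bits N} {y : E N}
    (h : K.IsPlaced f e y) : K.place f e = y := by
  have hex : ∃ y, K.IsPlaced f e y := ⟨y, h⟩
  rw [place, dif_pos hex]
  exact hex.choose_spec.unique h

variable (K)

theorem place_eq {k j : ℕ} (f : E k) {e : ℕ → Bits (k + j)} {σ : Perm (Bits (k + j))}
    (hσ : ∀ i < 2 ^ k, σ (ones j (ofNat k i)) = e i) :
    K.place f e = K.rho (k + j) σ * K.Cpow j f * K.rho (k + j) σ⁻¹ :=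
  IsPlaced.place_eq ⟨j, rfl, σ, hσ, rfl⟩

theorem place_ofNat {k : ℕ} (f : E k) : K.place f (ofNat k) = f := by
  refine (K.place_eq (j := 0) f (σ := 1) fun _ _ => rfl).trans ?_
  rw [inv_one, map_one, one_mul, mul_one]
  rfl

theorem place_congr {k N : ℕ} (f : E k) {e e' : ℕ → Bits N} (h : ∀ i < 2 ^ k, e i = e' i) :
    K.place f e = K.place f e' := by
  have : K.IsPlaced f e = K.IsPlaced f e' := by
    ext y
    refine exists_congr fun j => exists_congr fun h1 => exists_congr fun σ =>
      and_congr_left fun _ => forall₂_congr fun i hi => ?_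
    rw [h i hi]
  unfold place
  rw [this]

theorem place_conj {k N : ℕ} (f : E k) {e : ℕ → Bits N} (he : Set.InjOn e (Set.Iio (2 ^ k)))
    (τ : Perm (Bits N)) :
    SemiconjBy (K.rho N τ) (K.place f e) (K.place f fun i => τ (e i)) := by
  obtain ⟨j, h, σ, hσ⟩ := exists_frame he
  subst h
  rw [K.place_eq f hσ, K.place_eq f (σ := τ * σ) fun i hi => congrArg τ (hσ i hi), SemiconjBy,
    mul_inv_rev, map_mul, map_mul]
  simp only [mul_assoc, rho_inv_mul, mul_one]

theorem place_true {k N : ℕ} (f : E k) {e : ℕ → Bits N} (he : Set.InjOn e (Set.Iio (2 ^ k))) :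
    K.place (N := N + 1) f (fun i => (true, e i)) = K.C true (K.place f e) := by
  obtain ⟨j, h, σ, hσ⟩ := exists_frame he
  subst h
  have h1 : (Perm.prodExtendRight true σ)⁻¹ = Perm.prodExtendRight true σ⁻¹ :=
    (map_inv (Perm.prodExtendRightHom true) σ).symm
  refine (K.place_eq (j := j + 1) f (σ := Perm.prodExtendRight true σ) fun i hi => ?_).trans ?_
  · change Perm.prodExtendRight true σ (true, ones j (ofNat k i)) = _
    rw [Perm.prodExtendRight_apply_eq]
    exact congrArg _ (hσ i hi)
  · rw [h1, K.place_eq f hσ, map_mul, map_mul, ← rho_prodExtendRight, ← rho_prodExtendRight]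
    rfl

/-- An operation placed at words with first bit `b` is controlled by that bit. -/
theorem place_cons {k N : ℕ} (b : Bool) (f : E k) {e : ℕ → Bits N}
    (he : Set.InjOn e (Set.Iio (2 ^ k))) :
    K.place (N := N + 1) f (fun i => (b, e i)) = K.C b (K.place f e) := by
  cases b
  · have he' : Set.InjOn (fun i => ((true, e i) : Bits (N + 1))) (Set.Iio (2 ^ k)) :=
      fun i hi j hj h => he hi hj (Prod.ext_iff.1 h).2
    have h : K.rho (N + 1) (flip N) * K.place (N := N + 1) f (fun i => (true, e i)) =
        K.place (N := N + 1) f (fun i => (false, e i)) * K.rho (N + 1) (flip N) :=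
      K.place_conj f he' (flip N)
    rw [place_true K f he, rho_flip] at h
    rw [← X_C, h, mul_assoc, X_mul_X, mul_one]
  · exact K.place_true f he

/-- Operations at disjoint sets of words commute: a permutation moves the words of one to words
with first bit `true` and those of the other to words with first bit `false`, and then the
operations are controlled by opposite values of the first wire. -/
theorem place_comm {k l N : ℕ} (f : E k) (g : E l) {e e' : ℕ → Bits N}
    (he : Set.InjOn e (Set.Iio (2 ^ k))) (he' : Set.InjOn e' (Set.Iio (2 ^ l)))
    (h : ∀ i < 2 ^ k, ∀ j < 2 ^ l, e i ≠ e' j) : Commute (K.place f e) (K.place g e') := by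
  let e'' : ℕ → Bits N := fun i => if i < 2 ^ k then e i else e' (i - 2 ^ k)
  have he'' : Set.InjOn e'' (Set.Iio (2 ^ k + 2 ^ l)) := by
    intro i hi j hj hij
    simp only [Set.mem_Iio] at hi hj
    simp only [e''] at hij
    split_ifs at hij with h1 h2 h2
    · exact he h1 h2 hij
    · exact absurd hij (h i h1 _ (by omega))
    · exact absurd hij.symm (h j h2 _ (by omega))
    · have := he' (show i - 2 ^ k < 2 ^ l by omega) (show j - 2 ^ k < 2 ^ l by omega) hij
      omega
  have hcard : 2 ^ k + 2 ^ l ≤ 2 ^ N := by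
    have := Nat.card_le_card_of_injective (fun i : Fin (2 ^ k + 2 ^ l) => e'' i)
      fun i j h => Fin.ext (he'' i.2 j.2 h)
    rwa [Nat.card_fin, Bits.card] at this
  have hk : k < N := (Nat.pow_lt_pow_iff_right (by norm_num)).1
    (lt_of_lt_of_le (Nat.lt_add_of_pos_right (Nat.two_pow_pos l)) hcard)
  have hl : l < N := (Nat.pow_lt_pow_iff_right (by norm_num)).1
    (lt_of_lt_of_le (Nat.lt_add_of_pos_left (Nat.two_pow_pos k)) hcard)
  obtain ⟨M, rfl⟩ : ∃ M, N = M + 1 := ⟨N - 1, by omega⟩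
  have hk' : 2 ^ k ≤ 2 ^ M := Nat.pow_le_pow_right (by norm_num) (by omega)
  have hl' : 2 ^ l ≤ 2 ^ M := Nat.pow_le_pow_right (by norm_num) (by omega)
  have hM := ofNat_injOn M
  have hinj : ∀ (b : Bool) {m : ℕ}, m ≤ 2 ^ M →
      Set.InjOn (fun i => ((b, ofNat M i) : Bits (M + 1))) (Set.Iio m) := fun b m hm i hi j hj h =>
    Realisation.injOn_mono hM hm hi hj (Prod.ext_iff.1 h).2
  obtain ⟨σ, hσ⟩ := exists_perm_map (X := Bits (M + 1)) (N := 2 ^ k + 2 ^ l) (e := e'')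
    (u := fun i => if i < 2 ^ k then ((true, ofNat M i) : Bits (M + 1))
      else (false, ofNat M (i - 2 ^ k))) (fun i hi j hj hij => by
        simp only [Set.mem_Iio] at hi hj
        dsimp only at hij
        split_ifs at hij with h1 h2 h2
        · exact hinj true hk' h1 h2 hij
        · exact absurd (Prod.ext_iff.1 hij).1 (by simp)
        · exact absurd (Prod.ext_iff.1 hij).1 (by simp)
        · have := hinj false hl' (show i - 2 ^ k < 2 ^ l by omega)
            (show j - 2 ^ k < 2 ^ l by omega) hij
          omega) he''
  have h1 := K.place_conj (N := M + 1) f (hinj true hk') σ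
  have h2 := K.place_conj (N := M + 1) g (hinj false hl') σ
  rw [K.place_congr f (e := fun i => σ (true, ofNat M i)) (e' := e) fun i hi => by
    simpa [e'', hi] using hσ i (Nat.lt_add_right _ hi),
    K.place_cons true f (Realisation.injOn_mono hM hk')] at h1
  rw [K.place_congr g (e := fun i => σ (false, ofNat M i)) (e' := e') fun i hi => by
    simpa [e''] using hσ (2 ^ k + i) (Nat.add_lt_add_left hi _),
    K.place_cons false g (Realisation.injOn_mono hM hl')] at h2
  have h3 : ∀ {a b : E (M + 1)}, SemiconjBy (K.rho (M + 1) σ) a b →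
      b = K.rho (M + 1) σ * a * K.rho (M + 1) σ⁻¹ := fun {a b} h => by
    rw [h.eq, mul_assoc, rho_mul_inv, mul_one]
  have hc : Commute (K.C true (K.place f (ofNat M))) (K.C false (K.place g (ofNat M))) :=
    K.C_comm' (by decide) _ _
  have h4 := (h1.mul_right h2)
  rw [hc.eq] at h4
  rw [Commute, SemiconjBy, h3 h4, h3 (h2.mul_right h1)]

end ControlTower

/-! ### Expressions of the rigged crop in a tower -/

namespace ControlTower

open Bits

variable {E : ℕ → Type u} [∀ n, Monoid (E n)] (K : ControlTower E) {G : ℕ → ℕ → Type v}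
  (hG : ∀ {m n : ℕ}, G m n → m = n) (γ : ∀ {m n : ℕ}, G m n → E m)

/-- The generator `g̃` acts at `2 ^ k` words as the operation `γ g` on `k` wires placed there. -/
noncomputable def genRealisation (N : ℕ) : GenRealisation (RigGen G) (Bits N) (E N) where
  perm := K.rho N
  val
    | .tilde g, e => K.place (γ g) e
  endo := RigGen.endo hG
  val_conj := by
    rintro _ _ ⟨g⟩ e he σ
    exact K.place_conj (γ g) he σ
  val_congr := by
    rintro _ _ ⟨g⟩ e e' h
    exact K.place_congr (γ g) h
  val_comm := by
    rintro _ _ _ _ ⟨f⟩ ⟨g⟩ e e' he he' h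
    exact K.place_comm (γ f) (γ g) he he' h

/-- Expressions of the rigged crop act at the words of length `N`. -/
noncomputable def realisation (N : ℕ) : Realisation (PropTerm.data (RigGen G)) (Bits N) (E N) :=
  (K.genRealisation hG γ N).toRealisation

variable {N : ℕ}

/-- An expression acting on the words with first bit `b` is controlled by that bit. -/
theorem realisation_val_cons (b : Bool) {m n : ℕ} (t : PropTerm (RigGen G) m n) :
    ∀ {e : ℕ → Bits N}, Set.InjOn e (Set.Iio m) →
    (K.realisation hG γ (N + 1)).val t (fun i => (b, e i)) =
      K.C b ((K.realisation hG γ N).val t e) := by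
  have hb : ∀ {m : ℕ} {e : ℕ → Bits N}, Set.InjOn e (Set.Iio m) →
      Set.InjOn (fun i => ((b, e i) : Bits (N + 1))) (Set.Iio m) :=
    fun he i hi j hj h => he hi hj (Prod.ext_iff.1 h).2
  induction t with
  | gen g =>
    obtain ⟨g⟩ := g
    intro e he
    exact K.place_cons b (γ g) he
  | id n =>
    intro e he
    exact (map_one _).symm
  | comp g f hg hf =>
    obtain rfl := (K.realisation hG γ N).endo f
    intro e he
    exact (congrArg₂ (· * ·) (hg he) (hf he)).trans (map_mul _ _ _).symm
  | add f g hf hg =>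
    intro e he
    exact (congrArg₂ (· * ·) (hf (Realisation.injOn_left he))
      (hg (Realisation.injOn_shift he le_rfl))).trans (map_mul _ _ _).symm
  | swap m n =>
    intro e he
    obtain ⟨σ, hσ⟩ := exists_along_swapFun he
    have h : Along (fun i => ((b, e i) : Bits (N + 1))) (m + n) (swapFun m n)
        (Perm.prodExtendRight b σ) := by
      refine ⟨fun i hi => ?_, fun y hy => ?_⟩
      · exact (Perm.prodExtendRight_apply_eq b σ (e i)).trans (congrArg (Prod.mk b) (hσ.1 i hi))
      · obtain ⟨c, y⟩ := y
        by_cases hc : c = b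
        · subst hc
          exact (Perm.prodExtendRight_apply_eq c σ y).trans
            (congrArg (Prod.mk c) (hσ.2 y fun i hi h => hy i hi (congrArg (Prod.mk c) h)))
        · exact Perm.prodExtendRight_apply_ne σ hc y
    refine ((K.realisation hG γ (N + 1)).val_swap (hb he) h).trans (Eq.trans ?_
      (congrArg (K.C b) ((K.realisation hG γ N).val_swap he hσ)).symm)
    exact K.rho_prodExtendRight b σ

theorem realisation_val_ones {m n : ℕ} (t : PropTerm (RigGen G) m n) {e : ℕ → Bits N}
    (he : Set.InjOn e (Set.Iio m)) : ∀ j : ℕ,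
    (K.realisation hG γ (N + j)).val t (fun i => ones j (e i)) =
      K.Cpow j ((K.realisation hG γ N).val t e)
  | 0 => rfl
  | j + 1 => (K.realisation_val_cons hG γ true t fun _ hi _ hj h =>
      he hi hj (ones_injective j h)).trans
        (congrArg (K.C true) (realisation_val_ones t he j))

theorem realisation_rows_cons (b : Bool) {m n k : ℕ} (t : PropTerm (RigGen G) m n)
    {e : ℕ → Bits N} (he : Set.InjOn e (Set.Iio (k * m))) :
    (K.realisation hG γ (N + 1)).rows t k (fun i => (b, e i)) =
      K.C b ((K.realisation hG γ N).rows t k e) :=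
  (seqProd_congr fun _ hi => K.realisation_val_cons hG γ b t (Realisation.injOn_row he hi)).trans
    (map_seqProd (K.C b) _ k).symm

/-- Expressions on `2 ^ n` positions which act in the same way at all words of length `n` act in the
same way at all sequences of `2 ^ n` words. -/
theorem realisation_val_eq {n l : ℕ} {s t : PropTerm (RigGen G) (2 ^ n) l}
    (h : (K.realisation hG γ n).val s (ofNat n) = (K.realisation hG γ n).val t (ofNat n))
    {e : ℕ → Bits N} (he : Set.InjOn e (Set.Iio (2 ^ n))) :
    (K.realisation hG γ N).val s e = (K.realisation hG γ N).val t e := by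
  obtain ⟨j, hj, σ, hσ⟩ := exists_frame he
  subst hj
  replace hσ : ∀ i < 2 ^ n, σ (ones j (ofNat n i)) = e i := hσ
  have h1 : ∀ r : PropTerm (RigGen G) (2 ^ n) l, (K.realisation hG γ (n + j)).val r e =
      K.rho (n + j) σ * K.Cpow j ((K.realisation hG γ n).val r (ofNat n)) *
        K.rho (n + j) σ⁻¹ := fun r => by
    have h2 := (K.realisation hG γ (n + j)).val_conj r (e := fun i => ones j (ofNat n i))
      (fun _ hi _ hj h => ofNat_injOn n hi hj (ones_injective j h)) σ
    rw [(K.realisation hG γ (n + j)).val_congr r (e := fun i => σ (ones j (ofNat n i))) hσ,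
      K.realisation_val_ones hG γ r (ofNat_injOn n)] at h2
    have h3 : K.rho (n + j) σ * K.Cpow j ((K.realisation hG γ n).val r (ofNat n)) =
      (K.realisation hG γ (n + j)).val r e * K.rho (n + j) σ := h2
    rw [h3, mul_assoc, rho_mul_inv, mul_one]
  rw [h1, h1, h]

end ControlTower

/-! ### The rigged crop acts in the controlled prop -/

/-- The inclusion of `P` in its controlled prop. -/
def ControllableProp.toControlledMap (P : ControllableProp.{u}) :
    P.toPropData.Map P.controlled.toPropData where
  map f := P.toControlled f
  map_id n := Quotient.sound (.of_id n)
  map_comp g f := Quotient.sound (.of_comp g f)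
  map_add f g := Quotient.sound (.of_add f g)
  map_swap m n := Quotient.sound (.of_swap m n)

namespace PropPresentation

open Bits

variable {P : ControllableProp.{u}} (D : PropPresentation.{u, v} P.toStrictProp)

/-- A generator of `P` as an endomorphism in the controlled prop. -/
def genEnd {m n : ℕ} (g : D.Gen m n) : P.controlled.End m :=
  P.controlled.cast rfl (D.gen_endo g).symm (P.toControlled (D.interp m n g))

/-- The expressions of the rigged crop acting in the controlled prop, at the words of length `N`. -/
noncomputable def wordRealisation (N : ℕ) :
    Realisation (PropTerm.data (RigGen D.Gen)) (Bits N) (P.controlled.End N) :=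
  P.tower.realisation D.gen_endo D.genEnd N

theorem wordRealisation_val_castEnd {N N' m n : ℕ} (h : N = N') (t : PropTerm (RigGen D.Gen) m n) :
    (D.wordRealisation N').val t (ofNat N') =
      P.controlled.castEnd h ((D.wordRealisation N).val t (ofNat N)) := by
  subst h; rfl

theorem wordRealisation_cols_castEnd {N N' m n k : ℕ} (h : N = N')
    (t : PropTerm (RigGen D.Gen) m n) :
    (D.wordRealisation N').cols t k (ofNat N') =
      P.controlled.castEnd h ((D.wordRealisation N).cols t k (ofNat N)) := by
  subst h; rfl

theorem grid_injOn {k m N : ℕ} (hN : k + m = N) :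
    Set.InjOn (ofNat N) (Set.Iio (2 ^ k * 2 ^ m)) := by
  rw [← pow_add, hN]
  exact ofNat_injOn N

/-- Copies of an expression on the rows of the grid of all words of length `k + m` are the sum of
the identity of `k` and the value of the expression. -/
theorem wordRealisation_rows {m l : ℕ} (h : PropTerm (RigGen D.Gen) (2 ^ m) l) :
    ∀ (k N : ℕ) (hN : k + m = N), (D.wordRealisation N).rows h (2 ^ k) (ofNat N) =
      P.controlled.castEnd hN (P.controlled.inr k ((D.wordRealisation m).val h (ofNat m)))
  | 0, N, hN => by
    obtain rfl : m = N := by omega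
    rw [P.controlled.castEnd_inr_zero]
    exact (D.wordRealisation m).rows_one h _
  | k + 1, N, hN => by
    obtain ⟨N, rfl⟩ : ∃ N', N = N' + 1 := ⟨N - 1, by omega⟩
    have hN' : k + m = N := by omega
    have he := grid_injOn hN'
    have h0 := (D.wordRealisation (N + 1)).rows_add h (2 ^ k) (2 ^ k) (ofNat (N + 1))
    have h1 := (D.wordRealisation (N + 1)).rows_congr h (k := 2 ^ k) (e := ofNat (N + 1))
      (e' := fun i => (false, ofNat N i)) fun i hi => by
        exact ofNat_of_lt (by rwa [← hN', pow_add])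
    have h2 := (D.wordRealisation (N + 1)).rows_congr h (k := 2 ^ k)
      (e := fun i => ofNat (N + 1) (2 ^ k * 2 ^ m + i))
      (e' := fun i => (true, ofNat N i)) fun i hi => by
        rw [← pow_add, hN'] at hi ⊢
        exact ofNat_two_pow_add hi
    have h3 := P.tower.realisation_rows_cons D.gen_endo D.genEnd false h he
    have h4 := P.tower.realisation_rows_cons D.gen_endo D.genEnd true h he
    rw [pow_succ, Nat.mul_two, h0, h1, h2]
    refine (congrArg₂ (· * ·) h3 h4).trans ?_
    refine (P.towerC_false_mul_true _).trans ?_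
    refine (congrArg (fun z => P.controlled.castEnd (Nat.add_comm 1 N) (P.controlled.inr 1 z))
      (wordRealisation_rows h k N hN')).trans ?_
    rw [← P.controlled.castEnd_inr hN' (by omega),
      ← P.controlled.castEnd_inr_inr (by omega), P.controlled.castEnd_castEnd,
      P.controlled.castEnd_castEnd,
      ← P.controlled.castEnd_inr_congr (Nat.add_comm 1 k) (by omega), P.controlled.castEnd_castEnd]

/-- Copies of an expression on the columns of the grid of all words of length `k + m` are the sum
of the value of the expression and the identity of `m`. -/
theorem wordRealisation_cols {k m l : ℕ} (f : PropTerm (RigGen D.Gen) (2 ^ k) l) :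
    (D.wordRealisation (k + m)).cols f (2 ^ m) (ofNat (k + m)) =
      P.controlled.inl m ((D.wordRealisation k).val f (ofNat k)) := by
  have hmk : m + k = k + m := Nat.add_comm m k
  obtain ⟨_, τ, h1, hτ⟩ := P.controlled.swap_isPermMor m k
  have h2 : (D.wordRealisation (m + k)).rows f (2 ^ m)
      (fun i => wire (m + k) τ (ofNat (m + k) i)) =
      (D.wordRealisation (m + k)).cols f (2 ^ m) (ofNat (m + k)) :=
    (D.wordRealisation (m + k)).rows_eq_cols f fun a ha b hb => wire_ofNat_grid hτ ha hb
  have h3 : SemiconjBy (P.tower.rho (m + k) (wire (m + k) τ)) _ _ :=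
    (D.wordRealisation (m + k)).rows_conj f (grid_injOn rfl) (wire (m + k) τ)
  rw [P.rho_wire, h2, wordRealisation_rows D f m (m + k) rfl, P.controlled.castEnd_rfl] at h3
  have h4 : P.controlled.permHom (m + k) τ *
      P.controlled.inr m ((D.wordRealisation k).val f (ofNat k)) =
      P.controlled.castEnd hmk.symm (P.controlled.inl m ((D.wordRealisation k).val f (ofNat k))) *
        P.controlled.permHom (m + k) τ := by
    rw [← h1]
    have := P.controlled.isProp.swap_natural (P.controlled.id m)
      ((D.wordRealisation k).val f (ofNat k) : P.controlled.End k)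
    have := congrArg (P.controlled.cast rfl hmk.symm) this
    rw [P.controlled.cast_comp rfl rfl, P.controlled.cast_comp rfl hmk.symm] at this
    exact this
  have h5 : (D.wordRealisation (m + k)).cols f (2 ^ m) (ofNat (m + k)) =
      P.controlled.castEnd hmk.symm
        (P.controlled.inl m ((D.wordRealisation k).val f (ofNat k))) := by
    have h6 := h3.eq.symm.trans h4
    calc _ = (D.wordRealisation (m + k)).cols f (2 ^ m) (ofNat (m + k)) *
          P.controlled.permHom (m + k) τ * P.controlled.permHom (m + k) τ⁻¹ := by
          rw [mul_assoc, P.controlled.permHom_mul_inv, mul_one]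
      _ = _ := by rw [h6, mul_assoc, P.controlled.permHom_mul_inv, mul_one]
  rw [D.wordRealisation_cols_castEnd hmk, h5, P.controlled.castEnd_castEnd,
    P.controlled.castEnd_rfl]

theorem rigTerm_endo {m n : ℕ} (f : PropTerm (RigGen D.Gen) (2 ^ m) (2 ^ n)) : m = n :=
  Nat.pow_right_injective le_rfl (f.endo (RigGen.endo D.gen_endo))

/-- The map from expressions of the rigged crop to the controlled prop, by their action at all
words. -/
noncomputable def termMap :
    (PropTerm.data (RigGen D.Gen)).powTwo.Map P.controlled.toPropData where
  map {m n} f := P.controlled.cast rfl (D.rigTerm_endo f)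
    ((D.wordRealisation m).val (m := 2 ^ m) (n := 2 ^ n) f (ofNat m))
  map_id n := (D.wordRealisation n).val_id (ofNat_injOn n)
  map_comp {l m n} g f := by
    obtain rfl := D.rigTerm_endo f
    obtain rfl := D.rigTerm_endo g
    exact (D.wordRealisation _).val_comp (l := 2 ^ l) (m := 2 ^ l) (n := 2 ^ l) g f (ofNat_injOn _)
  map_add {k l m n} f h := by
    obtain rfl := D.rigTerm_endo f
    obtain rfl := D.rigTerm_endo h
    refine ((D.wordRealisation _).val_powTwo_add (k := k) (l := k) (m := m) (n := m) f h
      (ofNat_injOn _)).trans ?_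
    exact (congrArg₂ (· * ·) (D.wordRealisation_cols (l := 2 ^ k) f)
      (D.wordRealisation_rows (l := 2 ^ m) h k (k + m) rfl)).trans (P.controlled.inl_mul_inr _ _)
  map_swap m n := by
    obtain ⟨hmn, τ, h1, hτ⟩ := P.controlled.swap_isPermMor m n
    obtain ⟨σ, h2, h3, -⟩ := (D.wordRealisation (m + n)).val_mulSwap (2 ^ m) (2 ^ n)
      (grid_injOn rfl)
    have h4 : wire (m + n) τ = σ := by
      ext1 a
      obtain ⟨i, hi, rfl⟩ := exists_ofNat a
      rw [pow_add] at hi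
      revert i
      refine Realisation.forall_grid fun a ha b hb => ?_
      rw [h3 a ha b hb, wire_ofNat_grid hτ ha hb]
    have h5 : (D.wordRealisation (m + n)).val (m := 2 ^ (m + n)) (n := 2 ^ (n + m))
        ((PropTerm.data (RigGen D.Gen)).powTwo.swap m n) (ofNat (m + n)) =
        P.controlled.cast rfl hmn.symm (P.controlled.swap m n) := by
      refine (((D.wordRealisation (m + n)).val_cast _ _ _ _).trans h2).trans ?_
      rw [h1, ← h4]
      exact P.rho_wire (m + n) τ
    refine (congrArg (P.controlled.cast rfl hmn) h5).trans ?_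
    rw [P.controlled.cast_cast]
    rfl

theorem termMap_gen {m n : ℕ} (g : D.Gen m n) :
    D.termMap.map (m := m) (n := n) (.gen (.tilde g)) = P.toControlled (D.interp m n g) := by
  obtain rfl := D.gen_endo g
  exact P.tower.place_ofNat (D.genEnd g)

theorem termMap_tilde {m n : ℕ} (t : PropTerm D.Gen m n) :
    D.termMap.map t.tilde = P.toControlled (t.eval P.toPropData D.interp) := by
  refine (D.termMap.map_eval _ t).trans
    (Eq.trans ?_ (P.toControlledMap.map_eval D.interp t).symm)
  congr 1
  funext m n g
  exact D.termMap_gen g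

/-- Expressions with the same image in the controlled prop act in the same way at all words. -/
theorem wordRealisation_val_eq {m n N : ℕ} {s t : PropTerm (RigGen D.Gen) (2 ^ m) (2 ^ n)}
    (h : D.termMap.map (m := m) (n := n) s = D.termMap.map (m := m) (n := n) t) {e : ℕ → Bits N}
    (he : Set.InjOn e (Set.Iio (2 ^ m))) :
    (D.wordRealisation N).val s e = (D.wordRealisation N).val t e := by
  obtain rfl := D.rigTerm_endo s
  exact P.tower.realisation_val_eq D.gen_endo D.genEnd h he

variable (X : PropTerm D.Gen 1 1)

/-- The symmetry `γ_{1,1}` acts on words of length one as the involution. -/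
theorem termMap_swap : D.termMap.map (m := 1) (n := 1)
    ((PropTerm.data (RigGen D.Gen)).cast (pow_one 2).symm (pow_one 2).symm (.swap 1 1)) =
      P.controlled.x := by
  have h : Along (ofNat 1) (1 + 1) (swapFun 1 1) (flip 0) := by
    refine ⟨fun i hi => ?_, fun y hy => ?_⟩
    · interval_cases i <;> rfl
    · obtain ⟨i, hi, rfl⟩ := exists_ofNat y
      exact absurd rfl (hy i hi)
  refine ((D.wordRealisation 1).val_cast _ _ _ _).trans
    (((D.wordRealisation 1).val_swap (ofNat_injOn 1) h).trans ?_)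
  refine (P.tower.rho_flip 0).trans ?_
  exact P.controlled.inl_zero P.controlled.x

/-- The relations of the rigged crop hold in the action on words. By `wordRealisation_val_eq`, they
need only be checked in the controlled prop, where tensor products have become sums. -/
theorem wordRealisation_val_eq_of_rel (hX : X.eval P.toPropData D.interp = P.x) {m n : ℕ}
    {s t : PropTerm (RigGen D.Gen) m n}
    (h : RigRel D.Rel X m n s t) {N : ℕ} {e : ℕ → Bits N}
    (he : Set.InjOn e (Set.Iio m)) :
    (D.wordRealisation N).val s e = (D.wordRealisation N).val t e := by
  cases h with
  | @interchange k l m n f h =>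
    refine D.wordRealisation_val_eq (m := k + m) (n := l + n) ?_ he
    refine (D.termMap.map_comp (l := k + m) (m := k + n) (n := l + n) _ _).trans (Eq.trans ?_
      (D.termMap.map_comp (l := k + m) (m := l + m) (n := l + n) _ _).symm)
    rw [termMap_tilde, termMap_tilde, termMap_tilde, termMap_tilde]
    refine ((P.toControlledMap.map_comp _ _).symm.trans ?_).trans (P.toControlledMap.map_comp _ _)
    congr 1
    simp only [PropTerm.eval]
    rw [← P.isProp.add_comp, ← P.isProp.add_comp, P.isProp.id_comp, P.isProp.id_comp,
      P.isProp.comp_id, P.isProp.comp_id]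
  | @base m n s t h =>
    refine D.wordRealisation_val_eq (m := m) (n := n) ?_ he
    rw [termMap_tilde, termMap_tilde, (D.eval_eq_iff s t).2 (.rel h)]
  | not =>
    refine D.wordRealisation_val_eq (m := 1) (n := 1) ?_ he
    rw [termMap_tilde, termMap_swap, hX]
    rfl

/-- The map from the powers of `2` in the rigged crop to the controlled prop, which records the
action of a morphism at all words. -/
noncomputable def rigMap (hX : X.eval P.toPropData D.interp = P.x) :
    (D.rig X).powTwo.Map P.controlled.toPropData where
  map {m n} := Quotient.lift (D.termMap.map (m := m) (n := n)) fun s t h =>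
    congrArg (P.controlled.cast rfl (D.rigTerm_endo s)) <|
      (D.wordRealisation m).val_eq_of_cong (fun _ _ _ _ h _ he =>
        D.wordRealisation_val_eq_of_rel X hX h he) h (ofNat_injOn m)
  map_id n := D.termMap.map_id n
  map_comp {l m n} g f := by
    induction g using Quotient.ind with | _ g =>
    induction f using Quotient.ind with | _ f =>
    exact D.termMap.map_comp (l := l) (m := m) (n := n) g f
  map_add {k l m n} f g := by
    induction g using Quotient.ind with | _ g =>
    induction f using Quotient.ind with | _ f =>
    refine Eq.trans ?_ (D.termMap.map_add (k := k) (l := l) (m := m) (n := n) f g)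
    exact congrArg (Quotient.lift (D.termMap.map (m := k + m) (n := l + n)) _)
      ((presentedMap (RigGen D.Gen) (RigRel D.Rel X)).powTwo.map_add
        (k := k) (l := l) (m := m) (n := n) f g).symm
  map_swap m n := by
    refine Eq.trans ?_ (D.termMap.map_swap m n)
    exact congrArg (Quotient.lift (D.termMap.map (m := m + n) (n := n + m)) _)
      ((presentedMap (RigGen D.Gen) (RigRel D.Rel X)).powTwo.map_swap m n).symm

theorem termMap_ctl (b : Bool) {n : ℕ} (f : PropTerm (RigGen D.Gen) (2 ^ n) (2 ^ n)) :
    D.termMap.map (m := 1 + n) (n := 1 + n)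
      (StrictProp.ctl (PropTerm.data (RigGen D.Gen)) b f) =
      P.C b (D.termMap.map (m := n) (n := n) f) := by
  have h1 := D.wordRealisation_val_castEnd (Nat.add_comm n 1)
    (StrictProp.ctl (PropTerm.data (RigGen D.Gen)) b f)
  have h2 : (D.wordRealisation (n + 1)).val (StrictProp.ctl (PropTerm.data (RigGen D.Gen)) b f)
      (ofNat (n + 1)) = P.towerC b ((D.wordRealisation n).val f (ofNat n)) := by
    have he : Set.InjOn (ofNat (n + 1)) (Set.Iio (2 ^ (1 + n))) := by
      rw [Nat.add_comm]; exact ofNat_injOn _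
    refine Eq.trans ?_ (P.tower.realisation_val_cons D.gen_endo D.genEnd b f (ofNat_injOn n))
    cases b
    · refine ((D.wordRealisation (n + 1)).val_ctl_false f he).trans
        ((D.wordRealisation (n + 1)).val_congr f fun i hi => ?_)
      exact ofNat_of_lt hi
    · refine ((D.wordRealisation (n + 1)).val_ctl_true f he).trans
        ((D.wordRealisation (n + 1)).val_congr f fun i hi => ?_)
      exact ofNat_two_pow_add hi
  refine h1.trans ((congrArg (P.controlled.castEnd _) h2).trans ?_)
  rw [P.towerC_apply, P.controlled.castEnd_castEnd]
  rfl

/-- The map to the controlled prop takes block sums with an identity to control operators. -/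
theorem rigMap_ctl (hX : X.eval P.toPropData D.interp = P.x) (b : Bool) {n : ℕ}
    (f : (D.rig X).Hom (2 ^ n) (2 ^ n)) :
    (D.rigMap X hX).map (m := 1 + n) (n := 1 + n) (StrictProp.ctl (D.rig X).toPropData b f) =
      P.C b ((D.rigMap X hX).map (m := n) (n := n) f) := by
  induction f using Quotient.ind with | _ f =>
  refine Eq.trans ?_ (D.termMap_ctl b f)
  refine congrArg (Quotient.lift (D.termMap.map (m := 1 + n) (n := 1 + n)) _)
    (Eq.trans ?_ ((presentedMap (RigGen D.Gen) (RigRel D.Rel X)).map_cast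
      (two_pow_add_self n) (two_pow_add_self n) _).symm)
  cases b <;> rfl

/-- The map from the rigged crop is a left inverse of the map from the controlled prop, as is
checked on the expressions of the controlled prop. -/
theorem rigMap_ctrlMap (hX : X.eval P.toPropData D.interp = P.x) {m n : ℕ}
    (f : P.controlled.Hom m n) : (D.rigMap X hX).map ((D.ctrlMap X hX).map f) = f := by
  induction f using Quotient.ind with | _ t =>
  induction t with
  | of f =>
    obtain ⟨t, rfl⟩ := D.surjective f
    refine (congrArg (D.rigMap X hX).map (D.ctrlMap_toControlled X hX t)).trans ?_
    refine ((D.rigMap X hX).map_eval _ t).trans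
      (Eq.trans ?_ (P.toControlledMap.map_eval D.interp t).symm)
    congr 1
    funext m n g
    exact D.termMap_gen g
  | id n => exact (D.rigMap X hX).map_id n
  | comp g f hg hf => exact ((D.rigMap X hX).map_comp _ _).trans (congrArg₂ P.controlled.comp hg hf)
  | add f g hf hg => exact ((D.rigMap X hX).map_add _ _).trans (congrArg₂ P.controlled.add hf hg)
  | swap m n => exact (D.rigMap X hX).map_swap m n
  | ctrl b f hf => exact (D.rigMap_ctl X hX b _).trans (congrArg (P.C b) hf)

end PropPresentation

/-! ### Every morphism between powers of `2` comes from the controlled prop -/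

/-- `f` permutes the positions `0, …, 2 ^ n - 1`, read as words, by `σ`. -/
def StrictProp.IsWordPerm (Q : StrictProp.{u}) {n : ℕ} (f : Q.Hom (2 ^ n) (2 ^ n))
    (σ : Perm (Bits n)) : Prop :=
  ∃ p : ℕ → ℕ, Q.IsPermMor f p ∧ ∀ i < 2 ^ n, Bits.ofNat n (p i) = σ (Bits.ofNat n i)

namespace StrictProp.IsWordPerm

open Bits

variable {Q : StrictProp.{u}}

theorem id (n : ℕ) : Q.IsWordPerm (Q.id (2 ^ n)) (1 : Perm (Bits n)) :=
  ⟨_, IsPermMor.id _, fun _ _ => rfl⟩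

theorem comp {n : ℕ} {g f : Q.Hom (2 ^ n) (2 ^ n)} {σ τ : Perm (Bits n)} (hg : Q.IsWordPerm g σ)
    (hf : Q.IsWordPerm f τ) : Q.IsWordPerm (Q.comp g f) (σ * τ) := by
  obtain ⟨q, g1, g2⟩ := hg
  obtain ⟨p, f1, f2⟩ := hf
  exact ⟨_, g1.comp f1, fun i hi => by rw [g2 _ (f1.lt hi), f2 i hi, Perm.mul_apply]⟩

/-- Block sums with an identity permute the words with a given first bit. -/
theorem ctl (c : Bool) {n : ℕ} {f : Q.Hom (2 ^ n) (2 ^ n)} {σ : Perm (Bits n)}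
    (hf : Q.IsWordPerm f σ) {h : 2 ^ (1 + n) = 2 ^ (n + 1)} :
    Q.IsWordPerm (n := n + 1) (Q.cast h h (ctl Q.toPropData c f))
      (Perm.prodExtendRight c σ) := by
  obtain ⟨p, f1, f2⟩ := hf
  cases c
  · refine ⟨_, IsPermMor.cast _ _ (IsPermMor.cast _ _ (f1.add (IsPermMor.id _))), fun i hi => ?_⟩
    rw [pow_succ, Nat.mul_two] at hi
    split_ifs with h1
    · rw [ofNat_of_lt (f1.lt h1), ofNat_of_lt h1, f2 i h1]
      exact (Perm.prodExtendRight_apply_eq false σ _).symm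
    · obtain ⟨j, rfl⟩ := Nat.exists_eq_add_of_le (not_lt.1 h1)
      rw [Nat.add_sub_cancel_left, ofNat_two_pow_add (by omega)]
      exact (Perm.prodExtendRight_apply_ne σ (by simp) _).symm
  · refine ⟨_, IsPermMor.cast _ _ (IsPermMor.cast _ _ ((IsPermMor.id _).add f1)), fun i hi => ?_⟩
    rw [pow_succ, Nat.mul_two] at hi
    split_ifs with h1
    · rw [ofNat_of_lt h1]
      exact (Perm.prodExtendRight_apply_ne σ (by simp) _).symm
    · obtain ⟨j, rfl⟩ := Nat.exists_eq_add_of_le (not_lt.1 h1)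
      have hj : j < 2 ^ n := by omega
      rw [Nat.add_sub_cancel_left, ofNat_two_pow_add (f1.lt hj), ofNat_two_pow_add hj, f2 j hj]
      exact (Perm.prodExtendRight_apply_eq true σ _).symm

/-- The symmetry of the tensor product exchanges the first two bits. -/
theorem swap (hQ : ∀ {m n : ℕ}, Q.Hom m n → m = n) (n : ℕ) {h : 2 ^ (2 + n) = 2 ^ (n + 2)} :
    Q.IsWordPerm (n := n + 2)
      (Q.cast h h (Q.powTwo.add (Q.powTwo.swap 1 1) (Q.id (2 ^ n)))) (exch n) := by
  refine ⟨_, IsPermMor.cast _ _ (IsPermMor.cast _ _ ((powTwo_swap_isPermMor hQ 1 1).kron hQ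
    (IsPermMor.id (2 ^ n)) (by positivity) (by positivity))), ?_⟩
  rw [show 2 ^ (n + 2) = 4 * 2 ^ n by ring]
  refine Realisation.forall_grid fun a ha b hb => ?_
  rw [Realisation.div_grid hb, Realisation.mod_grid hb]
  have h1 : ∀ a, ofNat (n + 2) (a * 2 ^ n + b) =
      (a.testBit 1, a.testBit 0, ofNat n b) := fun a => by
    rw [ofNat_succ, ofNat_succ, ofNat_grid_low, testBit_grid_high hb 1, ← testBit_grid_high hb 0]
    rfl
  rw [h1, h1]
  interval_cases a <;> rfl

end StrictProp.IsWordPerm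

namespace PropPresentation

open Bits

variable {P : ControllableProp.{u}} (D : PropPresentation.{u, v} P.toStrictProp)
  (X : PropTerm D.Gen 1 1) (hX : X.eval P.toPropData D.interp = P.x)

/-- The map from the controlled prop on endomorphisms. -/
noncomputable def ctrlHom (n : ℕ) : P.controlled.End n →* (D.rig X).End (2 ^ n) where
  toFun f := (D.ctrlMap X hX).map f
  map_one' := (D.ctrlMap X hX).map_id n
  map_mul' g f := (D.ctrlMap X hX).map_comp g f

theorem ctrlHom_castEnd {m n : ℕ} (h : m = n) (f : P.controlled.End m) :
    D.ctrlHom X hX n (P.controlled.castEnd h f) =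
      (D.rig X).cast (congrArg (2 ^ ·) h) (congrArg (2 ^ ·) h) (D.ctrlHom X hX m f) := by
  subst h; rfl

theorem ctrlHom_C (b : Bool) {n : ℕ} (f : P.controlled.End n) :
    D.ctrlHom X hX (n + 1) (P.tower.C b f) =
      (D.rig X).cast (congrArg (2 ^ ·) (Nat.add_comm 1 n)) (congrArg (2 ^ ·) (Nat.add_comm 1 n))
        (StrictProp.ctl (D.rig X).toPropData b (D.ctrlHom X hX n f)) :=
  (D.ctrlHom_castEnd X hX _ _).trans (congrArg _ (D.ctrlMap_C X hX b f))

theorem ctrlMap_x : (D.ctrlMap X hX).map P.controlled.x =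
    (D.rig X).cast (pow_one 2).symm (pow_one 2).symm ((D.rig X).swap 1 1) := by
  refine Eq.trans ?_ ((D.ctrlMap_toControlled X hX X).trans (D.rigEval_not X))
  rw [hX]
  rfl

theorem isWordPerm_exch (n : ℕ) :
    (D.rig X).IsWordPerm (D.ctrlHom X hX (n + 2) (P.tower.rho (n + 2) (exch n))) (exch n) := by
  have h : D.ctrlHom X hX (n + 2) (P.tower.rho (n + 2) (exch n)) =
      (D.rig X).cast (congrArg (2 ^ ·) (Nat.add_comm 2 n)) (congrArg (2 ^ ·) (Nat.add_comm 2 n))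
        ((D.rig X).powTwo.add ((D.rig X).powTwo.swap 1 1) ((D.rig X).id (2 ^ n))) := by
    rw [P.tower.rho_exch]
    refine (D.ctrlHom_castEnd X hX _ _).trans (congrArg _ ?_)
    exact ((D.ctrlMap X hX).map_add (P.controlled.swap 1 1) (P.controlled.id n)).trans
      (congrArg₂ (D.rig X).powTwo.add ((D.ctrlMap X hX).map_swap 1 1)
        ((D.ctrlMap X hX).map_id n))
  rw [h]
  exact StrictProp.IsWordPerm.swap (D.rig_endo X) n

theorem isWordPerm_prodExtendRight (c : Bool) {n : ℕ} {σ : Perm (Bits n)}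
    (h : (D.rig X).IsWordPerm (D.ctrlHom X hX n (P.tower.rho n σ)) σ) :
    (D.rig X).IsWordPerm (n := n + 1)
      (D.ctrlHom X hX (n + 1) (P.tower.rho (n + 1) (Perm.prodExtendRight c σ)))
      (Perm.prodExtendRight c σ) := by
  rw [P.tower.rho_prodExtendRight, ctrlHom_C]
  exact h.ctl c

theorem isWordPerm_mul {n : ℕ} {σ τ : Perm (Bits n)}
    (h : (D.rig X).IsWordPerm (D.ctrlHom X hX n (P.tower.rho n σ)) σ)
    (h' : (D.rig X).IsWordPerm (D.ctrlHom X hX n (P.tower.rho n τ)) τ) :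
    (D.rig X).IsWordPerm (D.ctrlHom X hX n (P.tower.rho n (σ * τ))) (σ * τ) := by
  rw [map_mul, map_mul]
  exact h.comp h'

/-- The multiply controlled negations are sent to transpositions of positions. -/
theorem isWordPerm_swap : ∀ {n : ℕ} (a : Bits n), (D.rig X).IsWordPerm (n := n + 1)
    (D.ctrlHom X hX (n + 1) (P.tower.rho (n + 1) (swap (α := Bits (n + 1)) (false, a) (true, a))))
    (swap (α := Bits (n + 1)) (false, a) (true, a))
  | 0, a => by
    rw [P.tower.rho_swap]
    have h : D.ctrlHom X hX 1 (P.tower.mcx a) =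
        (D.rig X).cast (pow_one 2).symm (pow_one 2).symm ((D.rig X).swap 1 1) :=
      (congrArg (D.ctrlHom X hX 1) (P.controlled.inl_zero P.controlled.x)).trans
        (D.ctrlMap_x X hX)
    rw [h]
    refine ⟨_, StrictProp.IsPermMor.cast _ _ ((D.rig X).swap_isPermMor 1 1), fun i hi => ?_⟩
    have h0 : ofNat 1 0 = (false, a) := rfl
    have h1 : ofNat 1 1 = (true, a) := rfl
    change i < 2 at hi
    interval_cases i
    · exact h1.trans (swap_apply_left (α := Bits 1) (false, a) (true, a)).symm
    · exact h0.trans (swap_apply_right (α := Bits 1) (false, a) (true, a)).symm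
  | n + 1, (c, a) => by
    have h : swap (α := Bits (n + 2)) (false, c, a) (true, c, a) =
        exch n * Perm.prodExtendRight (β₁ := Bits (n + 1)) c
          (swap (α := Bits (n + 1)) (false, a) (true, a)) * exch n := by
      have h1 := swap_apply_apply (exch n) (c, false, a) (c, true, a)
      refine Eq.trans ?_ (h1.trans ?_)
      · rfl
      · rw [exch_inv, Perm.prodExtendRight_swap]
    rw [h]
    exact D.isWordPerm_mul X hX (D.isWordPerm_mul X hX (D.isWordPerm_exch X hX n)
      (D.isWordPerm_prodExtendRight X hX c (isWordPerm_swap a))) (D.isWordPerm_exch X hX n)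

/-- The action of permutations of words in the controlled prop is sent to the action of
permutations of positions in the rigged crop. -/
theorem isWordPerm_rho : ∀ {n : ℕ} (σ : Perm (Bits n)),
    (D.rig X).IsWordPerm (D.ctrlHom X hX n (P.tower.rho n σ)) σ
  | 0, σ => by
    have : σ = 1 := Equiv.ext fun _ => rfl
    rw [this, map_one, map_one]
    exact StrictProp.IsWordPerm.id 0
  | n + 1, σ => by
    have hσ : σ ∈ Submonoid.closure {τ : Perm (Bits (n + 1)) | τ.IsSwap} := by
      have := Finite.of_equiv _ (get (n + 1)).symm
      rw [Perm.mclosure_isSwap]; trivial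
    induction hσ using Submonoid.closure_induction with
    | one =>
      rw [map_one, map_one]
      exact StrictProp.IsWordPerm.id _
    | mul σ τ _ _ h1 h2 => exact D.isWordPerm_mul X hX h1 h2
    | mem τ h =>
      have hv : ∀ c (a : Bits n), (D.rig X).IsWordPerm (n := n + 1)
          (D.ctrlHom X hX (n + 1) (P.tower.rho (n + 1) (swap (α := Bits (n + 1)) (c, a) (!c, a))))
          (swap (α := Bits (n + 1)) (c, a) (!c, a)) := fun c a => by
        cases c
        · exact D.isWordPerm_swap X hX a
        · have := D.isWordPerm_swap X hX a
          rwa [swap_comm] at this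
      obtain ⟨⟨b, x⟩, ⟨c, y⟩, -, rfl⟩ := h
      by_cases hbc : c = b
      · subst hbc
        have := D.isWordPerm_prodExtendRight X hX c (isWordPerm_rho (swap x y))
        rwa [Perm.prodExtendRight_swap] at this
      · obtain rfl : c = !b := by cases b <;> cases c <;> simp_all
        have h1 := D.isWordPerm_prodExtendRight X hX (!b) (isWordPerm_rho (swap x y))
        have h2 := D.isWordPerm_mul X hX (D.isWordPerm_mul X hX h1 (hv b x)) h1
        have h3 := swap_eq_conj_prodExtendRight b x y
        rwa [← h3] at h2

/-- Every permutation of `2 ^ n` positions comes from the controlled prop. -/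
theorem exists_ctrlHom_eq_permHom (n : ℕ) (τ : Perm (Fin (2 ^ n))) :
    ∃ f, D.ctrlHom X hX n f = (D.rig X).permHom (2 ^ n) τ := by
  have hb : Function.Bijective fun i : Fin (2 ^ n) => ofNat n i :=
    ⟨fun i j h => Fin.ext (ofNat_injOn n i.2 j.2 h), fun a => by
      obtain ⟨i, hi, rfl⟩ := exists_ofNat a
      exact ⟨⟨i, hi⟩, rfl⟩⟩
  let φ := Equiv.ofBijective _ hb
  obtain ⟨p, h1, h2⟩ := D.isWordPerm_rho X hX (φ.permCongr τ)
  refine ⟨_, h1.eq ⟨rfl, τ, rfl, fun i => ?_⟩⟩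
  have h3 : ofNat n (p i) = ofNat n (τ i) := (h2 i i.2).trans <| by
    change φ (τ (φ.symm (φ i))) = φ (τ i)
    rw [φ.symm_apply_apply]
  exact (ofNat_injOn n (h1.lt i.2) (τ i).2 h3).symm

/-- The generator `g̃` at the last `2 ^ k` of `2 ^ (k + j)` positions is the image of an iterated
control of `g`. -/
theorem exists_val_ctrlHom_eq_gen {k l : ℕ} (g : D.Gen k l) (j : ℕ) :
    ∃ w : P.controlled.End (k + j), ∀ (M : ℕ) (e : ℕ → Fin M),
      Set.InjOn e (Set.Iio (2 ^ (k + j))) →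
      ((D.rig X).selfRealisation (D.rig_endo X) M).val (D.ctrlHom X hX (k + j) w) e =
        ((D.rig X).selfRealisation (D.rig_endo X) M).val (riggedGen D.Rel X g)
          fun i => e (2 ^ (k + j) - 2 ^ k + i) := by
  induction j with
  | zero =>
    obtain rfl := D.gen_endo g
    refine ⟨P.toControlled (D.interp k k g), fun M e he => ?_⟩
    have h : D.ctrlHom X hX k (P.toControlled (D.interp k k g)) = riggedGen D.Rel X g :=
      D.ctrlMap_toControlled X hX (.gen g)
    refine (congrArg (fun z => ((D.rig X).selfRealisation (D.rig_endo X) M).val z e) h).trans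
      (Realisation.val_congr _ _ fun i _ => congrArg e ?_)
    rw [Nat.add_zero, Nat.sub_self, Nat.zero_add]
  | succ j ih =>
    obtain ⟨w, hw⟩ := ih
    refine ⟨P.tower.C true w, fun M e he => ?_⟩
    have h : 2 ^ (k + (j + 1)) = 2 ^ (k + j) + 2 ^ (k + j) := by ring
    have hk : 2 ^ k ≤ 2 ^ (k + j) := Nat.pow_le_pow_right (by norm_num) (by omega)
    have he1 : Set.InjOn e (Set.Iio (2 ^ (1 + (k + j)))) := by
      rwa [Nat.add_comm 1]
    refine (congrArg (fun z => ((D.rig X).selfRealisation (D.rig_endo X) M).val z e)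
      (D.ctrlHom_C X hX true w)).trans ?_
    refine (Realisation.val_cast _ _ _ _ _).trans ((Realisation.val_ctl_true _ _ he1).trans ?_)
    rw [h] at he
    refine (hw M _ (Realisation.injOn_shift he le_rfl)).trans
      (Realisation.val_congr _ _ fun i hi => congrArg e ?_)
    omega

/-- A morphism of the rigged crop, between any objects, placed at any of `2 ^ n` positions comes
from the controlled prop. In this form the claim can be proved by induction on expressions of the
rigged crop, whose subexpressions need not be between powers of `2`. -/
theorem exists_ctrlHom_eq_val (n : ℕ) {a b : ℕ} (f : (D.rig X).Hom a b) :
    ∀ e : ℕ → Fin (2 ^ n), Set.InjOn e (Set.Iio a) →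
      ∃ w, D.ctrlHom X hX n w =
        ((D.rig X).selfRealisation (D.rig_endo X) (2 ^ n)).val f e := by
  have mul : ∀ {x y : (D.rig X).End (2 ^ n)}, (∃ w, D.ctrlHom X hX n w = x) →
      (∃ w, D.ctrlHom X hX n w = y) → ∃ w, D.ctrlHom X hX n w = x * y := by
    rintro _ _ ⟨w, rfl⟩ ⟨w', rfl⟩
    exact ⟨w * w', map_mul _ _ _⟩
  induction f using presentedProp_induction with
  | gen g =>
    intro e he
    obtain ⟨g⟩ := g
    rename_i k l
    have hk : 2 ^ k ≤ 2 ^ n := by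
      have := Fintype.card_le_of_injective (fun i : Fin (2 ^ k) => e i)
        fun i j h => Fin.ext (he i.2 j.2 h)
      simpa using this
    obtain ⟨j, rfl⟩ := Nat.exists_eq_add_of_le ((Nat.pow_le_pow_iff_right (by norm_num)).1 hk)
    have he0 : Set.InjOn (Fin.ofNat (2 ^ (k + j))) (Set.Iio (2 ^ (k + j))) :=
      fun i hi i' hi' h => by
        have := Fin.ext_iff.1 h
        simpa [Fin.ofNat, Nat.mod_eq_of_lt hi, Nat.mod_eq_of_lt hi'] using this
    obtain ⟨w, hw⟩ := D.exists_val_ctrlHom_eq_gen X hX g j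
    have hw := hw _ _ he0
    have he1 := Realisation.injOn_shift he0
      (show 2 ^ (k + j) - 2 ^ k + 2 ^ k ≤ 2 ^ (k + j) by omega)
    obtain ⟨σ, hσ⟩ := exists_perm_map he1 he
    have h1 := ((D.rig X).selfRealisation (D.rig_endo X) _).val_conj (riggedGen D.Rel X g) he1 σ
    rw [Realisation.val_congr _ _ hσ, ← hw] at h1
    have h2 : ((D.rig X).selfRealisation (D.rig_endo X) _).val (riggedGen D.Rel X g) e =
        (D.rig X).permHom _ σ * D.ctrlHom X hX (k + j) w * (D.rig X).permHom _ σ⁻¹ := by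
      have h3 : (D.rig X).permHom _ σ * D.ctrlHom X hX (k + j) w =
          ((D.rig X).selfRealisation (D.rig_endo X) _).val (riggedGen D.Rel X g) e *
            (D.rig X).permHom _ σ := by
        refine Eq.trans ?_ h1.eq
        congr 1
        exact ((D.rig X).selfVal_ofNat _).symm
      rw [h3, mul_assoc, StrictProp.permHom_mul_inv, mul_one]
    obtain ⟨z, hz⟩ := mul (mul (D.exists_ctrlHom_eq_permHom X hX _ σ) ⟨w, rfl⟩)
      (D.exists_ctrlHom_eq_permHom X hX _ σ⁻¹)
    exact ⟨z, hz.trans h2.symm⟩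
  | id m =>
    intro e he
    exact ⟨1, (map_one _).trans (Realisation.val_id _ he).symm⟩
  | comp g f hg hf =>
    intro e he
    obtain rfl := D.rig_endo X f
    obtain ⟨z, hz⟩ := mul (hg e he) (hf e he)
    exact ⟨z, hz.trans (Realisation.val_comp _ g f he).symm⟩
  | add f g hf hg =>
    intro e he
    obtain ⟨z, hz⟩ := mul (hf e (Realisation.injOn_left he))
      (hg _ (Realisation.injOn_shift he le_rfl))
    exact ⟨z, hz.trans (Realisation.val_add _ f g he).symm⟩
  | swap m l =>
    intro e he
    obtain ⟨σ, hσ⟩ := exists_along_swapFun he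
    obtain ⟨z, hz⟩ := D.exists_ctrlHom_eq_permHom X hX n σ
    exact ⟨z, hz.trans
      (((D.rig X).selfRealisation (D.rig_endo X) (2 ^ n)).val_swap he hσ).symm⟩

theorem ctrlMap_surjective {m n : ℕ} (f : (D.rig X).powTwo.Hom m n) :
    ∃ w, (D.ctrlMap X hX).map w = f := by
  obtain rfl := Nat.pow_right_injective le_rfl (D.rig_endo X (m := 2 ^ m) (n := 2 ^ n) f)
  have he0 : Set.InjOn (Fin.ofNat (2 ^ m)) (Set.Iio (2 ^ m)) := fun i hi i' hi' h => by
    have := Fin.ext_iff.1 h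
    simpa [Fin.ofNat, Nat.mod_eq_of_lt hi, Nat.mod_eq_of_lt hi'] using this
  obtain ⟨w, hw⟩ := D.exists_ctrlHom_eq_val X hX m (a := 2 ^ m) (b := 2 ^ m) f _ he0
  exact ⟨w, hw.trans ((D.rig X).selfVal_ofNat (M := 2 ^ m) f)⟩

/-- The isomorphism from the controlled prop to the powers of `2` in the rigged crop. -/
noncomputable def ctrlIso : P.controlled.Iso (D.rig X).powTwo where
  map := (D.ctrlMap X hX).map
  bijective _ _ :=
    ⟨Function.LeftInverse.injective (D.rigMap_ctrlMap X hX), D.ctrlMap_surjective X hX⟩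
  map_id := (D.ctrlMap X hX).map_id
  map_comp := (D.ctrlMap X hX).map_comp
  map_add := (D.ctrlMap X hX).map_add
  map_swap := (D.ctrlMap X hX).map_swap

end PropPresentation

theorem mainTheorem1 (P : ControllableProp.{u}) (D : PropPresentation.{u, v} P.toStrictProp)
    (X : PropTerm D.Gen 1 1) (hX : X.eval P.toPropData D.interp = P.x) :
    (riggedCrop D.Gen D.Rel X).powTwo.IsProp ∧
      ∃ A : P.controlled.Iso (riggedCrop D.Gen D.Rel X).powTwo,
        A.map P.controlled.x =
            (riggedCrop D.Gen D.Rel X).cast (pow_one 2).symm (pow_one 2).symm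
              ((riggedCrop D.Gen D.Rel X).swap 1 1) ∧
        (∀ (k l : ℕ) (g : D.Gen k l),
          A.map (P.toControlled (D.interp k l g)) = riggedGen D.Rel X g) ∧
        (∀ (n : ℕ) (f : P.controlled.Hom n n),
          A.map (P.C true f) =
            (riggedCrop D.Gen D.Rel X).cast (two_pow_add_self n) (two_pow_add_self n)
              ((riggedCrop D.Gen D.Rel X).add ((riggedCrop D.Gen D.Rel X).id (2 ^ n))
                (A.map f))) ∧
        (∀ (n : ℕ) (f : P.controlled.Hom n n),
          A.map (P.C false f) =
            (riggedCrop D.Gen D.Rel X).cast (two_pow_add_self n) (two_pow_add_self n)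
              ((riggedCrop D.Gen D.Rel X).add (A.map f)
                ((riggedCrop D.Gen D.Rel X).id (2 ^ n)))) :=
  ⟨D.rig_powTwo_isProp X, D.ctrlIso X hX, D.ctrlMap_x X hX,
    fun _ _ g => D.ctrlMap_toControlled X hX (.gen g),
    fun _ f => D.ctrlMap_C X hX true f, fun _ f => D.ctrlMap_C X hX false f⟩
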